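/- Let $(\mathcal M,g)$ be a smooth five-dimensional Lorentzian manifold (signature $(-,+,+,+,+)$) with Levi-Civita connection $\nabla$, and suppose that it carries a smooth null frame, i.e. real vector fields $k,\ell,u$ and a complex vector field $m$ with $$g_{ab}=2k_{(a}\ell_{b)}+2m_{(a}\bar m_{b)}+u_au_b .$$ An almost optical structure $(\mathcal N,\mathcal K)$ consists of a totally null complex rank-$2$ subbundle $\mathcal N$ of $\mathbb C\otimes T\mathcal M$ and a real line subbundle $\mathcal K\subset T\mathcal M$ with $\mathcal N\cap\overline{\mathcal N}=\mathbb C\otimes\mathcal K$. It is called an (integrable) optical structure if both $\mathcal N$ and its orthogonal complement $\mathcal N^\perp$ (for the complexified metric) are integrable in the sense of Frobenius: $[\Gamma(\mathcal N),\Gamma(\mathcal N)]\subset\Gamma(\mathcal N)$ and $[\Gamma(\mathcal N^\perp),\Gamma(\mathcal N^\perp)]\subset\Gamma(\mathcal N^\perp)$. The frame defines two almost optical structures $(\mathcal N_0,\mathcal L)$ and $(\mathcal N_1,\mathcal K)$ by $$\mathcal N_0=\mathrm{span}\{\ell,\bar m\},\quad \mathcal L=\mathrm{span}\{\ell\},\qquad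 \mathcal N_1=\mathrm{span}\{k,\bar m\},\quad \mathcal K=\mathrm{span}\{k\}.$$ Let $P=\tfrac13\left(\mathrm{Ric}-\tfrac18 S\,g\right)$ be the Rho (Schouten) tensor, where $S$ is the scalar curvature. Let $C$ be the Weyl tensor, defined by $R_{abcd}=C_{abcd}-4g_{[a|[c}P_{d]|b]}$ with $R_{abd}{}^{c}V^d=2\nabla_{[a}\nabla_{b]}V^c$, and let $A_{abc}=2\nabla_{[b}P_{c]a}$ be the Cotton–York tensor; all are extended complex multilinearly. Put $\Psi_2=C(k,\bar m,\ell,m)$ (complex) and $\Psi_2^0=C(k,u,\ell,u)$ (real). Suppose that for each $i\in\{0,1\}$ $$C(X,Y,Z,\cdot)=0,\qquad A(Z,X,Y)=0\qquad\text{for all }X,Y\in\Gamma(\mathcal N_i^\perp),\ Z\in\Gamma(\mathcal N_i),$$ and that the Weyl tensor does not degenerate otherwise, in the sense that $\Psi_2$ and $\Psi_2^0$ are generic: at all points of a dense subset of $\mathcal M$ one has $\Psi_2\neq0$, $\Psi_2^0\neq0$ and $\Psi_2\neq\pm\Psi_2^0$. Then both $(\mathcal N_0,\mathcal L)$ and $(\mathcal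 N_1,\mathcal K)$ are optical structures, i.e. $\mathcal N_0$, $\mathcal N_0^\perp$, $\mathcal N_1$ and $\mathcal N_1^\perp$ are all integrable. -/

import Mathlib

open scoped Manifold ContDiff TensorProduct

noncomputable section

namespace Optical

/-- The model space of a five-dimensional manifold. -/
abbrev E5 : Type := EuclideanSpace ℝ (Fin 5)

section Fields

variable (M : Type*) [TopologicalSpace M] [ChartedSpace E5 M]

/-- Real vector fields on `M` (no regularity required). -/
abbrev RField : Type _ := (x : M) → TangentSpace (𝓡 5) x

/-- A vector field `re + i im` with values in the complexified tangent bundle. -/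
structure CField where
  re : RField M
  im : RField M

variable {M}

/-- The vector field `X` is smooth on `U`. -/
def SmoothOn [IsManifold (𝓡 5) ∞ M] (X : RField M) (U : Set M) : Prop :=
  ContMDiffOn (𝓡 5) (𝓡 5).tangent ∞ (fun x => (⟨x, X x⟩ : TangentBundle (𝓡 5) M)) U

namespace CField

/-- The value at `x`, in the complexified tangent space `ℂ ⊗ T_x M`. -/
def val (X : CField M) (x : M) : ℂ ⊗[ℝ] TangentSpace (𝓡 5) x :=
  (1 : ℂ) ⊗ₜ[ℝ] X.re x + Complex.I ⊗ₜ[ℝ] X.im x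

/-- The complex conjugate field. -/
def conj (X : CField M) : CField M := ⟨X.re, -X.im⟩

/-- A real vector field as a complex one. -/
def ofReal (X : RField M) : CField M := ⟨X, 0⟩

/-- The complex field `X` is smooth on `U`. -/
def SmoothOn [IsManifold (𝓡 5) ∞ M] (X : CField M) (U : Set M) : Prop :=
  Optical.SmoothOn X.re U ∧ Optical.SmoothOn X.im U

/-- The Lie bracket, extended to be complex bilinear. -/
def bracket (X Y : CField M) : CField M where
  re := VectorField.mlieBracket (𝓡 5) X.re Y.re - VectorField.mlieBracket (𝓡 5) X.im Y.im
  im := VectorField.mlieBracket (𝓡 5) X.re Y.im + VectorField.mlieBracket (𝓡 5) X.im Y.re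

end CField

/-- The complex linear extension of a (real linear) functional of vector fields. -/
def cext (f : RField M → ℂ) (X : CField M) : ℂ := f X.re + Complex.I * f X.im

/-- Complex conjugation `z ⊗ v ↦ z̄ ⊗ v` on the complexified tangent space. -/
def conjT (x : M) :
    ℂ ⊗[ℝ] TangentSpace (𝓡 5) x →ₗ[ℝ] ℂ ⊗[ℝ] TangentSpace (𝓡 5) x :=
  LinearMap.rTensor (TangentSpace (𝓡 5) x) Complex.conjAe.toLinearMap

end Fields

section Metric

variable (M : Type*) [TopologicalSpace M] [ChartedSpace E5 M] [IsManifold (𝓡 5) ∞ M]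

/-- A smooth Lorentzian metric, of signature `(-,+,+,+,+)`. -/
structure LorentzMetric where
  val : (x : M) → TangentSpace (𝓡 5) x →L[ℝ] TangentSpace (𝓡 5) x →L[ℝ] ℝ
  symm : ∀ (x : M) (v w : TangentSpace (𝓡 5) x), val x v w = val x w v
  lorentzian : ∀ x : M, ∃ b : Module.Basis (Fin 5) ℝ (TangentSpace (𝓡 5) x),
    ∀ i j, val x (b i) (b j) = if i = j then (if i = 0 then -1 else 1) else 0
  smooth : ContMDiff (𝓡 5) ((𝓡 5).prod 𝓘(ℝ, E5 →L[ℝ] E5 →L[ℝ] ℝ)) ∞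
    (fun x => Bundle.TotalSpace.mk' (E5 →L[ℝ] E5 →L[ℝ] ℝ)
      (E := fun x : M => TangentSpace (𝓡 5) x →L[ℝ] TangentSpace (𝓡 5) x →L[ℝ] ℝ) x (val x))

end Metric

section Curvature

variable {M : Type*} [TopologicalSpace M] [ChartedSpace E5 M] [IsManifold (𝓡 5) ∞ M]

/-- The `i`-th basis vector of `T_x M` (for the preferred chart at `x`). -/
def coordVec (x : M) (i : Fin 5) : TangentSpace (𝓡 5) x :=
  (EuclideanSpace.single i (1 : ℝ) : E5)

/-- The extension of `coordVec x i` to a vector field, smooth near `x`: the coordinate vector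
field of the preferred chart at `x`. -/
def coordField (x : M) (i : Fin 5) : RField M :=
  FiberBundle.extend E5 (E := fun y : M => TangentSpace (𝓡 5) y) (coordVec x i)

namespace LorentzMetric

variable (g : LorentzMetric M)

/-- The function `g(X, Y)`. -/
def inner (X Y : RField M) (x : M) : ℝ := g.val x (X x) (Y x)

/-- The inverse metric `g^{ij}` at `x`, in the basis `coordVec x`. -/
def inv (x : M) : Matrix (Fin 5) (Fin 5) ℝ :=
  (Matrix.of fun i j => g.val x (coordVec x i) (coordVec x j))⁻¹

/-- The Koszul expression, equal to `g(∇_X Y, Z)`. -/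
def koszul (X Y Z : RField M) (x : M) : ℝ :=
  (mvfderiv (𝓡 5) (g.inner Y Z) x (X x) + mvfderiv (𝓡 5) (g.inner Z X) x (Y x)
    - mvfderiv (𝓡 5) (g.inner X Y) x (Z x)
    + g.inner (VectorField.mlieBracket (𝓡 5) X Y) Z x
    - g.inner (VectorField.mlieBracket (𝓡 5) Y Z) X x
    + g.inner (VectorField.mlieBracket (𝓡 5) Z X) Y x) / 2

/-- The Levi-Civita covariant derivative `∇_X Y`, obtained by raising the index of the
Koszul expression. -/
def nabla (X Y : RField M) : RField M := fun x =>
  ∑ i, ∑ j, (g.inv x i j * g.koszul X Y (coordField x j) x) • coordVec x i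

/-- The Riemann curvature `R(X, Y) Z = ∇_X ∇_Y Z - ∇_Y ∇_X Z - ∇_{[X, Y]} Z`. -/
def curv (X Y Z : RField M) : RField M :=
  g.nabla X (g.nabla Y Z) - g.nabla Y (g.nabla X Z)
    - g.nabla (VectorField.mlieBracket (𝓡 5) X Y) Z

/-- The fully covariant Riemann tensor `R(X, Y, Z, W) = g(R(X, Y) Z, W)`. -/
def riem (X Y Z W : RField M) (x : M) : ℝ := g.inner (g.curv X Y Z) W x

/-- The Ricci tensor, the trace of `U ↦ R(U, Y) Z`. -/
def ric (Y Z : RField M) (x : M) : ℝ :=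
  ∑ i, ∑ j, g.inv x i j * g.riem (coordField x i) Y Z (coordField x j) x

/-- The scalar curvature. -/
def scal (x : M) : ℝ :=
  ∑ i, ∑ j, g.inv x i j * g.ric (coordField x i) (coordField x j) x

/-- The Rho (Schouten) tensor `(Ric - S g / (2 (n - 1))) / (n - 2)` in dimension `n = 5`. -/
def rho (Y Z : RField M) (x : M) : ℝ :=
  (g.ric Y Z x - g.scal x / 8 * g.inner Y Z x) / 3

/-- The Weyl tensor `C`, given by `R_{abcd} = C_{abcd} - 4 g_{[a|[c} P_{d]|b]}`. -/
def weyl (X Y Z W : RField M) (x : M) : ℝ :=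
  g.riem X Y Z W x + g.inner X Z x * g.rho Y W x - g.inner Y Z x * g.rho X W x
    - g.inner X W x * g.rho Y Z x + g.inner Y W x * g.rho X Z x

/-- The covariant derivative `(∇_X P)(Y, Z)` of the Rho tensor. -/
def nablaRho (X Y Z : RField M) (x : M) : ℝ :=
  mvfderiv (𝓡 5) (g.rho Y Z) x (X x) - g.rho (g.nabla X Y) Z x - g.rho Y (g.nabla X Z) x

/-- The Cotton-York tensor `A_{abc} = 2 ∇_{[b} P_{c]a}`, as `A(Z, X, Y)`. -/
def cotton (Z X Y : RField M) (x : M) : ℝ := g.nablaRho X Y Z x - g.nablaRho Y X Z x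

/-- The complex multilinear extension of the Weyl tensor. -/
def weylC (X Y Z W : CField M) (x : M) : ℂ :=
  cext (fun a => cext (fun b => cext (fun c => cext (fun d =>
    (g.weyl a b c d x : ℂ)) W) Z) Y) X

/-- The complex multilinear extension of the Cotton-York tensor. -/
def cottonC (Z X Y : CField M) (x : M) : ℂ :=
  cext (fun c => cext (fun a => cext (fun b => (g.cotton c a b x : ℂ)) Y) X) Z

/-- The metric at `x` as a bilinear form. -/
def form (x : M) : LinearMap.BilinForm ℝ (TangentSpace (𝓡 5) x) :=
  LinearMap.mk₂ ℝ (fun v w => g.val x v w) (by simp) (by simp) (by simp) (by simp)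

/-- The complex bilinear extension of the metric at `x`. -/
def formC (x : M) : LinearMap.BilinForm ℂ (ℂ ⊗[ℝ] TangentSpace (𝓡 5) x) :=
  LinearMap.BilinForm.baseChange ℂ (g.form x)

end LorentzMetric

end Curvature

section Distributions

variable {M : Type*} [TopologicalSpace M] [ChartedSpace E5 M]

variable (M) in
/-- A family of complex subspaces of the complexified tangent spaces. -/
abbrev CDist : Type _ := (x : M) → Submodule ℂ (ℂ ⊗[ℝ] TangentSpace (𝓡 5) x)

variable (M) in
/-- A family of real subspaces of the tangent spaces. -/
abbrev RDist : Type _ := (x : M) → Submodule ℝ (TangentSpace (𝓡 5) x)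

variable [IsManifold (𝓡 5) ∞ M]

/-- `X` is a smooth section of `N` over `U`. -/
def IsSectionOn (N : CDist M) (X : CField M) (U : Set M) : Prop :=
  X.SmoothOn U ∧ ∀ x ∈ U, X.val x ∈ N x

/-- `X ∈ Γ(N)`: a smooth section over all of `M`. -/
def IsSection (N : CDist M) (X : CField M) : Prop := IsSectionOn N X Set.univ

/-- `N` is a smooth complex subbundle of rank `r`: it has local smooth frames. -/
def IsCSubbundle (N : CDist M) (r : ℕ) : Prop :=
  ∀ x : M, ∃ U : Set M, IsOpen U ∧ x ∈ U ∧ ∃ Z : Fin r → CField M,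
    (∀ i, (Z i).SmoothOn U) ∧
    ∀ y ∈ U, LinearIndependent ℂ (fun i => (Z i).val y) ∧
      Submodule.span ℂ (Set.range fun i => (Z i).val y) = N y

/-- `K` is a smooth real subbundle of rank `r`. -/
def IsRSubbundle (K : RDist M) (r : ℕ) : Prop :=
  ∀ x : M, ∃ U : Set M, IsOpen U ∧ x ∈ U ∧ ∃ Z : Fin r → RField M,
    (∀ i, SmoothOn (Z i) U) ∧
    ∀ y ∈ U, LinearIndependent ℝ (fun i => Z i y) ∧
      Submodule.span ℝ (Set.range fun i => Z i y) = K y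

/-- Frobenius integrability: brackets of (local) sections of `N` are sections of `N`. -/
def IsIntegrable (N : CDist M) : Prop :=
  ∀ U : Set M, IsOpen U → ∀ X Y : CField M, IsSectionOn N X U → IsSectionOn N Y U →
    ∀ x ∈ U, (X.bracket Y).val x ∈ N x

/-- The orthogonal complement of `N` for the complexified metric. -/
def LorentzMetric.perp (g : LorentzMetric M) (N : CDist M) : CDist M :=
  fun x => (g.formC x).orthogonal (N x)

/-- An almost null structure: a totally null complex subbundle of rank two. -/
def IsAlmostNullStructure (g : LorentzMetric M) (N : CDist M) : Prop :=
  IsCSubbundle N 2 ∧ ∀ x, N x ≤ g.perp N x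

/-- `(N, K)` is an almost optical structure: `N` is an almost null structure, `K` is a real line
bundle and `N ∩ N̄ = ℂ ⊗ K` (so that `N` has real index one). -/
def IsAlmostOpticalStructure (g : LorentzMetric M) (N : CDist M) (K : RDist M) : Prop :=
  IsAlmostNullStructure g N ∧ IsRSubbundle K 1 ∧
    ∀ (x : M) (v : ℂ ⊗[ℝ] TangentSpace (𝓡 5) x),
      (v ∈ N x ∧ conjT x v ∈ N x) ↔ v ∈ (K x).baseChange ℂ

/-- `(N, K)` is an (integrable) optical structure: both `N` and its orthogonal complement
are integrable. -/
def IsOpticalStructure (g : LorentzMetric M) (N : CDist M) (K : RDist M) : Prop :=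
  IsAlmostOpticalStructure g N K ∧ IsIntegrable N ∧ IsIntegrable (g.perp N)

/-- The Weyl tensor is algebraically special relative to `N`: `C(X, Y, Z, ·) = 0` for all
`X, Y ∈ Γ(N^⊥)` and `Z ∈ Γ(N)`. -/
def WeylSpecial (g : LorentzMetric M) (N : CDist M) : Prop :=
  ∀ X Y Z W : CField M, IsSection (g.perp N) X → IsSection (g.perp N) Y → IsSection N Z →
    W.SmoothOn Set.univ → ∀ x, g.weylC X Y Z W x = 0

/-- The Cotton-York tensor degenerates on `N`: `A(Z, X, Y) = 0` for all `X, Y ∈ Γ(N^⊥)` and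
`Z ∈ Γ(N)`. -/
def CottonDegenerate (g : LorentzMetric M) (N : CDist M) : Prop :=
  ∀ X Y Z : CField M, IsSection (g.perp N) X → IsSection (g.perp N) Y → IsSection N Z →
    ∀ x, g.cottonC Z X Y x = 0

end Distributions

section Frame

variable {M : Type*} [TopologicalSpace M] [ChartedSpace E5 M] [IsManifold (𝓡 5) ∞ M]

/-- A smooth null frame: real vector fields `k, l, u` and a complex one `m` for which the metric is
`g_{ab} = 2 k_{(a} l_{b)} + 2 m_{(a} m̄_{b)} + u_a u_b`; that is, the only nonzero products are
`g(k, l) = g(m, m̄) = g(u, u) = 1`. -/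
structure NullFrame (g : LorentzMetric M) where
  k : RField M
  l : RField M
  u : RField M
  m : CField M
  smooth_k : SmoothOn k Set.univ
  smooth_l : SmoothOn l Set.univ
  smooth_u : SmoothOn u Set.univ
  smooth_m : m.SmoothOn Set.univ
  kk : ∀ x, g.inner k k x = 0
  ll : ∀ x, g.inner l l x = 0
  uu : ∀ x, g.inner u u x = 1
  kl : ∀ x, g.inner k l x = 1
  ku : ∀ x, g.inner k u x = 0
  lu : ∀ x, g.inner l u x = 0
  km : ∀ x, g.formC x ((CField.ofReal k).val x) (m.val x) = 0
  lm : ∀ x, g.formC x ((CField.ofReal l).val x) (m.val x) = 0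
  um : ∀ x, g.formC x ((CField.ofReal u).val x) (m.val x) = 0
  mm : ∀ x, g.formC x (m.val x) (m.val x) = 0
  m_conj : ∀ x, g.formC x (m.val x) (m.conj.val x) = 1

namespace NullFrame

variable {g : LorentzMetric M} (F : NullFrame g)

/-- `N₀ = span {l, m̄}`. -/
def N0 : CDist M := fun x => Submodule.span ℂ {(CField.ofReal F.l).val x, F.m.conj.val x}

/-- `L = span {l}`. -/
def L : RDist M := fun x => Submodule.span ℝ {F.l x}

/-- `N₁ = span {k, m̄}`. -/
def N1 : CDist M := fun x => Submodule.span ℂ {(CField.ofReal F.k).val x, F.m.conj.val x}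

/-- `K = span {k}`. -/
def K : RDist M := fun x => Submodule.span ℝ {F.k x}

/-- The Weyl component `Ψ₂ = C(k, m̄, l, m)`. -/
def psi2 (x : M) : ℂ :=
  g.weylC (CField.ofReal F.k) F.m.conj (CField.ofReal F.l) F.m x

/-- The real Weyl component `Ψ₂⁰ = C(k, u, l, u)`. -/
def psi20 (x : M) : ℝ := g.weyl F.k F.u F.l F.u x

/-- The component functions `Ψ₂` and `Ψ₂⁰` are generic: away from a set with empty interior they
are nonzero and `Ψ₂ ≠ ± Ψ₂⁰`. -/
def GenericPsi : Prop :=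
  Dense {x : M | F.psi2 x ≠ 0 ∧ F.psi20 x ≠ 0 ∧
    F.psi2 x ≠ (F.psi20 x : ℂ) ∧ F.psi2 x ≠ -(F.psi20 x : ℂ)}

end NullFrame

end Frame

end Optical

end

/-! The core is linear algebra on the Bianchi identity. Number the vectors `k, m̄, l, m, u` as `f 0,
..., f 4` and put Γ_ijk = g(∇_{f i} f j, f k). The connection is metric and torsion-free, so `N1` =
span{f 0, f 1} and its complement span{f 0, f 1, f 4} are integrable once Γ_ijk = 0 for i, j in {0,
1, 4}, k in {0, 1}, the case i = j = 4 excepted (`IsNull.isIntegrable`, `IsNull.isIntegrable_perp`).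

Grade vectors by giving `k, m̄` degree 1, `u` degree 0 and `l, m` degree -1. Speciality of the Weyl
tensor relative to `N1` kills its components of positive degree (`eq_zero_of_degree`). The same
holds for `N0` and, as the Weyl tensor is real, for both conjugates; the four gradings together
leave only components of weight zero in ℤ × ℤ, which is type D (`eq_zero_of_wt`).

By `nabla4_weyl_cyclic` the cyclic derivative of the Weyl tensor is metric times Cotton-York tensor.
In well chosen components every derivative of a Weyl component has nonzero weight and every
Cotton-York term is one assumed to vanish, so what remains is linear in Γ with coefficients in Ψ₂,
its conjugate and Ψ₂⁰ (`kappa`, `sigma`, `eq_one`, `eq_two`). Exchanging `k` with `m̄` (and `l` with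
`m`) preserves `N1` and all these complex identities but changes the sign of Ψ₂⁰, which doubles the
number of equations. Where Ψ₂, Ψ₂⁰ and Ψ₂ ± Ψ₂⁰ are nonzero, they force the required Γ to vanish
(`TypeDData.gamma_eq_zero`); by continuity Γ then vanishes everywhere. The case of `N0` follows by
exchanging `k` and `l`, which replaces Ψ₂ by its conjugate.

The differential geometry is developed from the Koszul expression in a global orthogonal frame with
constant squares. The null vectors have constant complex coefficients in it. Hence complex
identities may be checked on real frame fields, and the vanishing of a null component may be
differentiated (`dweylV_eq_zero`). -/

noncomputable section

set_option linter.unusedSectionVars false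

/-! ### Smooth vector fields, Lie brackets and directional derivatives. -/

namespace Optical

variable {M : Type*} [TopologicalSpace M] [ChartedSpace E5 M] [IsManifold (𝓡 5) ∞ M]

/-- Smoothness of a real function on a set. -/
abbrev SmoothFnOn (f : M → ℝ) (U : Set M) : Prop := ContMDiffOn (𝓡 5) 𝓘(ℝ, ℝ) ∞ f U

/-- The derivative of the function `f` along the vector field `X`. -/
def D (X : RField M) (f : M → ℝ) (x : M) : ℝ := mvfderiv (𝓡 5) f x (X x)

/-- The Lie bracket of real vector fields. -/
abbrev brk (X Y : RField M) : RField M := VectorField.mlieBracket (𝓡 5) X Y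

variable {U V : Set M} {X Y Z W : RField M} {f h : M → ℝ} {x : M}

theorem SmoothOn.mdiffAt (hX : SmoothOn X U) (hU : IsOpen U) (hx : x ∈ U) :
    MDifferentiableAt (𝓡 5) (𝓡 5).tangent (fun x => (⟨x, X x⟩ : TangentBundle (𝓡 5) M)) x :=
  ((hX x hx).contMDiffAt (hU.mem_nhds hx)).mdifferentiableAt (by simp)

theorem SmoothFnOn.mdiffAt (hf : SmoothFnOn f U) (hU : IsOpen U) (hx : x ∈ U) :
    MDifferentiableAt (𝓡 5) 𝓘(ℝ, ℝ) f x :=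
  ((hf x hx).contMDiffAt (hU.mem_nhds hx)).mdifferentiableAt (by simp)

theorem SmoothOn.mono (hX : SmoothOn X U) (h : V ⊆ U) : SmoothOn X V := ContMDiffOn.mono hX h

theorem SmoothOn.add (hX : SmoothOn X U) (hY : SmoothOn Y U) : SmoothOn (X + Y) U :=
  ContMDiffOn.add_section hX hY

theorem SmoothOn.sub (hX : SmoothOn X U) (hY : SmoothOn Y U) : SmoothOn (X - Y) U :=
  ContMDiffOn.sub_section hX hY

theorem SmoothOn.neg (hX : SmoothOn X U) : SmoothOn (-X) U :=
  ContMDiffOn.neg_section hX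

theorem smoothOn_zero : SmoothOn (0 : RField M) U :=
  (Bundle.contMDiff_zeroSection ℝ (fun x : M => TangentSpace (𝓡 5) x)).contMDiffOn

theorem SmoothOn.smul (hf : SmoothFnOn f U) (hX : SmoothOn X U) : SmoothOn (f • X) U :=
  ContMDiffOn.smul_section hf hX

theorem SmoothOn.sum {ι : Type*} {s : Finset ι} {X : ι → RField M}
    (hX : ∀ i ∈ s, SmoothOn (X i) U) : SmoothOn (∑ i ∈ s, X i) U := by
  classical
  induction s using Finset.induction_on with
  | empty => simpa using smoothOn_zero
  | insert a s ha ih =>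
    rw [Finset.sum_insert ha]
    exact (hX a (by simp)).add (ih fun i hi => hX i (by simp [hi]))

theorem SmoothOn.congr (hX : SmoothOn X U) (h : ∀ y ∈ U, Y y = X y) : SmoothOn Y U :=
  ContMDiffOn.congr hX fun y hy => by simp [h y hy]

theorem isManifold_minSmoothness_two : IsManifold (𝓡 5) (minSmoothness ℝ 2) M := by
  simp only [minSmoothness_of_isRCLikeNormedField]
  exact IsManifold.of_le (n := ∞) (WithTop.coe_le_coe.2 (le_top : (2 : ℕ∞) ≤ ⊤))

theorem SmoothOn.brk (hU : IsOpen U) (hX : SmoothOn X U) (hY : SmoothOn Y U) :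
    SmoothOn (brk X Y) U := by
  intro x hx
  have : IsManifold (𝓡 5) (minSmoothness ℝ 2) M := isManifold_minSmoothness_two
  have : IsManifold (𝓡 5) (((⊤ : ℕ∞) : WithTop ℕ∞) + 1) M := by
    simpa using (inferInstance : IsManifold (𝓡 5) ∞ M)
  exact (ContMDiffAt.mlieBracket_vectorField (m := ⊤) (n := ⊤)
    ((hX x hx).contMDiffAt (hU.mem_nhds hx)) ((hY x hx).contMDiffAt (hU.mem_nhds hx))
    (by simp)).contMDiffWithinAt

theorem LorentzMetric.smooth_inner (g : LorentzMetric M) (hX : SmoothOn X U) (hY : SmoothOn Y U) :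
    SmoothFnOn (g.inner X Y) U := by
  intro x hx
  have := ContMDiffOn.clm_bundle_apply₂ (E₃ := fun _ : M => ℝ) (F₃ := ℝ)
    (g.smooth.contMDiffOn (s := U)) hX hY
  exact (Bundle.contMDiffWithinAt_totalSpace.1 (this x hx)).2

theorem brk_add_left (hU : IsOpen U) (hX : SmoothOn X U) (hY : SmoothOn Y U) (hx : x ∈ U) :
    brk (X + Y) Z x = brk X Z x + brk Y Z x :=
  VectorField.mlieBracket_add_left (hX.mdiffAt hU hx) (hY.mdiffAt hU hx)

theorem brk_add_right (hU : IsOpen U) (hX : SmoothOn X U) (hY : SmoothOn Y U) (hx : x ∈ U) :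
    brk Z (X + Y) x = brk Z X x + brk Z Y x :=
  VectorField.mlieBracket_add_right (hX.mdiffAt hU hx) (hY.mdiffAt hU hx)

theorem brk_swap (X Y : RField M) (x : M) : brk X Y x = -brk Y X x :=
  VectorField.mlieBracket_swap_apply

theorem brk_smul_right (hU : IsOpen U) (hf : SmoothFnOn f U) (hY : SmoothOn Y U) (hx : x ∈ U) :
    brk X (f • Y) x = D X f x • Y x + f x • brk X Y x :=
  VectorField.mlieBracket_smul_right (hf.mdiffAt hU hx) (hY.mdiffAt hU hx)

theorem brk_smul_left (hU : IsOpen U) (hf : SmoothFnOn f U) (hX : SmoothOn X U) (hx : x ∈ U) :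
    brk (f • X) Y x = -(D Y f x) • X x + f x • brk X Y x :=
  VectorField.mlieBracket_smul_left (hf.mdiffAt hU hx) (hX.mdiffAt hU hx)

theorem brk_congr (hU : IsOpen U) (hx : x ∈ U) {X' Y' : RField M} (hX : ∀ y ∈ U, X y = X' y)
    (hY : ∀ y ∈ U, Y y = Y' y) : brk X Y x = brk X' Y' x :=
  Filter.EventuallyEq.mlieBracket_vectorField_eq
    (Filter.eventually_of_mem (hU.mem_nhds hx) hX) (Filter.eventually_of_mem (hU.mem_nhds hx) hY)

theorem brk_jacobi (hU : IsOpen U) (hX : SmoothOn X U) (hY : SmoothOn Y U) (hZ : SmoothOn Z U)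
    (hx : x ∈ U) : brk X (brk Y Z) x = brk (brk X Y) Z x + brk Y (brk X Z) x := by
  have : IsManifold (𝓡 5) (minSmoothness ℝ 3) M := by
    simp only [minSmoothness_of_isRCLikeNormedField]
    exact IsManifold.of_le (n := ∞) (WithTop.coe_le_coe.2 (le_top : (3 : ℕ∞) ≤ ⊤))
  have h2 : minSmoothness ℝ 2 ≤ (∞ : WithTop ℕ∞) := by
    simp only [minSmoothness_of_isRCLikeNormedField]
    exact WithTop.coe_le_coe.2 (le_top : (2 : ℕ∞) ≤ ⊤)
  exact VectorField.leibniz_identity_mlieBracket_apply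
    (((hX x hx).contMDiffAt (hU.mem_nhds hx)).of_le h2)
    (((hY x hx).contMDiffAt (hU.mem_nhds hx)).of_le h2)
    (((hZ x hx).contMDiffAt (hU.mem_nhds hx)).of_le h2)

theorem D_add (hU : IsOpen U) (hf : SmoothFnOn f U) (hh : SmoothFnOn h U) (hx : x ∈ U) :
    D X (f + h) x = D X f x + D X h x := by
  simp [D, mvfderiv_add (hf.mdiffAt hU hx) (hh.mdiffAt hU hx)]

theorem D_sub (hU : IsOpen U) (hf : SmoothFnOn f U) (hh : SmoothFnOn h U) (hx : x ∈ U) :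
    D X (f - h) x = D X f x - D X h x := by
  simp [D, mvfderiv_sub (hf.mdiffAt hU hx) (hh.mdiffAt hU hx)]

theorem D_mul (hU : IsOpen U) (hf : SmoothFnOn f U) (hh : SmoothFnOn h U) (hx : x ∈ U) :
    D X (f * h) x = f x * D X h x + h x * D X f x := by
  simp [D, mvfderiv_mul (hf.mdiffAt hU hx) (hh.mdiffAt hU hx)]

theorem D_const (c : ℝ) : D X (fun _ => c) x = 0 := by
  simp [D, mvfderiv_const]

theorem D_zero : D X 0 x = 0 := D_const 0

theorem D_const_mul (hU : IsOpen U) (c : ℝ) (hf : SmoothFnOn f U) (hx : x ∈ U) :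
    D X (fun y => c * f y) x = c * D X f x := by
  have := D_mul (X := X) hU (contMDiffOn_const (c := c)) hf hx
  rw [D_const, mul_zero, add_zero] at this
  exact this

theorem D_sum (hU : IsOpen U) {ι : Type*} {s : Finset ι} {f : ι → M → ℝ}
    (hf : ∀ i ∈ s, SmoothFnOn (f i) U) (hx : x ∈ U) :
    D X (∑ i ∈ s, f i) x = ∑ i ∈ s, D X (f i) x := by
  classical
  induction s using Finset.induction_on with
  | empty => simpa using D_zero
  | insert a s ha ih =>
    have hs : SmoothFnOn (∑ i ∈ s, f i) U :=
      contMDiffOn_finsetSum' fun i hi => hf i (Finset.mem_insert_of_mem hi)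
    rw [Finset.sum_insert ha, Finset.sum_insert ha, D_add hU (hf a (by simp)) hs hx,
      ih fun i hi => hf i (by simp [hi])]

theorem D_congr (hU : IsOpen U) (hx : x ∈ U) (hf : ∀ y ∈ U, f y = h y) : D X f x = D X h x := by
  have : f =ᶠ[nhds x] h := Filter.eventually_of_mem (hU.mem_nhds hx) hf
  simp only [D, mvfderiv]
  rw [this.mfderiv_eq]
  have := hf x hx
  rfl

theorem D_field_add : D (X + Y) f x = D X f x + D Y f x := by simp [D]

theorem D_field_smul : D (h • X) f x = h x * D X f x := by simp [D]

end Optical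

/-! ### Orthogonal frames, tensoriality of the Koszul expression, raising indices. -/

namespace Optical

variable {M : Type*} [TopologicalSpace M] [ChartedSpace E5 M] [IsManifold (𝓡 5) ∞ M]

/-- A global smooth frame which is orthogonal, with vectors of constant square. -/
structure OrthoFrame (g : LorentzMetric M) where
  E : Fin 5 → RField M
  η : Fin 5 → ℝ
  η_ne : ∀ a, η a ≠ 0
  smooth : ∀ a, SmoothOn (E a) Set.univ
  orth : ∀ a b x, g.inner (E a) (E b) x = if a = b then η a else 0

variable {U V : Set M} {X Y Z W : RField M} {f h : M → ℝ} {x : M}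

namespace LorentzMetric
variable (g : LorentzMetric M)

theorem inner_symm (X Y : RField M) : g.inner X Y = g.inner Y X := by
  funext x; exact g.symm x _ _

theorem inner_add_left : g.inner (X + Y) Z = g.inner X Z + g.inner Y Z := by
  funext x; simp [inner]

theorem inner_add_right : g.inner X (Y + Z) = g.inner X Y + g.inner X Z := by
  funext x; simp [inner]

theorem inner_smul_left : g.inner (f • X) Y = f * g.inner X Y := by
  funext x; simp [inner]

theorem inner_smul_right : g.inner X (f • Y) = f * g.inner X Y := by
  funext x; simp [inner]

theorem koszul_eq (X Y Z : RField M) (x : M) : g.koszul X Y Z x =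
    (D X (g.inner Y Z) x + D Y (g.inner Z X) x - D Z (g.inner X Y) x
      + g.val x (brk X Y x) (Z x) - g.val x (brk Y Z x) (X x) + g.val x (brk Z X x) (Y x)) / 2 :=
  rfl

section koszul
variable {X' : RField M} (hU : IsOpen U) (hx : x ∈ U)
  (hX : SmoothOn X U) (hX' : SmoothOn X' U) (hY : SmoothOn Y U) (hZ : SmoothOn Z U)
  (hf : SmoothFnOn f U)
include hU hx hX hY hZ

include hX' in
theorem koszul_add_left : g.koszul (X + X') Y Z x = g.koszul X Y Z x + g.koszul X' Y Z x := by
  simp only [koszul_eq, inner_add_left, inner_add_right, D_field_add,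
    D_add hU (g.smooth_inner hZ hX) (g.smooth_inner hZ hX') hx,
    D_add hU (g.smooth_inner hX hY) (g.smooth_inner hX' hY) hx,
    brk_add_left hU hX hX' hx, brk_add_right hU hX hX' hx, Pi.add_apply, map_add,
    add_apply]
  ring

include hX' in
theorem koszul_add_mid : g.koszul Y (X + X') Z x = g.koszul Y X Z x + g.koszul Y X' Z x := by
  simp only [koszul_eq, inner_add_left, inner_add_right, D_field_add,
    D_add hU (g.smooth_inner hX hZ) (g.smooth_inner hX' hZ) hx,
    D_add hU (g.smooth_inner hY hX) (g.smooth_inner hY hX') hx,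
    brk_add_left hU hX hX' hx, brk_add_right hU hX hX' hx, Pi.add_apply, map_add,
    add_apply]
  ring

include hX' in
theorem koszul_add_right : g.koszul Y Z (X + X') x = g.koszul Y Z X x + g.koszul Y Z X' x := by
  simp only [koszul_eq, inner_add_left, inner_add_right, D_field_add,
    D_add hU (g.smooth_inner hX hY) (g.smooth_inner hX' hY) hx,
    D_add hU (g.smooth_inner hZ hX) (g.smooth_inner hZ hX') hx,
    brk_add_left hU hX hX' hx, brk_add_right hU hX hX' hx, Pi.add_apply, map_add,
    add_apply]
  ring

-- The derivatives of `f` along `Y` and `Z` each occur twice, once from differentiating an inner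
-- product and once from a bracket, with opposite signs.
include hf in
theorem koszul_smul_left : g.koszul (f • X) Y Z x = f x * g.koszul X Y Z x := by
  simp only [koszul_eq, inner_smul_left, inner_smul_right, D_field_smul,
    D_mul hU hf (g.smooth_inner hZ hX) hx, D_mul hU hf (g.smooth_inner hX hY) hx,
    brk_smul_left hU hf hX hx, brk_smul_right hU hf hX hx, Pi.smul_apply', map_add, map_smul,
    add_apply, smul_apply, smul_eq_mul]
  simp only [inner, g.symm x (Z x)]
  ring

-- Here the two terms with the derivative of `f` along `Y` have the same sign; the factor 1/2 makes
-- them the product rule.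
include hf in
theorem koszul_smul_mid : g.koszul Y (f • X) Z x =
    f x * g.koszul Y X Z x + D Y f x * g.inner X Z x := by
  simp only [koszul_eq, inner_smul_left, inner_smul_right, D_field_smul,
    D_mul hU hf (g.smooth_inner hX hZ) hx, D_mul hU hf (g.smooth_inner hY hX) hx,
    brk_smul_left hU hf hX hx, brk_smul_right hU hf hX hx, Pi.smul_apply', map_add, map_smul,
    add_apply, smul_apply, smul_eq_mul]
  simp only [inner, g.symm x (Y x)]
  ring

include hf in
theorem koszul_smul_right : g.koszul Y Z (f • X) x = f x * g.koszul Y Z X x := by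
  simp only [koszul_eq, inner_smul_left, inner_smul_right, D_field_smul,
    D_mul hU hf (g.smooth_inner hX hY) hx, D_mul hU hf (g.smooth_inner hZ hX) hx,
    brk_smul_left hU hf hX hx, brk_smul_right hU hf hX hx, Pi.smul_apply', map_add, map_smul,
    add_apply, smul_apply, smul_eq_mul]
  simp only [inner, g.symm x (Z x)]
  ring

end koszul

end LorentzMetric

namespace OrthoFrame
variable {g : LorentzMetric M} (Fr : OrthoFrame g)

theorem smoothOn (a : Fin 5) (U : Set M) : SmoothOn (Fr.E a) U := (Fr.smooth a).mono (Set.subset_univ _)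

/-- The components of a tangent vector in the frame. -/
def co (a : Fin 5) (v : TangentSpace (𝓡 5) x) : ℝ := g.val x v (Fr.E a x) / Fr.η a

theorem orth' (a b : Fin 5) (x : M) :
    g.val x (Fr.E a x) (Fr.E b x) = if a = b then Fr.η a else 0 := Fr.orth a b x

theorem co_E (a b : Fin 5) (x : M) : Fr.co a (Fr.E b x) = if a = b then 1 else 0 := by
  rw [co, Fr.orth']
  by_cases h : a = b
  · subst h; simp [Fr.η_ne]
  · simp [h, Ne.symm h]

theorem linearIndependent (x : M) : LinearIndependent ℝ (fun a => Fr.E a x) := by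
  rw [Fintype.linearIndependent_iff]
  intro c hc b
  have := congrArg (fun v => Fr.co b v) hc
  simpa [co, Fr.orth', Fr.η_ne] using this

theorem span_eq_top (x : M) : Submodule.span ℝ (Set.range fun a => Fr.E a x) = ⊤ := by
  have : FiniteDimensional ℝ (TangentSpace (𝓡 5) x) := inferInstanceAs (FiniteDimensional ℝ E5)
  refine (Fr.linearIndependent x).span_eq_top_of_card_eq_finrank' ?_
  have : Module.finrank ℝ (TangentSpace (𝓡 5) x) = Module.finrank ℝ E5 := rfl
  rw [this]; simp

/-- The frame as a basis of the tangent space. -/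
def basis (x : M) : Module.Basis (Fin 5) ℝ (TangentSpace (𝓡 5) x) :=
  Module.Basis.mk (Fr.linearIndependent x) (Fr.span_eq_top x).ge

theorem basis_apply (x : M) (a : Fin 5) : Fr.basis x a = Fr.E a x := by simp [basis]

theorem sum_co (v : TangentSpace (𝓡 5) x) : ∑ a, Fr.co a v • Fr.E a x = v := by
  have hv := (Fr.basis x).sum_repr v
  simp only [basis_apply] at hv
  have : ∀ b, Fr.co b v = (Fr.basis x).repr v b := by
    intro b
    conv_lhs => rw [← hv]
    simp [co, Fr.orth', Fr.η_ne]
  simp only [this, hv]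

theorem sum_co_field (X : RField M) : ∑ a, (fun y => Fr.co a (X y)) • Fr.E a = X := by
  funext y
  simpa [Finset.sum_apply] using Fr.sum_co (X y)

theorem smooth_co (a : Fin 5) (hX : SmoothOn X U) : SmoothFnOn (fun y => Fr.co a (X y)) U := by
  have := (g.smooth_inner hX (Fr.smoothOn a U)).mul (contMDiffOn_const (c := (Fr.η a)⁻¹))
  exact this

theorem ext_inner (v w : TangentSpace (𝓡 5) x)
    (h : ∀ a, g.val x v (Fr.E a x) = g.val x w (Fr.E a x)) : v = w := by
  rw [← Fr.sum_co v, ← Fr.sum_co w]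
  simp only [co, h]

/-- A functional on vector fields that is linear over smooth functions is determined by its values
on the frame. -/
theorem tensor_expand (T : RField M → ℝ)
    (hadd : ∀ X Y, SmoothOn X U → SmoothOn Y U → T (X + Y) = T X + T Y)
    (hsmul : ∀ (f : M → ℝ) X, SmoothFnOn f U → SmoothOn X U → T (f • X) = f x * T X)
    (hX : SmoothOn X U) : T X = ∑ a, Fr.co a (X x) * T (Fr.E a) := by
  have h0 : T 0 = 0 := by
    have := hsmul 0 0 contMDiffOn_const smoothOn_zero
    simpa using this
  have key : ∀ s : Finset (Fin 5), T (∑ a ∈ s, (fun y => Fr.co a (X y)) • Fr.E a) =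
      ∑ a ∈ s, Fr.co a (X x) * T (Fr.E a) := by
    intro s
    induction s using Finset.induction_on with
    | empty => simpa using h0
    | insert a s ha ih =>
      have hs : ∀ b, SmoothOn ((fun y => Fr.co b (X y)) • Fr.E b) U := fun b =>
        SmoothOn.smul (Fr.smooth_co b hX) (Fr.smoothOn b U)
      rw [Finset.sum_insert ha, Finset.sum_insert ha, hadd _ _ (hs a) (SmoothOn.sum fun b _ => hs b),
        hsmul _ _ (Fr.smooth_co a hX) (Fr.smoothOn a U), ih]
  conv_lhs => rw [← Fr.sum_co_field X]
  exact key _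

end OrthoFrame

/-- The vectors `coordVec x` as a basis. -/
def coordBasis (x : M) : Module.Basis (Fin 5) ℝ (TangentSpace (𝓡 5) x) :=
  (EuclideanSpace.basisFun (Fin 5) ℝ).toBasis

theorem coordBasis_apply (x : M) (i : Fin 5) : coordBasis x i = coordVec x i := by
  simp only [coordBasis, coordVec]
  exact (congrFun (OrthonormalBasis.coe_toBasis (EuclideanSpace.basisFun (Fin 5) ℝ)) i).trans
    (EuclideanSpace.basisFun_apply (Fin 5) ℝ i)

theorem coordField_self (x : M) (i : Fin 5) : coordField x i x = coordVec x i :=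
  FiberBundle.extend_apply_self _ _

/-- `nabla`, `ric` and `scal` are defined through coordinate fields, which are smooth only near `x`.
On this neighbourhood the tensoriality lemmas apply to them. -/
theorem exists_smooth_coordField (x : M) :
    ∃ U : Set M, IsOpen U ∧ x ∈ U ∧ ∀ i, SmoothOn (coordField x i) U := by
  have h : ∀ i, ∃ s ∈ nhds x, SmoothOn (coordField x i) s := fun i =>
    FiberBundle.exists_contMDiffOn_extend (k := ∞) (𝓡 5) E5 (V := fun y : M => TangentSpace (𝓡 5) y)
      (coordVec x i)
  choose s hs hsm using h
  refine ⟨interior (⋂ i, s i), isOpen_interior, ?_, fun i =>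
    (hsm i).mono (interior_subset.trans (Set.iInter_subset _ i))⟩
  rw [mem_interior_iff_mem_nhds]
  exact (Filter.iInter_mem).2 hs

namespace OrthoFrame
variable {g : LorentzMetric M} (Fr : OrthoFrame g)
include Fr

/-- Nondegeneracy comes from the frame: a kernel vector of the Gram matrix is orthogonal to every
coordinate vector, hence to the frame, hence zero. This makes the matrix inverse in `inv` a genuine
inverse. -/
theorem inv_mul (x : M) :
    (Matrix.of fun i j => g.val x (coordVec x i) (coordVec x j)) * g.inv x = 1 := by
  apply Matrix.mul_nonsing_inv
  rw [isUnit_iff_ne_zero]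
  intro hdet
  obtain ⟨c, hc, hc0⟩ := Matrix.exists_mulVec_eq_zero_iff.2 hdet
  apply hc
  have hv : ∑ i, c i • coordVec x i = 0 := by
    refine Fr.ext_inner _ _ fun a => ?_
    rw [g.symm x, map_zero, zero_apply,
      ← (coordBasis x).sum_repr (Fr.E a x)]
    simp only [coordBasis_apply, map_sum, map_smul, sum_apply,
      smul_apply, smul_eq_mul]
    simp only [Finset.mul_sum]
    rw [Finset.sum_comm]
    refine Finset.sum_eq_zero fun k _ => ?_
    have := congrFun hc0 k
    simp only [Matrix.mulVec, dotProduct, Matrix.of_apply, Pi.zero_apply] at this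
    calc _ = (coordBasis x).repr (Fr.E a x) k * ∑ i, g.val x (coordVec x k) (coordVec x i) * c i := by
          rw [Finset.mul_sum]; exact Finset.sum_congr rfl fun i _ => by ring
      _ = 0 := by rw [this, mul_zero]
  have := Fintype.linearIndependent_iff.1 (coordBasis x).linearIndependent c
    (by simpa only [coordBasis_apply] using hv)
  exact funext this

/-- Raising an index in coordinates is the same as raising it in the frame. -/
theorem raise_eq (x : M) (φ : TangentSpace (𝓡 5) x →ₗ[ℝ] ℝ) :
    ∑ i, ∑ j, (g.inv x i j * φ (coordVec x j)) • coordVec x i =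
      ∑ a, (φ (Fr.E a x) / Fr.η a) • Fr.E a x := by
  have h1 : ∀ k, g.val x (coordVec x k)
      (∑ i, ∑ j, (g.inv x i j * φ (coordVec x j)) • coordVec x i) = φ (coordVec x k) := by
    intro k
    simp only [map_sum, map_smul, smul_eq_mul]
    rw [Finset.sum_comm]
    have : ∀ j, ∑ i, g.inv x i j * φ (coordVec x j) * g.val x (coordVec x k) (coordVec x i) =
        (1 : Matrix (Fin 5) (Fin 5) ℝ) k j * φ (coordVec x j) := by
      intro j
      rw [← Fr.inv_mul x, Matrix.mul_apply, Finset.sum_mul]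
      exact Finset.sum_congr rfl fun i _ => by rw [Matrix.of_apply]; ring
    simp only [this]
    simp [Matrix.one_apply]
  have h2 : ∀ v, g.val x v (∑ a, (φ (Fr.E a x) / Fr.η a) • Fr.E a x) = φ v := by
    intro v
    conv_rhs => rw [← Fr.sum_co v]
    simp only [map_sum, map_smul, smul_eq_mul, co]
    exact Finset.sum_congr rfl fun a _ => by ring
  generalize ∑ i, ∑ j, (g.inv x i j * φ (coordVec x j)) • coordVec x i = w at h1
  refine Fr.ext_inner _ _ fun a => ?_
  rw [g.symm x, g.symm x (∑ a, _), h2, ← (coordBasis x).sum_repr (Fr.E a x), map_sum, map_sum,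
    sum_apply]
  refine Finset.sum_congr rfl fun k _ => ?_
  rw [coordBasis_apply, map_smul, smul_apply, h1, map_smul]

/-- The components as linear functionals. -/
def coLin (b : Fin 5) : TangentSpace (𝓡 5) x →ₗ[ℝ] ℝ where
  toFun v := Fr.co b v
  map_add' v w := by simp [co, add_div]
  map_smul' c v := by simp [co, mul_div_assoc]

theorem coLin_apply (b : Fin 5) (v : TangentSpace (𝓡 5) x) : Fr.coLin b v = Fr.co b v := rfl

/-- Moves the coordinate traces in `ric` and `scal` to the frame: the second argument is expanded in
the frame and `raise_eq` is applied to each component functional. -/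
theorem trace_eq (x : M) (T : TangentSpace (𝓡 5) x →ₗ[ℝ] TangentSpace (𝓡 5) x →ₗ[ℝ] ℝ) :
    ∑ i, ∑ j, g.inv x i j * T (coordVec x i) (coordVec x j) =
      ∑ a, T (Fr.E a x) (Fr.E a x) / Fr.η a := by
  have h1 : ∀ b, ∑ i, ∑ j, g.inv x i j * (Fr.co b (coordVec x j) * T (coordVec x i) (Fr.E b x)) =
      T (Fr.E b x) (Fr.E b x) / Fr.η b := by
    intro b
    have := congrArg (T.flip (Fr.E b x)) (Fr.raise_eq x (Fr.coLin b))
    simp only [map_sum, map_smul, smul_eq_mul, coLin_apply, co_E, LinearMap.flip_apply] at this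
    simp only [← mul_assoc]
    rw [this, Finset.sum_eq_single b] <;> simp +contextual [div_eq_inv_mul, Ne.symm]
  have h2 : ∀ i j, g.inv x i j * T (coordVec x i) (coordVec x j) =
      ∑ b, g.inv x i j * (Fr.co b (coordVec x j) * T (coordVec x i) (Fr.E b x)) := by
    intro i j
    rw [← Finset.mul_sum]
    congr 1
    conv_lhs => rw [← Fr.sum_co (coordVec x j)]
    rw [map_sum]
    exact Finset.sum_congr rfl fun b _ => by rw [map_smul, smul_eq_mul]
  simp only [h2, ← h1]
  exact (Finset.sum_congr rfl fun i _ => Finset.sum_comm).trans Finset.sum_comm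

end OrthoFrame
end Optical

/-! ### The Levi-Civita connection: smoothness, linearity, torsion, metric compatibility, locality.
-/

namespace Optical

variable {M : Type*} [TopologicalSpace M] [ChartedSpace E5 M] [IsManifold (𝓡 5) ∞ M]
variable {U : Set M} {X Y Z W X' Y' : RField M} {f h : M → ℝ} {x : M}
variable {g : LorentzMetric M}

namespace OrthoFrame
variable (Fr : OrthoFrame g)
include Fr

/-- A derivative is rewritten through brackets with `f • E 0`, so that smoothness of derivatives
(`smooth_D`) reduces to smoothness of brackets. -/
theorem D_eq (hU : IsOpen U) (hf : SmoothFnOn f U) (hx : x ∈ U) :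
    D X f x = (g.inner (brk X (f • Fr.E 0)) (Fr.E 0) x
      - f x * g.inner (brk X (Fr.E 0)) (Fr.E 0) x) * (Fr.η 0)⁻¹ := by
  have h0 := Fr.η_ne 0
  simp only [LorentzMetric.inner]
  rw [brk_smul_right hU hf (Fr.smoothOn 0 U) hx]
  simp only [map_add, map_smul, add_apply, smul_apply, smul_eq_mul, Fr.orth', if_true]
  field_simp
  ring

theorem smooth_D (hU : IsOpen U) (hX : SmoothOn X U) (hf : SmoothFnOn f U) :
    SmoothFnOn (D X f) U := by
  have h1 := g.smooth_inner (hX.brk hU (SmoothOn.smul hf (Fr.smoothOn 0 U))) (Fr.smoothOn 0 U)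
  have h2 := hf.mul (g.smooth_inner (hX.brk hU (Fr.smoothOn 0 U)) (Fr.smoothOn 0 U))
  exact ((h1.sub h2).mul (contMDiffOn_const (c := (Fr.η 0)⁻¹))).congr fun y hy => Fr.D_eq hU hf hy

/-- The Jacobi identity for `X`, `Y`, `f • E 0`, reduced by `f` times the one for `X`, `Y`, `E 0`,
leaves a multiple of `E 0` whose coefficient is the difference of the two sides. -/
theorem D_brk (hU : IsOpen U) (hX : SmoothOn X U) (hY : SmoothOn Y U) (hf : SmoothFnOn f U)
    (hx : x ∈ U) : D (brk X Y) f x = D X (D Y f) x - D Y (D X f) x := by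
  have hE := Fr.smoothOn 0 U
  have aux : ∀ {X Y : RField M}, SmoothOn X U → SmoothOn Y U →
      brk X (brk Y (f • Fr.E 0)) x = D X (D Y f) x • Fr.E 0 x + D Y f x • brk X (Fr.E 0) x
        + (D X f x • brk Y (Fr.E 0) x + f x • brk X (brk Y (Fr.E 0)) x) := by
    intro X Y hX hY
    have h1 : ∀ y ∈ U, brk Y (f • Fr.E 0) y = (D Y f • Fr.E 0 + f • brk Y (Fr.E 0)) y :=
      fun y hy => brk_smul_right hU hf hE hy
    rw [brk_congr hU hx (fun _ _ => rfl) h1,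
      brk_add_right hU (SmoothOn.smul (Fr.smooth_D hU hY hf) hE) (SmoothOn.smul hf (hY.brk hU hE)) hx,
      brk_smul_right hU (Fr.smooth_D hU hY hf) hE hx, brk_smul_right hU hf (hY.brk hU hE) hx]
  have hj := brk_jacobi hU hX hY (SmoothOn.smul hf hE) hx
  have hj' := brk_jacobi hU hX hY hE hx
  rw [aux hX hY, aux hY hX, brk_smul_right hU hf hE hx, hj'] at hj
  have h2 : (D (brk X Y) f x - (D X (D Y f) x - D Y (D X f) x)) • Fr.E 0 x = 0 := by
    have h4 := congrArg Neg.neg (sub_eq_zero.2 hj)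
    rw [neg_zero] at h4
    rw [← h4]
    module
  have h3 := congrArg (Fr.co 0) h2
  simp only [co, map_smul, smul_apply, Fr.orth', smul_eq_mul, map_zero, zero_apply, if_true] at h3
  have h0 := Fr.η_ne 0
  field_simp at h3
  linarith [(mul_eq_zero.1 (show _ * Fr.η 0 = 0 by simpa using h3)).resolve_right h0]

/-- The Koszul expression is tensorial in its last argument, so it is a covector at `x`, and
`raise_eq` says that coordinates and frame raise it to the same vector. -/
theorem nabla_apply (hU : IsOpen U) (hX : SmoothOn X U) (hY : SmoothOn Y U) (hx : x ∈ U) :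
    g.nabla X Y x = ∑ a, (g.koszul X Y (Fr.E a) x / Fr.η a) • Fr.E a x := by
  obtain ⟨V, hV, hxV, hs⟩ := exists_smooth_coordField x
  have hUV := hU.inter hV
  have hxUV : x ∈ U ∩ V := ⟨hx, hxV⟩
  have hX' := hX.mono (Set.inter_subset_left (t := V))
  have hY' := hY.mono (Set.inter_subset_left (t := V))
  -- The covector `Z ↦ koszul X Y Z x`, prescribed by its values on the frame.
  let φ : TangentSpace (𝓡 5) x →ₗ[ℝ] ℝ := ∑ a, g.koszul X Y (Fr.E a) x • Fr.coLin a
  have hφ : ∀ v, φ v = ∑ a, Fr.co a v * g.koszul X Y (Fr.E a) x := by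
    intro v
    simp [φ, LinearMap.sum_apply, coLin_apply, mul_comm]
  have hk : ∀ j, g.koszul X Y (coordField x j) x = φ (coordVec x j) := by
    intro j
    rw [hφ, ← coordField_self x j]
    refine Fr.tensor_expand (U := U ∩ V) (fun Z => g.koszul X Y Z x) ?_ ?_
      ((hs j).mono Set.inter_subset_right)
    · intro Z W hZ hW
      exact g.koszul_add_right hUV hxUV hZ hW hX' hY'
    · intro f Z hf hZ
      exact g.koszul_smul_right hUV hxUV hZ hX' hY' hf
  have := Fr.raise_eq x φ
  simp only [LorentzMetric.nabla, hk, this]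
  refine Finset.sum_congr rfl fun a _ => ?_
  rw [hφ]
  simp [co_E]

theorem inner_nabla (hU : IsOpen U) (hX : SmoothOn X U) (hY : SmoothOn Y U) (hZ : SmoothOn Z U)
    (hx : x ∈ U) : g.val x (g.nabla X Y x) (Z x) = g.koszul X Y Z x := by
  rw [Fr.nabla_apply hU hX hY hx, Fr.tensor_expand (U := U) (x := x)
    (fun Z => g.koszul X Y Z x) (fun Z W hZ hW => g.koszul_add_right hU hx hZ hW hX hY)
    (fun f Z hf hZ => g.koszul_smul_right hU hx hZ hX hY hf) hZ]
  simp only [map_sum, map_smul, sum_apply, smul_apply, smul_eq_mul, co, g.symm x (Z x)]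
  exact Finset.sum_congr rfl fun a _ => by ring

theorem smooth_koszul (hU : IsOpen U) (hX : SmoothOn X U) (hY : SmoothOn Y U) (hZ : SmoothOn Z U) :
    SmoothFnOn (g.koszul X Y Z) U := by
  have := (((((Fr.smooth_D hU hX (g.smooth_inner hY hZ)).add
    (Fr.smooth_D hU hY (g.smooth_inner hZ hX))).sub
    (Fr.smooth_D hU hZ (g.smooth_inner hX hY))).add
    (g.smooth_inner (hX.brk hU hY) hZ)).sub
    (g.smooth_inner (hY.brk hU hZ) hX)).add
    (g.smooth_inner (hZ.brk hU hX) hY)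
  exact this.mul (contMDiffOn_const (c := (2 : ℝ)⁻¹))

theorem smooth_nabla (hU : IsOpen U) (hX : SmoothOn X U) (hY : SmoothOn Y U) :
    SmoothOn (g.nabla X Y) U := by
  have : SmoothOn (∑ a, (fun y => g.koszul X Y (Fr.E a) y * (Fr.η a)⁻¹) • Fr.E a) U :=
    SmoothOn.sum fun a _ => SmoothOn.smul ((Fr.smooth_koszul hU hX hY (Fr.smoothOn a U)).mul
      (contMDiffOn_const (c := (Fr.η a)⁻¹))) (Fr.smoothOn a U)
  refine this.congr fun y hy => ?_
  rw [Fr.nabla_apply hU hX hY hy]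
  simp [Finset.sum_apply, div_eq_mul_inv]

section
variable (hU : IsOpen U) (hx : x ∈ U) (hX : SmoothOn X U) (hX' : SmoothOn X' U) (hY : SmoothOn Y U)
  (hZ : SmoothOn Z U) (hf : SmoothFnOn f U)
include hU hx hX hY

include hX' in
theorem nabla_add_left : g.nabla (X + X') Y x = g.nabla X Y x + g.nabla X' Y x := by
  refine Fr.ext_inner _ _ fun a => ?_
  have hE := Fr.smoothOn a U
  rw [map_add, add_apply, Fr.inner_nabla hU (hX.add hX') hY hE hx, Fr.inner_nabla hU hX hY hE hx,
    Fr.inner_nabla hU hX' hY hE hx, g.koszul_add_left hU hx hX hX' hY hE]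

include hX' in
theorem nabla_add_right : g.nabla Y (X + X') x = g.nabla Y X x + g.nabla Y X' x := by
  refine Fr.ext_inner _ _ fun a => ?_
  have hE := Fr.smoothOn a U
  rw [map_add, add_apply, Fr.inner_nabla hU hY (hX.add hX') hE hx, Fr.inner_nabla hU hY hX hE hx,
    Fr.inner_nabla hU hY hX' hE hx, g.koszul_add_mid hU hx hX hX' hY hE]

include hf in
theorem nabla_smul_left : g.nabla (f • X) Y x = f x • g.nabla X Y x := by
  refine Fr.ext_inner _ _ fun a => ?_
  have hE := Fr.smoothOn a U
  rw [map_smul, smul_apply, Fr.inner_nabla hU (SmoothOn.smul hf hX) hY hE hx,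
    Fr.inner_nabla hU hX hY hE hx, g.koszul_smul_left hU hx hX hY hE hf, smul_eq_mul]

include hf in
theorem nabla_smul_right : g.nabla Y (f • X) x = f x • g.nabla Y X x + D Y f x • X x := by
  refine Fr.ext_inner _ _ fun a => ?_
  have hE := Fr.smoothOn a U
  rw [map_add, add_apply, map_smul, smul_apply, map_smul, smul_apply,
    Fr.inner_nabla hU hY (SmoothOn.smul hf hX) hE hx,
    Fr.inner_nabla hU hY hX hE hx, g.koszul_smul_mid hU hx hX hY hE hf, smul_eq_mul, smul_eq_mul]
  rfl

theorem torsion : g.nabla X Y x - g.nabla Y X x = brk X Y x := by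
  refine Fr.ext_inner _ _ fun a => ?_
  have hE := Fr.smoothOn a U
  rw [map_sub, sub_apply, Fr.inner_nabla hU hX hY hE hx, Fr.inner_nabla hU hY hX hE hx,
    g.koszul_eq, g.koszul_eq, g.inner_symm Y X, g.inner_symm Y (Fr.E a), g.inner_symm X (Fr.E a),
    brk_swap Y X, brk_swap X (Fr.E a), brk_swap Y (Fr.E a)]
  simp only [map_neg, neg_apply]
  ring

include hZ in
theorem D_inner : D X (g.inner Y Z) x =
    g.val x (g.nabla X Y x) (Z x) + g.val x (Y x) (g.nabla X Z x) := by
  rw [g.symm x (Y x), Fr.inner_nabla hU hX hY hZ hx, Fr.inner_nabla hU hX hZ hY hx,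
    g.koszul_eq, g.koszul_eq, g.inner_symm Z Y, g.inner_symm X Y, g.inner_symm Z X,
    brk_swap Z Y, brk_swap X Z, brk_swap Y X]
  simp only [map_neg, neg_apply]
  ring

end

theorem nabla_congr_right (hU : IsOpen U) (hx : x ∈ U) (h : ∀ y ∈ U, Y y = Y' y) :
    g.nabla X Y x = g.nabla X Y' x := by
  have h1 : ∀ Z, g.koszul X Y Z x = g.koszul X Y' Z x := by
    intro Z
    have e1 : D X (g.inner Y Z) x = D X (g.inner Y' Z) x :=
      D_congr hU hx fun y hy => by simp [LorentzMetric.inner, h y hy]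
    have e2 : D Z (g.inner X Y) x = D Z (g.inner X Y') x :=
      D_congr hU hx fun y hy => by simp [LorentzMetric.inner, h y hy]
    have e3 : D Y (g.inner Z X) x = D Y' (g.inner Z X) x := by simp [D, h x hx]
    rw [g.koszul_eq, g.koszul_eq, e1, e2, e3, brk_congr hU hx (fun _ _ => rfl) h,
      brk_congr hU hx h (fun _ _ => rfl), h x hx]
  simp only [LorentzMetric.nabla, h1]

theorem nabla_congr_left (hU : IsOpen U) (hx : x ∈ U) (h : ∀ y ∈ U, Y y = Y' y) :
    g.nabla Y X x = g.nabla Y' X x := by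
  have h1 : ∀ Z, g.koszul Y X Z x = g.koszul Y' X Z x := by
    intro Z
    have e1 : D X (g.inner Z Y) x = D X (g.inner Z Y') x :=
      D_congr hU hx fun y hy => by simp [LorentzMetric.inner, h y hy]
    have e2 : D Z (g.inner Y X) x = D Z (g.inner Y' X) x :=
      D_congr hU hx fun y hy => by simp [LorentzMetric.inner, h y hy]
    have e3 : D Y (g.inner X Z) x = D Y' (g.inner X Z) x := by simp [D, h x hx]
    rw [g.koszul_eq, g.koszul_eq, e1, e2, e3, brk_congr hU hx (fun _ _ => rfl) h,
      brk_congr hU hx h (fun _ _ => rfl), h x hx]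
  simp only [LorentzMetric.nabla, h1]

end OrthoFrame
end Optical

/-! ### Algebraic symmetries of the Riemann tensor. -/

namespace Optical

variable {M : Type*} [TopologicalSpace M] [ChartedSpace E5 M] [IsManifold (𝓡 5) ∞ M]
variable {U : Set M} {X Y Z W X' Y' : RField M} {f h : M → ℝ} {x : M}
variable {g : LorentzMetric M}

theorem LorentzMetric.curv_apply (g : LorentzMetric M) (X Y Z : RField M) (x : M) :
    g.curv X Y Z x = g.nabla X (g.nabla Y Z) x - g.nabla Y (g.nabla X Z) x
      - g.nabla (brk X Y) Z x := rfl

namespace OrthoFrame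
variable (Fr : OrthoFrame g)
include Fr

section
variable (hU : IsOpen U) (hx : x ∈ U) (hX : SmoothOn X U) (hX' : SmoothOn X' U) (hY : SmoothOn Y U)
  (hZ : SmoothOn Z U) (hW : SmoothOn W U) (hf : SmoothFnOn f U)
include hU hx hX hY

theorem nabla_neg_left : g.nabla (-X) Y x = -g.nabla X Y x := by
  have : -X = (fun _ : M => (-1 : ℝ)) • X := by funext y; simp
  rw [this, Fr.nabla_smul_left hU hx hX hY contMDiffOn_const]; simp

theorem nabla_neg_right : g.nabla Y (-X) x = -g.nabla Y X x := by
  have : -X = (fun _ : M => (-1 : ℝ)) • X := by funext y; simp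
  rw [this, Fr.nabla_smul_right hU hx hX hY contMDiffOn_const, D_const]; simp

include hX' in
theorem nabla_sub_right : g.nabla Y (X - X') x = g.nabla Y X x - g.nabla Y X' x := by
  rw [sub_eq_add_neg, Fr.nabla_add_right hU hx hX hX'.neg hY,
    Fr.nabla_neg_right hU hx hX' hY, sub_eq_add_neg]

include hX' in
theorem nabla_sub_left : g.nabla (X - X') Y x = g.nabla X Y x - g.nabla X' Y x := by
  rw [sub_eq_add_neg, Fr.nabla_add_left hU hx hX hX'.neg hY,
    Fr.nabla_neg_left hU hx hX' hY, sub_eq_add_neg]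

include hZ

omit hx in
theorem smooth_curv : SmoothOn (g.curv X Y Z) U :=
  ((Fr.smooth_nabla hU hX (Fr.smooth_nabla hU hY hZ)).sub
    (Fr.smooth_nabla hU hY (Fr.smooth_nabla hU hX hZ))).sub
    (Fr.smooth_nabla hU (hX.brk hU hY) hZ)

theorem curv_swap : g.curv X Y Z x = -g.curv Y X Z x := by
  have h1 : g.nabla (brk Y X) Z x = -g.nabla (brk X Y) Z x := by
    rw [← Fr.nabla_neg_left hU hx (hX.brk hU hY) hZ]
    exact Fr.nabla_congr_left hU hx fun y _ => brk_swap Y X y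
  rw [g.curv_apply, g.curv_apply, h1]
  module

include hX' in
theorem curv_add_left : g.curv (X + X') Y Z x = g.curv X Y Z x + g.curv X' Y Z x := by
  have hn := fun {A : RField M} (hA : SmoothOn A U) => Fr.smooth_nabla hU hA hZ
  have h1 : g.nabla (brk (X + X') Y) Z x = g.nabla (brk X Y + brk X' Y) Z x :=
    Fr.nabla_congr_left hU hx fun y hy => brk_add_left hU hX hX' hy
  have h2 : g.nabla Y (g.nabla (X + X') Z) x = g.nabla Y (g.nabla X Z + g.nabla X' Z) x :=
    Fr.nabla_congr_right hU hx fun y hy => Fr.nabla_add_left hU hy hX hX' hZ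
  rw [g.curv_apply, g.curv_apply, g.curv_apply, h1, h2,
    Fr.nabla_add_left hU hx (hX.brk hU hY) (hX'.brk hU hY) hZ,
    Fr.nabla_add_right hU hx (hn hX) (hn hX') hY, Fr.nabla_add_left hU hx hX hX' (hn hY)]
  module

include hf in
theorem curv_smul_left : g.curv (f • X) Y Z x = f x • g.curv X Y Z x := by
  have hn := fun {A : RField M} (hA : SmoothOn A U) => Fr.smooth_nabla hU hA hZ
  have hD := Fr.smooth_D hU hY hf
  have h1 : g.nabla (brk (f • X) Y) Z x = g.nabla (f • brk X Y - D Y f • X) Z x :=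
    Fr.nabla_congr_left hU hx fun y hy => by
      rw [brk_smul_left hU hf hX hy, Pi.sub_apply, Pi.smul_apply', Pi.smul_apply']
      module
  have h2 : g.nabla Y (g.nabla (f • X) Z) x = g.nabla Y (f • g.nabla X Z) x :=
    Fr.nabla_congr_right hU hx fun y hy => Fr.nabla_smul_left hU hy hX hZ hf
  rw [g.curv_apply, g.curv_apply, h1, h2,
    Fr.nabla_sub_left hU hx (SmoothOn.smul hf (hX.brk hU hY)) (SmoothOn.smul hD hX) hZ,
    Fr.nabla_smul_left hU hx (hX.brk hU hY) hZ hf, Fr.nabla_smul_left hU hx hX hZ hD,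
    Fr.nabla_smul_right hU hx (hn hX) hY hf, Fr.nabla_smul_left hU hx hX (hn hY) hf]
  module

/-- Grouping the second derivatives by their outer direction, vanishing torsion turns each group
into a double bracket; the three double brackets cancel by the Jacobi identity. -/
theorem curv_cyclic : g.curv X Y Z x + g.curv Y Z X x + g.curv Z X Y x = 0 := by
  have h1 : ∀ {A B C : RField M}, SmoothOn A U → SmoothOn B U → SmoothOn C U →
      g.nabla A (g.nabla B C) x - g.nabla A (g.nabla C B) x - g.nabla (brk B C) A x =
        brk A (brk B C) x := by
    intro A B C hA hB hC
    rw [← Fr.nabla_sub_right hU hx (Fr.smooth_nabla hU hB hC) (Fr.smooth_nabla hU hC hB) hA,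
      ← Fr.torsion hU hx hA (hB.brk hU hC)]
    congr 1
    exact Fr.nabla_congr_right hU hx fun y hy => Fr.torsion hU hy hB hC
  have hj := brk_jacobi hU hX hY hZ hx
  have h2 : brk (brk X Y) Z x = -brk Z (brk X Y) x := brk_swap _ _ _
  have h3 : brk Y (brk X Z) x = -brk Y (brk Z X) x := by
    rw [brk_swap, brk_swap Y, neg_neg, ← neg_neg (brk (brk X Z) Y x)]
    rw [brk_congr hU hx (Y' := Y) (X' := -brk Z X) (fun y hy => brk_swap _ _ _) (fun _ _ => rfl)]
    have : -brk Z X = (fun _ : M => (-1 : ℝ)) • brk Z X := by funext y; simp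
    rw [this, brk_smul_left hU contMDiffOn_const (hZ.brk hU hX) hx, D_const]
    simp
  have e1 := h1 hX hY hZ
  have e2 := h1 hY hZ hX
  have e3 := h1 hZ hX hY
  have : g.curv X Y Z x + g.curv Y Z X x + g.curv Z X Y x =
      (g.nabla X (g.nabla Y Z) x - g.nabla X (g.nabla Z Y) x - g.nabla (brk Y Z) X x)
      + (g.nabla Y (g.nabla Z X) x - g.nabla Y (g.nabla X Z) x - g.nabla (brk Z X) Y x)
      + (g.nabla Z (g.nabla X Y) x - g.nabla Z (g.nabla Y X) x - g.nabla (brk X Y) Z x) := by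
    rw [g.curv_apply, g.curv_apply, g.curv_apply]
    module
  rw [this, e1, e2, e3, hj, h2, h3]
  module

-- This is `D_brk` applied to the function g(Z, W), with every derivative expanded by metric
-- compatibility.
include hW in
theorem riem_skew_right : g.riem X Y Z W x = -g.riem X Y W Z x := by
  have h1 : ∀ {A B : RField M}, SmoothOn A U → SmoothOn B U →
      D A (D B (g.inner Z W)) x = g.val x (g.nabla A (g.nabla B Z) x) (W x)
        + g.val x (g.nabla B Z x) (g.nabla A W x) + (g.val x (g.nabla A Z x) (g.nabla B W x)
        + g.val x (Z x) (g.nabla A (g.nabla B W) x)) := by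
    intro A B hA hB
    have hBZ := Fr.smooth_nabla hU hB hZ
    have hBW := Fr.smooth_nabla hU hB hW
    rw [← Fr.D_inner hU hx hA hBZ hW, ← Fr.D_inner hU hx hA hZ hBW,
      ← D_add hU (g.smooth_inner hBZ hW) (g.smooth_inner hZ hBW) hx]
    exact D_congr hU hx fun y hy => Fr.D_inner hU hy hB hZ hW
  have h2 := Fr.D_brk hU hX hY (g.smooth_inner hZ hW) hx
  rw [h1 hX hY, h1 hY hX, Fr.D_inner hU hx (hX.brk hU hY) hZ hW] at h2
  simp only [LorentzMetric.riem, LorentzMetric.inner, g.curv_apply, map_sub, sub_apply]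
  rw [g.symm x (g.nabla X (g.nabla Y W) x), g.symm x (g.nabla Y (g.nabla X W) x),
    g.symm x (g.nabla (brk X Y) W x)]
  linarith

include hW in
theorem riem_skew_left : g.riem X Y Z W x = -g.riem Y X Z W x := by
  simp only [LorentzMetric.riem, LorentzMetric.inner]
  rw [Fr.curv_swap hU hx hX hY hZ, map_neg, neg_apply]

include hW in
theorem riem_cyclic : g.riem X Y Z W x + g.riem Y Z X W x + g.riem Z X Y W x = 0 := by
  simp only [LorentzMetric.riem, LorentzMetric.inner]
  rw [← add_apply, ← map_add, ← add_apply, ← map_add, Fr.curv_cyclic hU hx hX hY hZ]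
  simp

-- The classical combination of the four cyclic identities obtained by rotating `X, Y, Z, W`, with
-- both skew symmetries.
include hW in
theorem riem_pair : g.riem X Y Z W x = g.riem Z W X Y x := by
  have a1 := Fr.riem_cyclic hU hx hX hY hZ hW
  have a2 := Fr.riem_cyclic hU hx hY hZ hW hX
  have a3 := Fr.riem_cyclic hU hx hZ hW hX hY
  have a4 := Fr.riem_cyclic hU hx hW hX hY hZ
  have b1 := Fr.riem_skew_right hU hx hY hZ hX hW
  have b2 := Fr.riem_skew_right hU hx hZ hX hY hW
  have b3 := Fr.riem_skew_right hU hx hZ hW hY hX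
  have b4 := Fr.riem_skew_right hU hx hW hY hZ hX
  have b5 := Fr.riem_skew_right hU hx hW hX hZ hY
  have b6 := Fr.riem_skew_right hU hx hX hY hZ hW
  have c1 := Fr.riem_skew_left hU hx hX hZ hW hY
  have c2 := Fr.riem_skew_left hU hx hY hW hX hZ
  linarith

end

end OrthoFrame
end Optical

/-! ### Riemann, Ricci and Rho as smooth tensors with values at a point. -/

namespace Optical

variable {M : Type*} [TopologicalSpace M] [ChartedSpace E5 M] [IsManifold (𝓡 5) ∞ M]
variable {U : Set M} {X Y Z W X' Y' : RField M} {f h : M → ℝ} {x : M}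
variable {g : LorentzMetric M}

namespace OrthoFrame
variable (Fr : OrthoFrame g)

section lift
variable {N : Type*} [AddCommMonoid N] [Module ℝ N]

/-- The linear map on tangent vectors with given values on the frame. -/
def lift (t : Fin 5 → N) : TangentSpace (𝓡 5) x →ₗ[ℝ] N := ∑ a, (Fr.coLin a).smulRight (t a)

theorem lift_apply (t : Fin 5 → N) (v : TangentSpace (𝓡 5) x) :
    Fr.lift t v = ∑ a, Fr.co a v • t a := by
  simp [lift, LinearMap.sum_apply, coLin_apply]

theorem lift_E (t : Fin 5 → N) (a : Fin 5) : Fr.lift t (Fr.E a x) = t a := by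
  simp [lift_apply, co_E]

end lift

/-- The Riemann tensor at a point. -/
def riemT (x : M) : TangentSpace (𝓡 5) x →ₗ[ℝ] TangentSpace (𝓡 5) x →ₗ[ℝ]
    TangentSpace (𝓡 5) x →ₗ[ℝ] TangentSpace (𝓡 5) x →ₗ[ℝ] ℝ :=
  Fr.lift (x := x) fun a => Fr.lift (x := x) fun b => Fr.lift (x := x) fun c =>
    Fr.lift (x := x) fun d =>
    g.riem (Fr.E a) (Fr.E b) (Fr.E c) (Fr.E d) x

theorem riemT_E (x : M) (a b c d : Fin 5) :
    Fr.riemT x (Fr.E a x) (Fr.E b x) (Fr.E c x) (Fr.E d x) =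
      g.riem (Fr.E a) (Fr.E b) (Fr.E c) (Fr.E d) x := by
  simp only [riemT, lift_E]

/-- Only the first slot needs linearity over functions of the curvature itself; the second and third
slots follow by skew and pair symmetry, and the fourth is a pointwise inner product. -/
theorem riem_expand1 (hU : IsOpen U) (hx : x ∈ U) (hX : SmoothOn X U) (hY : SmoothOn Y U)
    (hZ : SmoothOn Z U) : g.riem X Y Z W x = ∑ a, Fr.co a (X x) * g.riem (Fr.E a) Y Z W x := by
  refine Fr.tensor_expand (U := U) (fun X => g.riem X Y Z W x) ?_ ?_ hX
  · intro A B hA hB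
    simp only [LorentzMetric.riem, LorentzMetric.inner]
    rw [Fr.curv_add_left hU hx hA hB hY hZ, map_add, add_apply]
  · intro f A hf hA
    simp only [LorentzMetric.riem, LorentzMetric.inner]
    rw [Fr.curv_smul_left hU hx hA hY hZ hf, map_smul, smul_apply, smul_eq_mul]

theorem riem_expand2 (hU : IsOpen U) (hx : x ∈ U) (hX : SmoothOn X U) (hY : SmoothOn Y U)
    (hZ : SmoothOn Z U) (hW : SmoothOn W U) :
    g.riem X Y Z W x = ∑ a, Fr.co a (Y x) * g.riem X (Fr.E a) Z W x := by
  rw [Fr.riem_skew_left hU hx hX hY hZ hW, Fr.riem_expand1 hU hx hY hX hZ,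
    ← Finset.sum_neg_distrib]
  refine Finset.sum_congr rfl fun a _ => ?_
  rw [Fr.riem_skew_left hU hx hX (Fr.smoothOn a U) hZ hW, mul_neg]

theorem riem_expand3 (hU : IsOpen U) (hx : x ∈ U) (hX : SmoothOn X U) (hY : SmoothOn Y U)
    (hZ : SmoothOn Z U) (hW : SmoothOn W U) :
    g.riem X Y Z W x = ∑ a, Fr.co a (Z x) * g.riem X Y (Fr.E a) W x := by
  rw [Fr.riem_pair hU hx hX hY hZ hW, Fr.riem_expand1 hU hx hZ hW hX]
  refine Finset.sum_congr rfl fun a _ => ?_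
  rw [Fr.riem_pair hU hx hX hY (Fr.smoothOn a U) hW]

theorem riem_expand4 : g.riem X Y Z W x = ∑ a, Fr.co a (W x) * g.riem X Y Z (Fr.E a) x := by
  simp only [LorentzMetric.riem, LorentzMetric.inner]
  conv_lhs => rw [← Fr.sum_co (W x)]
  simp only [map_sum, map_smul, smul_eq_mul]

theorem riem_eq (hU : IsOpen U) (hx : x ∈ U) (hX : SmoothOn X U) (hY : SmoothOn Y U)
    (hZ : SmoothOn Z U) (hW : SmoothOn W U) :
    g.riem X Y Z W x = Fr.riemT x (X x) (Y x) (Z x) (W x) := by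
  have hE := fun a => Fr.smoothOn a U
  rw [Fr.riem_expand1 hU hx hX hY hZ, riemT, lift_apply]
  simp only [LinearMap.sum_apply, LinearMap.smul_apply, smul_eq_mul]
  refine Finset.sum_congr rfl fun a _ => ?_
  rw [Fr.riem_expand2 hU hx (hE a) hY hZ hW, lift_apply]
  simp only [LinearMap.sum_apply, LinearMap.smul_apply, smul_eq_mul]
  refine congrArg _ (Finset.sum_congr rfl fun b _ => ?_)
  rw [Fr.riem_expand3 hU hx (hE a) (hE b) hZ hW, lift_apply]
  simp only [LinearMap.sum_apply, LinearMap.smul_apply, smul_eq_mul]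
  refine congrArg _ (Finset.sum_congr rfl fun c _ => ?_)
  rw [Fr.riem_expand4, lift_apply]
  simp only [smul_eq_mul]

/-- The Ricci tensor at a point. -/
def ricT (x : M) : TangentSpace (𝓡 5) x →ₗ[ℝ] TangentSpace (𝓡 5) x →ₗ[ℝ] ℝ :=
  LinearMap.mk₂ ℝ (fun v w => ∑ a, Fr.riemT x (Fr.E a x) v w (Fr.E a x) / Fr.η a)
    (by intros; simp [add_div, Finset.sum_add_distrib])
    (by intros; simp [mul_div_assoc, Finset.mul_sum])
    (by intros; simp [add_div, Finset.sum_add_distrib])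
    (by intros; simp [mul_div_assoc, Finset.mul_sum])

theorem ricT_apply (x : M) (v w : TangentSpace (𝓡 5) x) :
    Fr.ricT x v w = ∑ a, Fr.riemT x (Fr.E a x) v w (Fr.E a x) / Fr.η a := rfl

theorem ric_eq (hU : IsOpen U) (hx : x ∈ U) (hY : SmoothOn Y U) (hZ : SmoothOn Z U) :
    g.ric Y Z x = Fr.ricT x (Y x) (Z x) := by
  obtain ⟨V, hV, hxV, hs⟩ := exists_smooth_coordField x
  have hUV := hU.inter hV
  have hxUV : x ∈ U ∩ V := ⟨hx, hxV⟩
  have hY' := hY.mono (Set.inter_subset_left (t := V))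
  have hZ' := hZ.mono (Set.inter_subset_left (t := V))
  have hs' := fun i => (hs i).mono (Set.inter_subset_right (s := U))
  let T : TangentSpace (𝓡 5) x →ₗ[ℝ] TangentSpace (𝓡 5) x →ₗ[ℝ] ℝ :=
    LinearMap.mk₂ ℝ (fun v w => Fr.riemT x v (Y x) (Z x) w)
      (by intros; simp) (by intros; simp) (by intros; simp) (by intros; simp)
  have h1 : ∀ i j, g.riem (coordField x i) Y Z (coordField x j) x =
      T (coordVec x i) (coordVec x j) := by
    intro i j
    rw [Fr.riem_eq hUV hxUV (hs' i) hY' hZ' (hs' j), coordField_self, coordField_self]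
    rfl
  rw [LorentzMetric.ric]
  simp only [h1]
  exact Fr.trace_eq x T

theorem scal_eq (x : M) : g.scal x = ∑ a, Fr.ricT x (Fr.E a x) (Fr.E a x) / Fr.η a := by
  obtain ⟨V, hV, hxV, hs⟩ := exists_smooth_coordField x
  rw [LorentzMetric.scal, ← Fr.trace_eq x (Fr.ricT x)]
  simp only [fun i j => Fr.ric_eq hV hxV (hs i) (hs j), coordField_self]

/-- The Rho tensor at a point. -/
def rhoT (x : M) : TangentSpace (𝓡 5) x →ₗ[ℝ] TangentSpace (𝓡 5) x →ₗ[ℝ] ℝ :=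
  (3 : ℝ)⁻¹ • (Fr.ricT x - (g.scal x / 8) • g.form x)

theorem rho_eq (hU : IsOpen U) (hx : x ∈ U) (hY : SmoothOn Y U) (hZ : SmoothOn Z U) :
    g.rho Y Z x = Fr.rhoT x (Y x) (Z x) := by
  rw [LorentzMetric.rho, Fr.ric_eq hU hx hY hZ, rhoT]
  simp only [LinearMap.smul_apply, LinearMap.sub_apply, smul_eq_mul]
  rw [div_eq_inv_mul]
  rfl

include Fr

theorem smooth_riem (hU : IsOpen U) (hX : SmoothOn X U) (hY : SmoothOn Y U)
    (hZ : SmoothOn Z U) (hW : SmoothOn W U) : SmoothFnOn (g.riem X Y Z W) U :=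
  g.smooth_inner (Fr.smooth_curv hU hX hY hZ) hW

theorem smooth_ric (hU : IsOpen U) (hY : SmoothOn Y U) (hZ : SmoothOn Z U) :
    SmoothFnOn (g.ric Y Z) U := by
  have h : SmoothFnOn (fun y => ∑ a, g.riem (Fr.E a) Y Z (Fr.E a) y * (Fr.η a)⁻¹) U :=
    contMDiffOn_finsetSum fun a _ =>
      (Fr.smooth_riem hU (Fr.smoothOn a U) hY hZ (Fr.smoothOn a U)).mul contMDiffOn_const
  refine h.congr fun y hy => ?_
  rw [Fr.ric_eq hU hy hY hZ, ricT_apply]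
  refine Finset.sum_congr rfl fun a _ => ?_
  rw [Fr.riem_eq hU hy (Fr.smoothOn a U) hY hZ (Fr.smoothOn a U), div_eq_mul_inv]

theorem smooth_scal (hU : IsOpen U) : SmoothFnOn g.scal U := by
  have h : SmoothFnOn (fun y => ∑ a, g.ric (Fr.E a) (Fr.E a) y * (Fr.η a)⁻¹) U :=
    contMDiffOn_finsetSum fun a _ =>
      (Fr.smooth_ric hU (Fr.smoothOn a U) (Fr.smoothOn a U)).mul contMDiffOn_const
  refine h.congr fun y hy => ?_
  rw [Fr.scal_eq]
  refine Finset.sum_congr rfl fun a _ => ?_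
  rw [Fr.ric_eq hU hy (Fr.smoothOn a U) (Fr.smoothOn a U), div_eq_mul_inv]

theorem smooth_rho (hU : IsOpen U) (hY : SmoothOn Y U) (hZ : SmoothOn Z U) :
    SmoothFnOn (g.rho Y Z) U := by
  have h := ((Fr.smooth_ric hU hY hZ).sub (((Fr.smooth_scal hU).mul
    (contMDiffOn_const (c := (8 : ℝ)⁻¹))).mul (g.smooth_inner hY hZ))).mul
    (contMDiffOn_const (c := (3 : ℝ)⁻¹))
  exact h

theorem ricT_symm (x : M) (v w : TangentSpace (𝓡 5) x) : Fr.ricT x v w = Fr.ricT x w v := by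
  have hE := fun a => Fr.smoothOn a (Set.univ : Set M)
  have h : ∀ b c, Fr.ricT x (Fr.E b x) (Fr.E c x) = Fr.ricT x (Fr.E c x) (Fr.E b x) := by
    intro b c
    simp only [ricT_apply, riemT_E]
    refine Finset.sum_congr rfl fun a _ => ?_
    rw [Fr.riem_pair isOpen_univ trivial (hE a) (hE b) (hE c) (hE a),
      Fr.riem_skew_left isOpen_univ trivial (hE c) (hE a) (hE a) (hE b),
      Fr.riem_skew_right isOpen_univ trivial (hE a) (hE c) (hE a) (hE b), neg_neg]
  rw [← Fr.sum_co v, ← Fr.sum_co w]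
  simp only [map_sum, map_smul, LinearMap.sum_apply, LinearMap.smul_apply,
    Finset.smul_sum]
  rw [Finset.sum_comm]
  exact Finset.sum_congr rfl fun a _ => Finset.sum_congr rfl fun b _ => by
    rw [h b a, smul_comm]

theorem rhoT_symm (x : M) (v w : TangentSpace (𝓡 5) x) : Fr.rhoT x v w = Fr.rhoT x w v := by
  simp only [rhoT, LinearMap.smul_apply, LinearMap.sub_apply, Fr.ricT_symm x v w]
  have : g.form x v w = g.form x w v := g.symm x v w
  rw [this]

end OrthoFrame
end Optical

/-! ### The differential Bianchi identity for the Riemann and Weyl tensors. -/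

namespace Optical

variable {M : Type*} [TopologicalSpace M] [ChartedSpace E5 M] [IsManifold (𝓡 5) ∞ M]
variable {U : Set M} {X Y Z V W X' Y' : RField M} {f h : M → ℝ} {x : M}

/-- The covariant derivative of a covariant four-tensor, as a functional of vector fields. -/
def LorentzMetric.nabla4 (g : LorentzMetric M)
    (T : RField M → RField M → RField M → RField M → M → ℝ) (X Y Z V W : RField M) (x : M) : ℝ :=
  D X (T Y Z V W) x - T (g.nabla X Y) Z V W x - T Y (g.nabla X Z) V W x
    - T Y Z (g.nabla X V) W x - T Y Z V (g.nabla X W) x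

variable {g : LorentzMetric M}

namespace OrthoFrame
variable (Fr : OrthoFrame g)
include Fr

theorem curv_congr_left (hU : IsOpen U) (hx : x ∈ U) (h : ∀ y ∈ U, X y = X' y) :
    g.curv X Y Z x = g.curv X' Y Z x := by
  rw [g.curv_apply, g.curv_apply, Fr.nabla_congr_left hU hx h,
    Fr.nabla_congr_right (Y := g.nabla X Z) hU hx fun y hy => Fr.nabla_congr_left hU hy h,
    Fr.nabla_congr_left (Y := brk X Y) hU hx fun y hy => brk_congr hU hy h fun _ _ => rfl]

section
variable (hU : IsOpen U) (hx : x ∈ U) (hX : SmoothOn X U) (hY : SmoothOn Y U)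
  (hZ : SmoothOn Z U) (hV : SmoothOn V U) (hW : SmoothOn W U)
include hU hx hX hY hZ hV

theorem curv_brk : g.curv (brk X Y) Z V x =
    g.curv (g.nabla X Y) Z V x - g.curv (g.nabla Y X) Z V x := by
  have hb := hX.brk hU hY
  have hn := Fr.smooth_nabla hU hY hX
  rw [eq_sub_iff_add_eq, ← Fr.curv_add_left hU hx hb hn hZ hV]
  refine Fr.curv_congr_left hU hx fun y hy => ?_
  rw [Pi.add_apply, ← Fr.torsion hU hy hX hY, sub_add_cancel]

theorem nabla_jacobi : g.nabla (brk (brk X Y) Z) V x + g.nabla (brk (brk Y Z) X) V x +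
    g.nabla (brk (brk Z X) Y) V x = 0 := by
  have h1 := (hX.brk hU hY).brk hU hZ
  have h2 := (hY.brk hU hZ).brk hU hX
  have h3 := (hZ.brk hU hX).brk hU hY
  rw [← Fr.nabla_add_left hU hx h1 h2 hV, ← Fr.nabla_add_left hU hx (h1.add h2) h3 hV]
  have h0 : ∀ y ∈ U, (brk (brk X Y) Z + brk (brk Y Z) X + brk (brk Z X) Y) y
      = ((fun _ : M => (0 : ℝ)) • X) y := by
    intro y hy
    have hj := brk_jacobi hU hX hY hZ hy
    have e1 : brk (brk Y Z) X y = -brk X (brk Y Z) y := brk_swap _ _ _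
    have e2 : brk (brk Z X) Y y = brk Y (brk X Z) y := by
      have : brk (brk Z X) Y y = brk (((fun _ : M => (-1 : ℝ)) • brk X Z)) Y y :=
        brk_congr hU hy (fun y _ => by rw [brk_swap]; simp) fun _ _ => rfl
      rw [this, brk_smul_left hU contMDiffOn_const (hX.brk hU hZ) hy, D_const, brk_swap Y]
      simp
    simp only [Pi.add_apply, Pi.smul_apply', zero_smul]
    rw [e1, e2, hj]
    module
  rw [Fr.nabla_congr_left hU hx h0, Fr.nabla_smul_left hU hx hX hV contMDiffOn_const, zero_smul]

/-- The double commutators of the three covariant derivatives cancel by the Jacobi identity for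
operators. What remains is the curvature along brackets, matched with the terms in `nabla X Y` by
`curv_brk`, and the derivatives along double brackets, which cancel by `nabla_jacobi`. -/
theorem curv_bianchi :
    (g.nabla X (g.curv Y Z V) x - g.curv (g.nabla X Y) Z V x - g.curv Y (g.nabla X Z) V x
      - g.curv Y Z (g.nabla X V) x) +
    (g.nabla Y (g.curv Z X V) x - g.curv (g.nabla Y Z) X V x - g.curv Z (g.nabla Y X) V x
      - g.curv Z X (g.nabla Y V) x) +
    (g.nabla Z (g.curv X Y V) x - g.curv (g.nabla Z X) Y V x - g.curv X (g.nabla Z Y) V x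
      - g.curv X Y (g.nabla Z V) x) = 0 := by
  have hn := fun {A B : RField M} (hA : SmoothOn A U) (hB : SmoothOn B U) =>
    Fr.smooth_nabla hU hA hB
  have h1 : ∀ {A B C : RField M}, SmoothOn A U → SmoothOn B U → SmoothOn C U →
      g.nabla A (g.curv B C V) x = g.nabla A (g.nabla B (g.nabla C V)) x
        - g.nabla A (g.nabla C (g.nabla B V)) x - g.nabla A (g.nabla (brk B C) V) x := by
    intro A B C hA hB hC
    rw [← Fr.nabla_sub_right hU hx (hn hB (hn hC hV)) (hn hC (hn hB hV)) hA,
      ← Fr.nabla_sub_right hU hx ((hn hB (hn hC hV)).sub (hn hC (hn hB hV)))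
        (hn (hB.brk hU hC) hV) hA]
    rfl
  rw [h1 hX hY hZ, h1 hY hZ hX, h1 hZ hX hY,
    Fr.curv_swap hU hx hY (hn hX hZ) hV, Fr.curv_swap hU hx hZ (hn hY hX) hV,
    Fr.curv_swap hU hx hX (hn hZ hY) hV]
  have c1 := Fr.curv_brk hU hx hX hY hZ hV
  have c2 := Fr.curv_brk hU hx hY hZ hX hV
  have c3 := Fr.curv_brk hU hx hZ hX hY hV
  have hj := Fr.nabla_jacobi hU hx hX hY hZ hV
  rw [g.curv_apply] at c1 c2 c3
  rw [g.curv_apply Y Z, g.curv_apply Z X, g.curv_apply X Y]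
  rw [← sub_eq_zero] at c1 c2 c3
  -- Packages the fact that the cyclic sum is the sum of the left sides of the four relations just
  -- obtained; the regrouping is left to `module`.
  have h0 : ∀ {a b c d e : TangentSpace (𝓡 5) x}, b = 0 → c = 0 → d = 0 → e = 0 →
      a = b + c + d + e → a = 0 := by
    rintro a b c d e rfl rfl rfl rfl h; simpa using h
  refine h0 c1 c2 c3 hj ?_
  module

include hW in
theorem nabla4_riem : g.nabla4 g.riem X Y Z V W x =
    g.val x (g.nabla X (g.curv Y Z V) x - g.curv (g.nabla X Y) Z V x - g.curv Y (g.nabla X Z) V x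
      - g.curv Y Z (g.nabla X V) x) (W x) := by
  have h1 : D X (g.riem Y Z V W) x = _ :=
    Fr.D_inner hU hx hX (Fr.smooth_curv hU hY hZ hV) hW
  rw [LorentzMetric.nabla4, h1]
  simp only [LorentzMetric.riem, LorentzMetric.inner, map_sub, sub_apply]
  ring

include hW in
theorem nabla4_riem_cyclic : g.nabla4 g.riem X Y Z V W x + g.nabla4 g.riem Y Z X V W x +
    g.nabla4 g.riem Z X Y V W x = 0 := by
  rw [Fr.nabla4_riem hU hx hX hY hZ hV hW, Fr.nabla4_riem hU hx hY hZ hX hV hW,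
    Fr.nabla4_riem hU hx hZ hX hY hV hW, ← add_apply, ← map_add, ← add_apply, ← map_add,
    Fr.curv_bianchi hU hx hX hY hZ hV]
  simp

-- The metric is parallel, so in each product of metric and Rho tensor only the Rho factor
-- contributes a derivative.
include hW in
theorem nabla4_weyl : g.nabla4 g.weyl X Y Z V W x = g.nabla4 g.riem X Y Z V W x
    + g.inner Y V x * g.nablaRho X Z W x - g.inner Z V x * g.nablaRho X Y W x
    - g.inner Y W x * g.nablaRho X Z V x + g.inner Z W x * g.nablaRho X Y V x := by
  have hr := fun {A B : RField M} (hA : SmoothOn A U) (hB : SmoothOn B U) =>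
    Fr.smooth_rho hU hA hB
  have hi := fun {A B : RField M} (hA : SmoothOn A U) (hB : SmoothOn B U) =>
    g.smooth_inner hA hB
  have hw : g.weyl Y Z V W = g.riem Y Z V W + g.inner Y V * g.rho Z W - g.inner Z V * g.rho Y W
    - g.inner Y W * g.rho Z V + g.inner Z W * g.rho Y V := rfl
  have h1 := Fr.smooth_riem hU hY hZ hV hW
  have h2 : SmoothFnOn (g.inner Y V * g.rho Z W) U := (hi hY hV).mul (hr hZ hW)
  have h3 : SmoothFnOn (g.inner Z V * g.rho Y W) U := (hi hZ hV).mul (hr hY hW)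
  have h4 : SmoothFnOn (g.inner Y W * g.rho Z V) U := (hi hY hW).mul (hr hZ hV)
  have h5 : SmoothFnOn (g.inner Z W * g.rho Y V) U := (hi hZ hW).mul (hr hY hV)
  have h12 : SmoothFnOn (g.riem Y Z V W + g.inner Y V * g.rho Z W) U := h1.add h2
  have h13 : SmoothFnOn (g.riem Y Z V W + g.inner Y V * g.rho Z W - g.inner Z V * g.rho Y W) U :=
    h12.sub h3
  have h14 : SmoothFnOn (g.riem Y Z V W + g.inner Y V * g.rho Z W - g.inner Z V * g.rho Y W
    - g.inner Y W * g.rho Z V) U := h13.sub h4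
  have hN : ∀ A B : RField M, g.nablaRho X A B x =
    D X (g.rho A B) x - g.rho (g.nabla X A) B x - g.rho A (g.nabla X B) x := fun _ _ => rfl
  rw [LorentzMetric.nabla4, LorentzMetric.nabla4, hw, D_add hU h14 h5 hx, D_sub hU h13 h4 hx,
    D_sub hU h12 h3 hx, D_add hU h1 h2 hx, D_mul hU (hi hY hV) (hr hZ hW) hx,
    D_mul hU (hi hZ hV) (hr hY hW) hx, D_mul hU (hi hY hW) (hr hZ hV) hx,
    D_mul hU (hi hZ hW) (hr hY hV) hx, Fr.D_inner hU hx hX hY hV, Fr.D_inner hU hx hX hZ hV,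
    Fr.D_inner hU hx hX hY hW, Fr.D_inner hU hx hX hZ hW]
  simp only [LorentzMetric.weyl, hN]
  simp only [LorentzMetric.inner]
  ring

include hW in
/-- The Bianchi identity for the Weyl tensor: its cyclic derivative is given by the Cotton-York
tensor. -/
theorem nabla4_weyl_cyclic : g.nabla4 g.weyl X Y Z V W x + g.nabla4 g.weyl Y Z X V W x +
    g.nabla4 g.weyl Z X Y V W x =
    g.inner X V x * g.cotton W Z Y x - g.inner X W x * g.cotton V Z Y x
    + (g.inner Y V x * g.cotton W X Z x - g.inner Y W x * g.cotton V X Z x)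
    + (g.inner Z V x * g.cotton W Y X x - g.inner Z W x * g.cotton V Y X x) := by
  have := Fr.nabla4_riem_cyclic hU hx hX hY hZ hV hW
  rw [Fr.nabla4_weyl hU hx hX hY hZ hV hW, Fr.nabla4_weyl hU hx hY hZ hX hV hW,
    Fr.nabla4_weyl hU hx hZ hX hY hV hW]
  simp only [LorentzMetric.cotton]
  linear_combination this

end

end OrthoFrame
end Optical

/-! ### Linear algebra of the Bianchi identity for a Weyl tensor of type D. -/

namespace Optical

/-- The involution of the indices of a null frame `(k, m̄, l, m, u)` that the metric defines. -/
def star : Fin 5 → Fin 5 := ![2, 3, 0, 1, 4]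

/-- The weight of the vectors of a null frame. -/
def wt : Fin 5 → ℤ × ℤ := ![(1, 0), (0, 1), (-1, 0), (0, -1), (0, 0)]

/-- The components of the derivative of a four-tensor with components `c`. -/
def nablaComp (Γ : Fin 5 → Fin 5 → Fin 5 → ℂ) (c : Fin 5 → Fin 5 → Fin 5 → Fin 5 → ℂ)
    (dc : Fin 5 → Fin 5 → Fin 5 → Fin 5 → Fin 5 → ℂ) (i j k p q : Fin 5) : ℂ :=
  dc i j k p q - ∑ m, Γ i j (star m) * c m k p q - ∑ m, Γ i k (star m) * c j m p q
    - ∑ m, Γ i p (star m) * c j k m q - ∑ m, Γ i q (star m) * c j k p m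

/-- The metric in a null frame. -/
def nullMetric (i j : Fin 5) : ℂ := if j = star i then 1 else 0

/-- The components, in a null frame, of the connection, of the Weyl tensor of type D and its
derivatives, and of the Cotton-York tensor, with the relations between them. -/
structure TypeDData where
  Γ : Fin 5 → Fin 5 → Fin 5 → ℂ
  c : Fin 5 → Fin 5 → Fin 5 → Fin 5 → ℂ
  dc : Fin 5 → Fin 5 → Fin 5 → Fin 5 → Fin 5 → ℂ
  A : Fin 5 → Fin 5 → Fin 5 → ℂ
  Γ_skew : ∀ i j k, Γ i j k = -Γ i k j
  c_skew : ∀ i j k l, c i j k l = -c j i k l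
  c_pair : ∀ i j k l, c i j k l = c k l i j
  c_cyclic : ∀ i j k l, c i j k l + c j k i l + c k i j l = 0
  c_trace : ∀ i j, ∑ m, c m i j (star m) = 0
  c_wt : ∀ i j k l, wt i + wt j + wt k + wt l ≠ 0 → c i j k l = 0
  dc_wt : ∀ n i j k l, wt i + wt j + wt k + wt l ≠ 0 → dc n i j k l = 0
  bianchi : ∀ i j k p q, nablaComp Γ c dc i j k p q + nablaComp Γ c dc j k i p q
      + nablaComp Γ c dc k i j p q =
    nullMetric i p * A q k j - nullMetric i q * A p k j
    + (nullMetric j p * A q i k - nullMetric j q * A p i k)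
    + (nullMetric k p * A q j i - nullMetric k q * A p j i)
  A_zero : ∀ r i j, r = 0 ∨ r = 1 → i = 0 ∨ i = 1 ∨ i = 4 → j = 0 ∨ j = 1 ∨ j = 4 → A r i j = 0

namespace TypeDData
variable (T : TypeDData)

theorem c_skew' (i j k l : Fin 5) : T.c i j k l = -T.c i j l k := by
  rw [T.c_pair, T.c_skew, T.c_pair]

theorem c_self (i k l : Fin 5) : T.c i i k l = 0 := by
  have := T.c_skew i i k l
  linear_combination this / 2

/-- The exchange of the roles of `k` and `m̄`. -/
def swap : Fin 5 → Fin 5 := ![1, 0, 3, 2, 4]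

/-- The trace over the slots paired with `u, u`. It is why exchanging `k` and `m̄` changes the sign
of Ψ₂⁰. Together with `c_0202` and `c_0213` it reduces the Weyl components met below to ψ = `c 0 1 2
3`, ψ' = `c 0 3 2 1` and φ = `c 0 4 2 4`. -/
theorem c_1434 : T.c 1 4 3 4 = -T.c 0 4 2 4 := by
  have h := T.c_trace 4 4
  simp only [Fin.sum_univ_five, star, Matrix.cons_val] at h
  rw [T.c_self, T.c_skew' 0, T.c_skew' 1, T.c_pair 2, T.c_skew 4 0, T.c_pair 3, T.c_skew 4 1] at h
  linear_combination -h / 2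

theorem c_0202 : T.c 0 2 0 2 = T.c 0 1 2 3 + T.c 0 3 2 1 + T.c 0 4 2 4 := by
  have h := T.c_trace 0 2
  simp only [Fin.sum_univ_five, star, Matrix.cons_val] at h
  rw [T.c_self, T.c_skew 1, T.c_skew 2, T.c_skew' 0 2, T.c_skew 3, T.c_skew 4] at h
  linear_combination h

theorem c_0213 : T.c 0 2 1 3 = T.c 0 1 2 3 - T.c 0 3 2 1 := by
  have h := T.c_cyclic 0 2 1 3
  rw [T.c_pair 2, T.c_skew 1] at h
  linear_combination h

/-- In the Bianchi component (0, 1, 4; 0, 4) all derivatives of Weyl components have nonzero weight,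
and the one Cotton-York term with nonzero metric factor vanishes by `A_zero`. What is left is a
single Γ times φ. The components used in `sigma`, `eq_one` and `eq_two` reduce to algebra in the
same way. -/
theorem kappa (hφ : T.c 0 4 2 4 ≠ 0) : T.Γ 0 0 1 = 0 := by
  have h := T.bianchi 0 1 4 0 4
  have hc := fun i j k l => T.c_wt i j k l
  have hd := fun n i j k l => T.dc_wt n i j k l
  simp +decide only [nablaComp, Fin.sum_univ_five, star, nullMetric, hc, hd, T.A_zero] at h
  simp at h
  have h0 : T.Γ 1 0 0 = 0 := by linear_combination T.Γ_skew 1 0 0 / 2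
  rw [T.Γ_skew 0 1 0, h0, T.c_1434, T.c_pair 2 4 0 4, T.c_skew 4 2, T.c_skew 4 0,
    T.c_pair 2 4 0 4] at h
  refine (mul_eq_zero.1 (?_ : T.c 0 4 2 4 * T.Γ 0 0 1 = 0)).resolve_left hφ
  linear_combination h / 2

theorem sigma (hφ : T.c 0 1 2 3 + T.c 0 4 2 4 ≠ 0) : T.Γ 0 0 4 = 0 := by
  have h := T.bianchi 0 3 4 0 1
  have hc := fun i j k l => T.c_wt i j k l
  have hd := fun n i j k l => T.dc_wt n i j k l
  simp +decide only [nablaComp, Fin.sum_univ_five, star, nullMetric, hc, hd, T.A_zero] at h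
  simp at h
  have h0 : T.Γ 4 0 0 = 0 := by linear_combination T.Γ_skew 4 0 0 / 2
  rw [T.Γ_skew 0 4 0, h0, T.c_skew 3 2, T.c_pair 2 3, T.c_skew' 3 4, T.c_pair 3 4, T.c_1434] at h
  refine (mul_eq_zero.1 (?_ : (T.c 0 1 2 3 + T.c 0 4 2 4) * T.Γ 0 0 4 = 0)).resolve_left hφ
  linear_combination -h

/-- With `eq_two` this gives two equations for the three unknowns `Γ 0 1 4`, `Γ 1 0 4`, `Γ 4 0 1`.
The same pair for `swapData` involves the same unknowns and completes the system. -/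
theorem eq_one : T.Γ 0 1 4 * (T.c 0 1 2 3 - T.c 0 3 2 1)
    - T.Γ 1 0 4 * (T.c 0 1 2 3 + T.c 0 3 2 1 + 2 * T.c 0 4 2 4)
    + T.Γ 4 0 1 * (3 * T.c 0 1 2 3 + T.c 0 4 2 4) = 0 := by
  have h := T.bianchi 0 1 4 0 2
  have hc := fun i j k l => T.c_wt i j k l
  have hd := fun n i j k l => T.dc_wt n i j k l
  simp +decide only [nablaComp, Fin.sum_univ_five, star, nullMetric, hc, hd, T.c_self,
    T.A_zero] at h
  simp at h
  rw [T.Γ_skew 0 4 1, T.Γ_skew 1 4 0, T.Γ_skew 4 1 0, T.c_skew 3 1, T.c_pair 1 3, T.c_skew 2 0,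
    T.c_skew 4 0, T.c_skew' 0 4 4 2, T.c_skew' 0 1 3 2, T.c_0213, T.c_0202] at h
  linear_combination h

theorem eq_two : T.Γ 0 1 4 * (T.c 0 1 2 3 - T.c 0 4 2 4)
    + T.Γ 4 0 1 * (3 * T.c 0 1 2 3 + T.c 0 4 2 4) = 0 := by
  have h := T.bianchi 0 2 4 0 1
  have hc := fun i j k l => T.c_wt i j k l
  have hd := fun n i j k l => T.dc_wt n i j k l
  simp +decide only [nablaComp, Fin.sum_univ_five, star, nullMetric, hc, hd, T.A_zero] at h
  simp at h
  rw [T.Γ_skew 0 4 1, T.Γ_skew 4 1 0, T.c_skew 3 2, T.c_pair 2 3, T.c_pair 2 4, T.c_skew' 0 2 3 1,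
    T.c_0213, T.c_0202] at h
  linear_combination h

theorem swap_involutive : Function.Involutive swap := by
  intro i; revert i; decide

theorem sum_swap (f : Fin 5 → ℂ) : ∑ m, f (swap m) = ∑ m, f m :=
  swap_involutive.bijective.sum_comp f

theorem star_swap (i : Fin 5) : star (swap i) = swap (star i) := by revert i; decide

theorem wt_swap (i : Fin 5) : wt (swap i) = (wt i).swap := by revert i; decide

theorem wt_swap_ne {i j k l : Fin 5} (h : wt i + wt j + wt k + wt l ≠ 0) :
    wt (swap i) + wt (swap j) + wt (swap k) + wt (swap l) ≠ 0 := by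
  simp only [wt_swap]
  intro h0
  apply h
  have := congrArg Prod.swap h0
  simpa [Prod.ext_iff, and_comm] using this

theorem nullMetric_swap (i j : Fin 5) : nullMetric (swap i) (swap j) = nullMetric i j := by
  simp only [nullMetric, star_swap, swap_involutive.injective.eq_iff]

/-- The data with the roles of `k` and `m̄` exchanged. -/
def swapData : TypeDData where
  Γ i j k := T.Γ (swap i) (swap j) (swap k)
  c i j k l := T.c (swap i) (swap j) (swap k) (swap l)
  dc n i j k l := T.dc (swap n) (swap i) (swap j) (swap k) (swap l)
  A i j k := T.A (swap i) (swap j) (swap k)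
  Γ_skew _ _ _ := T.Γ_skew _ _ _
  c_skew _ _ _ _ := T.c_skew _ _ _ _
  c_pair _ _ _ _ := T.c_pair _ _ _ _
  c_cyclic _ _ _ _ := T.c_cyclic _ _ _ _
  c_trace i j := by
    rw [← T.c_trace (swap i) (swap j), ← sum_swap fun m => T.c m _ _ _]
    simp only [star_swap]
  c_wt i j k l h := T.c_wt _ _ _ _ (wt_swap_ne h)
  dc_wt n i j k l h := T.dc_wt _ _ _ _ _ (wt_swap_ne h)
  bianchi i j k p q := by
    have h := T.bianchi (swap i) (swap j) (swap k) (swap p) (swap q)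
    simp only [nullMetric_swap] at h
    rw [← h]
    simp only [nablaComp, ← star_swap]
    simp only [fun a b d e f : Fin 5 => sum_swap fun m => T.Γ a b (star m) * T.c m d e f,
      fun a b d e f : Fin 5 => sum_swap fun m => T.Γ a b (star m) * T.c d m e f,
      fun a b d e f : Fin 5 => sum_swap fun m => T.Γ a b (star m) * T.c d e m f,
      fun a b d e f : Fin 5 => sum_swap fun m => T.Γ a b (star m) * T.c d e f m]
  A_zero r i j hr hi hj := by
    apply T.A_zero <;> revert r i j <;> decide

/-- The connection components obstructing the integrability of `N` and `N^⊥` vanish. -/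
theorem gamma_eq_zero (hψ : T.c 0 1 2 3 ≠ 0) (hφ : T.c 0 4 2 4 ≠ 0)
    (h1 : T.c 0 1 2 3 ≠ T.c 0 4 2 4) (h2 : T.c 0 1 2 3 ≠ -T.c 0 4 2 4) (i j k : Fin 5)
    (hi : i = 0 ∨ i = 1 ∨ i = 4) (hj : j = 0 ∨ j = 1 ∨ j = 4) (hk : k = 0 ∨ k = 1)
    (hij : i ≠ 4 ∨ j ≠ 4) :
    T.Γ i j k = 0 := by
  -- The exchange of `k` and `m̄` fixes ψ and ψ', while φ becomes -φ by `c_1434`.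
  have e1 : T.c 1 0 3 2 = T.c 0 1 2 3 := by rw [T.c_skew, T.c_skew', neg_neg]
  have e2 : T.c 1 2 3 0 = T.c 0 3 2 1 := by rw [T.c_pair, T.c_skew, T.c_skew', neg_neg]
  have a1 := T.kappa hφ
  have a2 : T.Γ 1 1 0 = 0 := T.swapData.kappa (by
    change T.c 1 4 3 4 ≠ 0
    rw [T.c_1434]; exact neg_ne_zero.2 hφ)
  have b1 := T.sigma (fun h => h2 (by linear_combination h))
  have b2 : T.Γ 1 1 4 = 0 := T.swapData.sigma (fun h => h1 (by
    change T.c 1 0 3 2 + T.c 1 4 3 4 = 0 at h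
    rw [e1, T.c_1434] at h
    linear_combination h))
  have c1 := T.eq_one
  have c2 := T.eq_two
  have d1 := T.swapData.eq_one
  have d2 := T.swapData.eq_two
  change T.Γ 1 0 4 * (T.c 1 0 3 2 - T.c 1 2 3 0)
    - T.Γ 0 1 4 * (T.c 1 0 3 2 + T.c 1 2 3 0 + 2 * T.c 1 4 3 4)
    + T.Γ 4 1 0 * (3 * T.c 1 0 3 2 + T.c 1 4 3 4) = 0 at d1
  change T.Γ 1 0 4 * (T.c 1 0 3 2 - T.c 1 4 3 4)
    + T.Γ 4 1 0 * (3 * T.c 1 0 3 2 + T.c 1 4 3 4) = 0 at d2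
  rw [T.Γ_skew 4 1 0, e1, e2, T.c_1434] at d1
  rw [T.Γ_skew 4 1 0, e1, T.c_1434] at d2
  generalize T.c 0 1 2 3 = ψ at *
  generalize T.c 0 3 2 1 = ψ' at *
  generalize T.c 0 4 2 4 = φ at *
  have hp : ψ - φ ≠ 0 := sub_ne_zero.2 h1
  have hm : ψ + φ ≠ 0 := fun h => h2 (by linear_combination h)
  -- Subtracting `c1 - c2` from `d1 - d2` eliminates ψ' and leaves (ψ + φ) Γ₁₀₄ = (ψ - φ) Γ₀₁₄.
  -- Substituting `c2` and `d2` turns this into 6 ψ Γ₄₀₁ = 0. The combination below is this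
  -- computation multiplied by (ψ - φ)(ψ + φ).
  have c0 : T.Γ 4 0 1 = 0 := by
    have : T.Γ 4 0 1 * (6 * ψ * (ψ - φ) * (ψ + φ)) = 0 := by
      linear_combination
        ((d1 - d2) * (ψ - φ) * (ψ + φ) - d2 * (-φ - ψ') * (ψ - φ) + c2 * (ψ + ψ' - 2 * φ) * (ψ + φ))
        - ((c1 - c2) * (ψ - φ) * (ψ + φ) - c2 * (φ - ψ') * (ψ + φ)
          + d2 * (ψ + ψ' + 2 * φ) * (ψ - φ))
    simpa [hψ, hp, hm] using this
  have a0 : T.Γ 0 1 4 = 0 := by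
    rw [c0] at c2
    simpa [hp] using c2
  have b0 : T.Γ 1 0 4 = 0 := by
    rw [c0] at d2
    simpa [hm] using d2
  have s0 : ∀ i j, T.Γ i j j = 0 := fun i j => by linear_combination T.Γ_skew i j j / 2
  rcases hi with rfl | rfl | rfl <;> rcases hj with rfl | rfl | rfl <;>
    rcases hk with rfl | rfl <;> first
    | assumption
    | exact s0 _ _
    | (rw [T.Γ_skew, neg_eq_zero]; assumption)
    | exact absurd hij (by decide)

end TypeDData
end Optical

/-! ### Symmetries, tensoriality and tracelessness of the Weyl tensor. -/

namespace Optical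

variable {M : Type*} [TopologicalSpace M] [ChartedSpace E5 M] [IsManifold (𝓡 5) ∞ M]
variable {U : Set M} {X Y Z V W X' Y' : RField M} {f h : M → ℝ} {x : M}
variable {g : LorentzMetric M}

namespace OrthoFrame
variable (Fr : OrthoFrame g)
include Fr

section
variable (hU : IsOpen U) (hx : x ∈ U) (hX : SmoothOn X U) (hY : SmoothOn Y U)
  (hZ : SmoothOn Z U) (hW : SmoothOn W U)
include hU hx

theorem rho_symm (hX : SmoothOn X U) (hY : SmoothOn Y U) : g.rho X Y x = g.rho Y X x := by
  rw [Fr.rho_eq hU hx hX hY, Fr.rho_eq hU hx hY hX, Fr.rhoT_symm]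

theorem rho_expand1 (hX : SmoothOn X U) (hY : SmoothOn Y U) :
    g.rho X Y x = ∑ a, Fr.co a (X x) * g.rho (Fr.E a) Y x := by
  rw [Fr.rho_eq hU hx hX hY]
  conv_lhs => rw [← Fr.sum_co (X x)]
  simp only [map_sum, map_smul, LinearMap.sum_apply, LinearMap.smul_apply, smul_eq_mul]
  exact Finset.sum_congr rfl fun a _ => by rw [Fr.rho_eq hU hx (Fr.smoothOn a U) hY]

omit hU hx in
theorem inner_expand1 : g.inner X Y x = ∑ a, Fr.co a (X x) * g.inner (Fr.E a) Y x := by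
  simp only [LorentzMetric.inner]
  conv_lhs => rw [← Fr.sum_co (X x)]
  simp only [map_sum, map_smul, sum_apply, smul_apply, smul_eq_mul]

include hX hY hZ hW

theorem weyl_expand1 :
    g.weyl X Y Z W x = ∑ a, Fr.co a (X x) * g.weyl (Fr.E a) Y Z W x := by
  simp only [LorentzMetric.weyl]
  rw [Fr.riem_expand1 hU hx hX hY hZ, Fr.inner_expand1 (X := X) (Y := Z),
    Fr.inner_expand1 (X := X) (Y := W), Fr.rho_expand1 hU hx hX hW, Fr.rho_expand1 hU hx hX hZ]
  simp only [Finset.mul_sum, Finset.sum_mul, ← Finset.sum_sub_distrib, ← Finset.sum_add_distrib]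
  exact Finset.sum_congr rfl fun a _ => by ring

theorem weyl_skew_left : g.weyl X Y Z W x = -g.weyl Y X Z W x := by
  simp only [LorentzMetric.weyl]
  rw [Fr.riem_skew_left hU hx hX hY hZ hW]
  ring

theorem weyl_skew_right : g.weyl X Y Z W x = -g.weyl X Y W Z x := by
  simp only [LorentzMetric.weyl]
  rw [Fr.riem_skew_right hU hx hX hY hZ hW]
  ring

theorem weyl_pair : g.weyl X Y Z W x = g.weyl Z W X Y x := by
  simp only [LorentzMetric.weyl]
  rw [Fr.riem_pair hU hx hX hY hZ hW, Fr.rho_symm hU hx hY hW, Fr.rho_symm hU hx hX hW,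
    Fr.rho_symm hU hx hY hZ, Fr.rho_symm hU hx hX hZ, g.inner_symm X Z, g.inner_symm Y Z,
    g.inner_symm X W, g.inner_symm Y W]
  ring

theorem weyl_cyclic : g.weyl X Y Z W x + g.weyl Y Z X W x + g.weyl Z X Y W x = 0 := by
  have := Fr.riem_cyclic hU hx hX hY hZ hW
  simp only [LorentzMetric.weyl]
  rw [Fr.rho_symm hU hx hY hX, Fr.rho_symm hU hx hZ hX, Fr.rho_symm hU hx hZ hY,
    g.inner_symm Y X, g.inner_symm Z X, g.inner_symm Z Y]
  linear_combination this

theorem weyl_expand2 :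
    g.weyl X Y Z W x = ∑ a, Fr.co a (Y x) * g.weyl X (Fr.E a) Z W x := by
  rw [Fr.weyl_skew_left hU hx hX hY hZ hW, Fr.weyl_expand1 hU hx hY hX hZ hW,
    ← Finset.sum_neg_distrib]
  refine Finset.sum_congr rfl fun a _ => ?_
  rw [Fr.weyl_skew_left hU hx hX (Fr.smoothOn a U) hZ hW, mul_neg]

theorem weyl_expand3 :
    g.weyl X Y Z W x = ∑ a, Fr.co a (Z x) * g.weyl X Y (Fr.E a) W x := by
  rw [Fr.weyl_pair hU hx hX hY hZ hW, Fr.weyl_expand1 hU hx hZ hW hX hY]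
  refine Finset.sum_congr rfl fun a _ => ?_
  rw [Fr.weyl_pair hU hx hX hY (Fr.smoothOn a U) hW]

theorem weyl_expand4 :
    g.weyl X Y Z W x = ∑ a, Fr.co a (W x) * g.weyl X Y Z (Fr.E a) x := by
  rw [Fr.weyl_skew_right hU hx hX hY hZ hW, Fr.weyl_expand3 hU hx hX hY hW hZ,
    ← Finset.sum_neg_distrib]
  refine Finset.sum_congr rfl fun a _ => ?_
  rw [Fr.weyl_skew_right hU hx hX hY hZ (Fr.smoothOn a U), mul_neg]

omit hx in
theorem smooth_weyl : SmoothFnOn (g.weyl X Y Z W) U :=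
  (((((Fr.smooth_riem hU hX hY hZ hW).add
    ((g.smooth_inner hX hZ).mul (Fr.smooth_rho hU hY hW))).sub
    ((g.smooth_inner hY hZ).mul (Fr.smooth_rho hU hX hW))).sub
    ((g.smooth_inner hX hW).mul (Fr.smooth_rho hU hY hZ))).add
    ((g.smooth_inner hY hW).mul (Fr.smooth_rho hU hX hZ)))

end

/-- The Rho tensor has trace S/8, so in dimension five Ric = 3 P + (tr P) g, and this is exactly
what the metric terms of the Weyl tensor subtract from the Ricci trace. -/
theorem weyl_trace (x : M) (b c : Fin 5) :
    ∑ a, g.weyl (Fr.E a) (Fr.E b) (Fr.E c) (Fr.E a) x / Fr.η a = 0 := by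
  have hE := fun a => Fr.smoothOn a (Set.univ : Set M)
  have hU := isOpen_univ (X := M)
  have hx := Set.mem_univ x
  have h1 : ∑ a, g.riem (Fr.E a) (Fr.E b) (Fr.E c) (Fr.E a) x / Fr.η a
      = g.ric (Fr.E b) (Fr.E c) x := by
    rw [Fr.ric_eq hU hx (hE b) (hE c), ricT_apply]
    simp only [riemT_E]
  have h2 : g.scal x = ∑ a, g.ric (Fr.E a) (Fr.E a) x / Fr.η a := by
    rw [Fr.scal_eq]
    exact Finset.sum_congr rfl fun a _ => by rw [Fr.ric_eq hU hx (hE a) (hE a)]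
  have h3 : ∑ a, g.rho (Fr.E a) (Fr.E a) x / Fr.η a = g.scal x / 8 := by
    have : ∀ a, g.rho (Fr.E a) (Fr.E a) x / Fr.η a =
        (g.ric (Fr.E a) (Fr.E a) x / Fr.η a - g.scal x / 8) / 3 := by
      intro a
      have := Fr.η_ne a
      rw [LorentzMetric.rho, Fr.orth, if_pos rfl]
      field_simp
    simp only [this]
    rw [← Finset.sum_div, Finset.sum_sub_distrib, ← h2]
    simp
    ring
  have h4 : g.rho (Fr.E b) (Fr.E c) x =
      (g.ric (Fr.E b) (Fr.E c) x - g.scal x / 8 * g.inner (Fr.E b) (Fr.E c) x) / 3 := rfl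
  have h5 : ∀ a, g.weyl (Fr.E a) (Fr.E b) (Fr.E c) (Fr.E a) x / Fr.η a =
      g.riem (Fr.E a) (Fr.E b) (Fr.E c) (Fr.E a) x / Fr.η a
      + (if a = c then g.rho (Fr.E b) (Fr.E a) x else 0)
      - g.inner (Fr.E b) (Fr.E c) x * (g.rho (Fr.E a) (Fr.E a) x / Fr.η a)
      - g.rho (Fr.E b) (Fr.E c) x
      + (if b = a then g.rho (Fr.E a) (Fr.E c) x else 0) := by
    intro a
    have h := Fr.η_ne a
    simp only [LorentzMetric.weyl]
    rw [Fr.orth a c, Fr.orth a a, Fr.orth b a, if_pos rfl]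
    by_cases h1 : a = c
    · by_cases h2 : b = a
      · subst h1 h2; simp only [if_true]; field_simp
      · subst h1; simp only [if_true, if_neg h2]; field_simp; ring
    · by_cases h2 : b = a
      · subst h2; simp only [if_true, if_neg h1]; field_simp; ring
      · simp only [if_neg h1, if_neg h2]; field_simp; ring
  simp only [h5, Finset.sum_add_distrib, Finset.sum_sub_distrib, ← Finset.mul_sum, h1, h3]
  simp
  rw [h4]
  ring

end OrthoFrame
end Optical

/-! ### Complex multilinear extensions of the frame components. -/

namespace Optical

/-- The space of complex components of vectors. -/
abbrev CV : Type := Fin 5 → ℂ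

section Multilinear

variable {N : Type*} [AddCommMonoid N] [Module ℂ N]

/-- The linear map with given values on the standard basis. -/
def lin (t : Fin 5 → N) : CV →ₗ[ℂ] N := Fintype.linearCombination ℂ t

theorem lin_apply (t : Fin 5 → N) (v : CV) : lin t v = ∑ a, v a • t a := rfl

/-- The standard basis vectors. -/
abbrev bas (a : Fin 5) : CV := Pi.single a 1

theorem lin_bas (t : Fin 5 → N) (a : Fin 5) : lin t (bas a) = t a := by
  simp [lin, Fintype.linearCombination_apply_single]

/-- The trilinear extension of real components. -/
def lin3 (t : Fin 5 → Fin 5 → Fin 5 → ℝ) : CV →ₗ[ℂ] CV →ₗ[ℂ] CV →ₗ[ℂ] ℂ :=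
  lin fun a => lin fun b => lin fun c => (t a b c : ℂ)

/-- The quadrilinear extension of real components. -/
def lin4 (t : Fin 5 → Fin 5 → Fin 5 → Fin 5 → ℝ) :
    CV →ₗ[ℂ] CV →ₗ[ℂ] CV →ₗ[ℂ] CV →ₗ[ℂ] ℂ :=
  lin fun a => lin fun b => lin fun c => lin fun d => (t a b c d : ℂ)

theorem lin3_bas (t : Fin 5 → Fin 5 → Fin 5 → ℝ) (a b c : Fin 5) :
    lin3 t (bas a) (bas b) (bas c) = t a b c := by
  simp only [lin3, lin_bas]

theorem lin4_bas (t : Fin 5 → Fin 5 → Fin 5 → Fin 5 → ℝ) (a b c d : Fin 5) :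
    lin4 t (bas a) (bas b) (bas c) (bas d) = t a b c d := by
  simp only [lin4, lin_bas]

theorem lin4_apply (t : Fin 5 → Fin 5 → Fin 5 → Fin 5 → ℝ) (v w y z : CV) :
    lin4 t v w y z = ∑ p : Fin 5 × Fin 5 × Fin 5 × Fin 5,
      (v p.1 * w p.2.1 * y p.2.2.1 * z p.2.2.2) * (t p.1 p.2.1 p.2.2.1 p.2.2.2 : ℂ) := by
  simp only [lin4, lin_apply, LinearMap.sum_apply, LinearMap.smul_apply, smul_eq_mul,
    Fintype.sum_prod_type, Finset.mul_sum]
  refine Finset.sum_congr rfl fun a _ => Finset.sum_congr rfl fun b _ =>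
    Finset.sum_congr rfl fun c _ => Finset.sum_congr rfl fun d _ => ?_
  ring

/-- This and its multilinear versions transfer real identities to complex vectors: on the standard
basis the components are those of real frame fields, where the identities are already known. -/
theorem eq_zero_of_bas {F : CV → ℂ} (hF : IsLinearMap ℂ F) (h : ∀ a, F (bas a) = 0) (v : CV) :
    F v = 0 := by
  have : hF.mk' F = 0 := by
    refine (Pi.basisFun ℂ (Fin 5)).ext fun a => ?_
    simpa using h a
  exact congrArg (fun L : CV →ₗ[ℂ] ℂ => L v) this

theorem eq_zero_of_bas2 {F : CV → CV → ℂ} (h1 : ∀ w, IsLinearMap ℂ fun v => F v w)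
    (h2 : ∀ v, IsLinearMap ℂ fun w => F v w) (h : ∀ a b, F (bas a) (bas b) = 0) (v w : CV) :
    F v w = 0 :=
  eq_zero_of_bas (h1 w) (fun a => eq_zero_of_bas (h2 _) (h a) w) v

theorem eq_zero_of_bas3 {F : CV → CV → CV → ℂ} (h1 : ∀ w y, IsLinearMap ℂ fun v => F v w y)
    (h2 : ∀ v y, IsLinearMap ℂ fun w => F v w y) (h3 : ∀ v w, IsLinearMap ℂ fun y => F v w y)
    (h : ∀ a b c, F (bas a) (bas b) (bas c) = 0) (v w y : CV) :
    F v w y = 0 :=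
  eq_zero_of_bas (h1 w y) (fun a => eq_zero_of_bas2 (h2 _) (h3 _) (h a) w y) v

theorem eq_zero_of_bas4 {F : CV → CV → CV → CV → ℂ}
    (h1 : ∀ w y z, IsLinearMap ℂ fun v => F v w y z)
    (h2 : ∀ v y z, IsLinearMap ℂ fun w => F v w y z)
    (h3 : ∀ v w z, IsLinearMap ℂ fun y => F v w y z)
    (h4 : ∀ v w y, IsLinearMap ℂ fun z => F v w y z)
    (h : ∀ a b c d, F (bas a) (bas b) (bas c) (bas d) = 0) (v w y z : CV) :
    F v w y z = 0 :=
  eq_zero_of_bas (h1 w y z) (fun a => eq_zero_of_bas3 (h2 _) (h3 _) (h4 _) (h a) w y z) v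

theorem eq_zero_of_bas5 {F : CV → CV → CV → CV → CV → ℂ}
    (h1 : ∀ w y z u, IsLinearMap ℂ fun v => F v w y z u)
    (h2 : ∀ v y z u, IsLinearMap ℂ fun w => F v w y z u)
    (h3 : ∀ v w z u, IsLinearMap ℂ fun y => F v w y z u)
    (h4 : ∀ v w y u, IsLinearMap ℂ fun z => F v w y z u)
    (h5 : ∀ v w y z, IsLinearMap ℂ fun u => F v w y z u)
    (h : ∀ a b c d e, F (bas a) (bas b) (bas c) (bas d) (bas e) = 0) (v w y z u : CV) :
    F v w y z u = 0 :=
  eq_zero_of_bas (h1 w y z u) (fun a => eq_zero_of_bas4 (h2 _) (h3 _) (h4 _) (h5 _) (h a) w y z u) v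

end Multilinear

variable {M : Type*} [TopologicalSpace M] [ChartedSpace E5 M] [IsManifold (𝓡 5) ∞ M]
variable {x : M} {g : LorentzMetric M}

/-- A complex linear relation with constant coefficients between real functions may be
differentiated. -/
theorem D_complex_relation {ι : Type*} [Fintype ι] (c : ι → ℂ) (F : ι → M → ℝ) (X : RField M)
    {U : Set M} (hU : IsOpen U) (hF : ∀ i, SmoothFnOn (F i) U)
    (h : ∀ y ∈ U, ∑ i, c i * (F i y : ℂ) = 0) {x : M} (hx : x ∈ U) :
    ∑ i, c i * (D X (F i) x : ℂ) = 0 := by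
  have key : ∀ r : ι → ℝ, (∀ y ∈ U, ∑ i, r i * F i y = 0) →
      ∑ i, r i * D X (F i) x = 0 := by
    intro r hr
    have hs : ∀ i, SmoothFnOn (fun y => r i * F i y) U := fun i =>
      contMDiffOn_const.mul (hF i)
    have h1 := D_sum (X := X) hU (s := Finset.univ) (fun i _ => hs i) hx
    have h2 : D X (∑ i, fun y => r i * F i y) x = 0 := by
      rw [← D_const (X := X) (x := x) 0]
      exact D_congr hU hx fun y hy => by simpa using hr y hy
    rw [h2] at h1
    rw [h1]
    exact Finset.sum_congr rfl fun i _ => (D_const_mul hU (r i) (hF i) hx).symm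
  refine Complex.ext ?_ ?_
  · have := key (fun i => (c i).re) fun y hy => by simpa using congrArg Complex.re (h y hy)
    simpa using this
  · have := key (fun i => (c i).im) fun y hy => by simpa using congrArg Complex.im (h y hy)
    simpa using this

namespace OrthoFrame
variable (Fr : OrthoFrame g)

/-- The connection components. -/
def gam (x : M) (a b c : Fin 5) : ℝ := g.inner (g.nabla (Fr.E a) (Fr.E b)) (Fr.E c) x

/-- The components of the Weyl tensor. -/
def weylComp (x : M) (a b c d : Fin 5) : ℝ := g.weyl (Fr.E a) (Fr.E b) (Fr.E c) (Fr.E d) x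

/-- The complex extension of the connection components. -/
def gamV (x : M) : CV →ₗ[ℂ] CV →ₗ[ℂ] CV →ₗ[ℂ] ℂ := lin3 (Fr.gam x)

/-- The complex bilinear extension of the connection. -/
def nabV (x : M) : CV →ₗ[ℂ] CV →ₗ[ℂ] CV :=
  lin fun a => lin fun b => (fun f => ((Fr.gam x a b f / Fr.η f : ℝ) : ℂ))

/-- The complex extension of the Weyl tensor. -/
def weylV (x : M) : CV →ₗ[ℂ] CV →ₗ[ℂ] CV →ₗ[ℂ] CV →ₗ[ℂ] ℂ := lin4 (Fr.weylComp x)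

/-- The complex extension of the derivatives of the components of the Weyl tensor. -/
def dweylV (x : M) : CV →ₗ[ℂ] CV →ₗ[ℂ] CV →ₗ[ℂ] CV →ₗ[ℂ] CV →ₗ[ℂ] ℂ :=
  lin fun n => lin4 fun a b c d => D (Fr.E n) (g.weyl (Fr.E a) (Fr.E b) (Fr.E c) (Fr.E d)) x

/-- The complex extension of the Cotton-York tensor. -/
def cottonV (x : M) : CV →ₗ[ℂ] CV →ₗ[ℂ] CV →ₗ[ℂ] ℂ :=
  lin3 fun a b c => g.cotton (Fr.E a) (Fr.E b) (Fr.E c) x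

/-- The complex extension of the metric. -/
def metV : CV →ₗ[ℂ] CV →ₗ[ℂ] ℂ :=
  lin fun a => lin fun b => if a = b then (Fr.η a : ℂ) else 0

theorem metV_bas (a b : Fin 5) : Fr.metV (bas a) (bas b) = if a = b then (Fr.η a : ℂ) else 0 := by
  simp only [metV, lin_bas]

theorem metV_bas_left (a : Fin 5) (v : CV) : Fr.metV (bas a) v = Fr.η a * v a := by
  simp [metV, lin_apply, mul_comm]

theorem metV_symm (v w : CV) : Fr.metV v w = Fr.metV w v := by
  rw [← sub_eq_zero]
  refine eq_zero_of_bas2 (F := fun v w => Fr.metV v w - Fr.metV w v)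
    (fun _ => ⟨by intros; simp; ring, by intros; simp; ring⟩)
    (fun _ => ⟨by intros; simp; ring, by intros; simp; ring⟩) (fun a b => ?_) v w
  rw [metV_bas, metV_bas]
  by_cases h : a = b
  · subst h; simp
  · simp [h, Ne.symm h]

theorem metV_nabV (x : M) (v w y : CV) : Fr.metV (Fr.nabV x v w) y = Fr.gamV x v w y := by
  rw [← sub_eq_zero]
  refine eq_zero_of_bas3 (F := fun v w y => Fr.metV (Fr.nabV x v w) y - Fr.gamV x v w y)
    (fun _ _ => ⟨by intros; simp; ring, by intros; simp; ring⟩)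
    (fun _ _ => ⟨by intros; simp; ring, by intros; simp; ring⟩)
    (fun _ _ => ⟨by intros; simp; ring, by intros; simp; ring⟩) (fun a b c => ?_) v w y
  rw [metV_symm, metV_bas_left]
  simp only [nabV, gamV, lin_bas, lin3_bas]
  have := Fr.η_ne c
  rw [sub_eq_zero]
  norm_cast
  field_simp

theorem gamV_skew (x : M) (v w y : CV) : Fr.gamV x v w y = -Fr.gamV x v y w := by
  rw [← sub_eq_zero]
  refine eq_zero_of_bas3 (F := fun v w y => Fr.gamV x v w y - -Fr.gamV x v y w)
    (fun _ _ => ⟨by intros; simp; ring, by intros; simp; ring⟩)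
    (fun _ _ => ⟨by intros; simp; ring, by intros; simp; ring⟩)
    (fun _ _ => ⟨by intros; simp; ring, by intros; simp; ring⟩) (fun a b c => ?_) v w y
  simp only [gamV, lin3_bas]
  have h1 := Fr.D_inner isOpen_univ (Set.mem_univ x) (Fr.smooth a) (Fr.smooth b) (Fr.smooth c)
  have h2 : D (Fr.E a) (g.inner (Fr.E b) (Fr.E c)) x = 0 := by
    rw [show g.inner (Fr.E b) (Fr.E c) = fun _ => if b = c then Fr.η b else 0 from
      funext (Fr.orth b c)]
    exact D_const _
  rw [h2, g.symm x (Fr.E b x)] at h1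
  have h3 : Fr.gam x a b c = -Fr.gam x a c b := by
    simp only [gam, LorentzMetric.inner]; linarith
  rw [h3]; push_cast; ring

theorem weylV_nabV (x : M) (a b : Fin 5) :
    Fr.nabV x (bas a) (bas b) = ∑ f, (Fr.co f (g.nabla (Fr.E a) (Fr.E b) x) : ℂ) • bas f := by
  simp only [nabV, lin_bas]
  funext f
  simp only [Finset.sum_apply, Pi.smul_apply, Pi.single_apply, smul_eq_mul, mul_ite, mul_one,
    mul_zero, Finset.sum_ite_eq, Finset.mem_univ, if_true]
  rfl

theorem weylV_bianchi (x : M) (v w y p q : CV) :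
    let N := fun v w y p q => Fr.dweylV x v w y p q - Fr.weylV x (Fr.nabV x v w) y p q
      - Fr.weylV x w (Fr.nabV x v y) p q - Fr.weylV x w y (Fr.nabV x v p) q
      - Fr.weylV x w y p (Fr.nabV x v q)
    N v w y p q + N w y v p q + N y v w p q =
      Fr.metV v p * Fr.cottonV x q y w - Fr.metV v q * Fr.cottonV x p y w
      + (Fr.metV w p * Fr.cottonV x q v y - Fr.metV w q * Fr.cottonV x p v y)
      + (Fr.metV y p * Fr.cottonV x q w v - Fr.metV y q * Fr.cottonV x p w v) := by
  intro N
  -- On basis vectors `N` is the covariant derivative of the Weyl tensor along frame fields: the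
  -- slot holding a derivative of a frame field is expanded by tensoriality.
  have hN : ∀ a b c d e, N (bas a) (bas b) (bas c) (bas d) (bas e) =
      (g.nabla4 g.weyl (Fr.E a) (Fr.E b) (Fr.E c) (Fr.E d) (Fr.E e) x : ℝ) := by
    intro a b c d e
    have hE := Fr.smooth
    have hU := isOpen_univ (X := M)
    have hx := Set.mem_univ x
    have hn := fun a b => Fr.smooth_nabla hU (hE a) (hE b)
    simp only [N, weylV_nabV, map_sum, map_smul, LinearMap.sum_apply, LinearMap.smul_apply,
      weylV, dweylV, lin_bas, lin4_bas, smul_eq_mul]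
    rw [LorentzMetric.nabla4, Fr.weyl_expand1 hU hx (hn a b) (hE c) (hE d) (hE e),
      Fr.weyl_expand2 hU hx (hE b) (hn a c) (hE d) (hE e),
      Fr.weyl_expand3 hU hx (hE b) (hE c) (hn a d) (hE e),
      Fr.weyl_expand4 hU hx (hE b) (hE c) (hE d) (hn a e)]
    push_cast
    rfl
  rw [← sub_eq_zero]
  refine eq_zero_of_bas5 (F := fun v w y p q => N v w y p q + N w y v p q + N y v w p q -
    (Fr.metV v p * Fr.cottonV x q y w - Fr.metV v q * Fr.cottonV x p y w
      + (Fr.metV w p * Fr.cottonV x q v y - Fr.metV w q * Fr.cottonV x p v y)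
      + (Fr.metV y p * Fr.cottonV x q w v - Fr.metV y q * Fr.cottonV x p w v)))
    (fun _ _ _ _ => ⟨by intros; simp [N]; ring, by intros; simp [N]; ring⟩)
    (fun _ _ _ _ => ⟨by intros; simp [N]; ring, by intros; simp [N]; ring⟩)
    (fun _ _ _ _ => ⟨by intros; simp [N]; ring, by intros; simp [N]; ring⟩)
    (fun _ _ _ _ => ⟨by intros; simp [N]; ring, by intros; simp [N]; ring⟩)
    (fun _ _ _ _ => ⟨by intros; simp [N]; ring, by intros; simp [N]; ring⟩)
    (fun a b c d e => ?_) v w y p q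
  have hm : ∀ a b, Fr.metV (bas a) (bas b) = (g.inner (Fr.E a) (Fr.E b) x : ℝ) := by
    intro a b
    rw [metV_bas, Fr.orth]; split_ifs <;> simp
  have hc : ∀ a b c, Fr.cottonV x (bas a) (bas b) (bas c)
      = (g.cotton (Fr.E a) (Fr.E b) (Fr.E c) x : ℝ) := fun a b c => by
    simp only [cottonV, lin3_bas]
  simp only [hN, hm, hc]
  have := Fr.nabla4_weyl_cyclic isOpen_univ (Set.mem_univ x) (Fr.smooth a) (Fr.smooth b)
    (Fr.smooth c) (Fr.smooth d) (Fr.smooth e)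
  rw [sub_eq_zero]
  exact_mod_cast this

theorem weylV_skew (x : M) (v w y z : CV) : Fr.weylV x v w y z = -Fr.weylV x w v y z := by
  rw [← sub_eq_zero]
  refine eq_zero_of_bas4 (F := fun v w y z => Fr.weylV x v w y z - -Fr.weylV x w v y z)
    (fun _ _ _ => ⟨by intros; simp; ring, by intros; simp; ring⟩)
    (fun _ _ _ => ⟨by intros; simp; ring, by intros; simp; ring⟩)
    (fun _ _ _ => ⟨by intros; simp; ring, by intros; simp; ring⟩)
    (fun _ _ _ => ⟨by intros; simp; ring, by intros; simp; ring⟩) (fun a b c d => ?_) v w y z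
  simp only [weylV, lin4_bas, weylComp]
  rw [Fr.weyl_skew_left isOpen_univ (Set.mem_univ x) (Fr.smooth a) (Fr.smooth b) (Fr.smooth c)
    (Fr.smooth d)]
  push_cast; ring

theorem weylV_pair (x : M) (v w y z : CV) : Fr.weylV x v w y z = Fr.weylV x y z v w := by
  rw [← sub_eq_zero]
  refine eq_zero_of_bas4 (F := fun v w y z => Fr.weylV x v w y z - Fr.weylV x y z v w)
    (fun _ _ _ => ⟨by intros; simp; ring, by intros; simp; ring⟩)
    (fun _ _ _ => ⟨by intros; simp; ring, by intros; simp; ring⟩)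
    (fun _ _ _ => ⟨by intros; simp; ring, by intros; simp; ring⟩)
    (fun _ _ _ => ⟨by intros; simp; ring, by intros; simp; ring⟩) (fun a b c d => ?_) v w y z
  simp only [weylV, lin4_bas, weylComp]
  rw [Fr.weyl_pair isOpen_univ (Set.mem_univ x) (Fr.smooth a) (Fr.smooth b) (Fr.smooth c)
    (Fr.smooth d)]
  ring

theorem weylV_cyclic (x : M) (v w y z : CV) :
    Fr.weylV x v w y z + Fr.weylV x w y v z + Fr.weylV x y v w z = 0 := by
  refine eq_zero_of_bas4
    (F := fun v w y z => Fr.weylV x v w y z + Fr.weylV x w y v z + Fr.weylV x y v w z)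
    (fun _ _ _ => ⟨by intros; simp; ring, by intros; simp; ring⟩)
    (fun _ _ _ => ⟨by intros; simp; ring, by intros; simp; ring⟩)
    (fun _ _ _ => ⟨by intros; simp; ring, by intros; simp; ring⟩)
    (fun _ _ _ => ⟨by intros; simp; ring, by intros; simp; ring⟩) (fun a b c d => ?_) v w y z
  simp only [weylV, lin4_bas, weylComp]
  exact_mod_cast Fr.weyl_cyclic isOpen_univ (Set.mem_univ x) (Fr.smooth a) (Fr.smooth b)
    (Fr.smooth c) (Fr.smooth d)

theorem weylV_trace (x : M) (v w : CV) :
    ∑ a, Fr.weylV x (bas a) v w (bas a) / Fr.η a = 0 := by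
  refine eq_zero_of_bas2 (F := fun v w => ∑ a, Fr.weylV x (bas a) v w (bas a) / Fr.η a)
    (fun _ => ⟨by intros; simp [add_div, Finset.sum_add_distrib],
      by intros; simp [mul_div_assoc, Finset.mul_sum]⟩)
    (fun _ => ⟨by intros; simp [add_div, Finset.sum_add_distrib],
      by intros; simp [mul_div_assoc, Finset.mul_sum]⟩) (fun b c => ?_) v w
  simp only [weylV, lin4_bas, weylComp]
  exact_mod_cast Fr.weyl_trace x b c

/-- The argument vectors do not depend on the point, so vanishing at every point is a relation with
constant coefficients between real functions, and `D_complex_relation` differentiates it. -/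
theorem dweylV_eq_zero {w y p q : CV} (h : ∀ x, Fr.weylV x w y p q = 0) (x : M) (v : CV) :
    Fr.dweylV x v w y p q = 0 := by
  refine eq_zero_of_bas (F := fun v => Fr.dweylV x v w y p q)
    ⟨by intros; simp, by intros; simp⟩ (fun a => ?_) v
  simp only [dweylV, lin_bas, lin4_apply]
  refine D_complex_relation
    (fun r : Fin 5 × Fin 5 × Fin 5 × Fin 5 => w r.1 * y r.2.1 * p r.2.2.1 * q r.2.2.2)
    (fun r => g.weyl (Fr.E r.1) (Fr.E r.2.1) (Fr.E r.2.2.1) (Fr.E r.2.2.2)) _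
    isOpen_univ (fun r => Fr.smooth_weyl isOpen_univ (Fr.smooth _) (Fr.smooth _) (Fr.smooth _) (Fr.smooth _))
    (fun y' _ => ?_) (Set.mem_univ x)
  have := h y'
  rwa [weylV, lin4_apply] at this

end OrthoFrame
end Optical

/-! ### Constant null frames, and comparison with the tensors on complex fields. -/

namespace Optical

variable {M : Type*} [TopologicalSpace M] [ChartedSpace E5 M] [IsManifold (𝓡 5) ∞ M]
variable {U : Set M} {X Y Z W X' Y' : RField M} {h : M → ℝ} {x : M} {g : LorentzMetric M}

namespace OrthoFrame
variable (Fr : OrthoFrame g)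

/-- The constant vectors `f` form a null frame. -/
def IsNull (f : Fin 5 → CV) : Prop := ∀ i j, Fr.metV (f i) (f j) = nullMetric i j

variable {Fr} {f : Fin 5 → CV}

theorem star_star (i : Fin 5) : star (star i) = i := by revert i; decide

/-- Under the metric `f (star m)` is dual to `f m`, so pairing with it reads off a coefficient.
Linear independence and the expansion of vectors rest on this. -/
theorem IsNull.metV_sum (hf : Fr.IsNull f) (c : Fin 5 → ℂ) (m : Fin 5) :
    Fr.metV (∑ i, c i • f i) (f (star m)) = c m := by
  simp only [map_sum, map_smul, LinearMap.sum_apply, LinearMap.smul_apply, hf _ _, nullMetric,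
    smul_eq_mul]
  rw [Finset.sum_eq_single m]
  · simp
  · intro b _ hb
    have : star m ≠ star b := fun h => hb (by rw [← star_star b, ← h, star_star])
    simp [this]
  · simp

theorem IsNull.linearIndependent (hf : Fr.IsNull f) : LinearIndependent ℂ f := by
  rw [Fintype.linearIndependent_iff]
  intro c hc m
  rw [← hf.metV_sum c m, hc]
  simp

theorem IsNull.expand (hf : Fr.IsNull f) (v : CV) :
    v = ∑ m, Fr.metV v (f (star m)) • f m := by
  have hsp : Submodule.span ℂ (Set.range f) = ⊤ :=
    hf.linearIndependent.span_eq_top_of_card_eq_finrank' (by simp)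
  have hv : v ∈ Submodule.span ℂ (Set.range f) := hsp ▸ Submodule.mem_top
  obtain ⟨c, rfl⟩ := (Submodule.mem_span_range_iff_exists_fun ℂ).1 hv
  simp only [hf.metV_sum]

/-- Both sides are the metric trace of `T`, taken in two pairs of dual bases. -/
theorem IsNull.trace (hf : Fr.IsNull f) (T : CV →ₗ[ℂ] CV →ₗ[ℂ] ℂ) :
    ∑ m, T (f m) (f (star m)) = ∑ a, T (bas a) (bas a) / Fr.η a := by
  have h1 : ∀ m, f (star m) = ∑ a, (Fr.metV (bas a) (f (star m)) / Fr.η a) • bas a := by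
    intro m
    funext a
    have : (Fr.η a : ℂ) ≠ 0 := by exact_mod_cast Fr.η_ne a
    simp only [metV_bas_left, Finset.sum_apply, Pi.smul_apply, Pi.single_apply, smul_eq_mul,
      mul_ite, mul_one, mul_zero, Finset.sum_ite_eq, Finset.mem_univ, if_true]
    field_simp
  have h2 : ∀ a, T (bas a) (bas a) = ∑ m, Fr.metV (bas a) (f (star m)) * T (f m) (bas a) := by
    intro a
    have := congrArg (fun v => T v (bas a)) (hf.expand (bas a))
    simpa only [map_sum, map_smul, LinearMap.sum_apply, LinearMap.smul_apply,
      smul_eq_mul] using this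
  calc _ = ∑ m, ∑ a, (Fr.metV (bas a) (f (star m)) / Fr.η a) * T (f m) (bas a) := by
        refine Finset.sum_congr rfl fun m _ => ?_
        conv_lhs => rw [h1 m]
        simp only [map_sum, map_smul, smul_eq_mul]
    _ = ∑ a, ∑ m, (Fr.metV (bas a) (f (star m)) / Fr.η a) * T (f m) (bas a) := Finset.sum_comm
    _ = _ := by
        refine Finset.sum_congr rfl fun a _ => ?_
        rw [h2, Finset.sum_div]
        exact Finset.sum_congr rfl fun m _ => by ring

/-- The components, in a null frame, of a metric with Weyl tensor of type D. -/
def typeD (hf : Fr.IsNull f)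
    (hwt : ∀ (x : M) (i j k l : Fin 5), wt i + wt j + wt k + wt l ≠ 0 →
      Fr.weylV x (f i) (f j) (f k) (f l) = 0)
    (hA : ∀ (x : M) (r i j : Fin 5), r = 0 ∨ r = 1 → i = 0 ∨ i = 1 ∨ i = 4 →
      j = 0 ∨ j = 1 ∨ j = 4 → Fr.cottonV x (f r) (f i) (f j) = 0) (x : M) : TypeDData where
  Γ i j k := Fr.gamV x (f i) (f j) (f k)
  c i j k l := Fr.weylV x (f i) (f j) (f k) (f l)
  dc n i j k l := Fr.dweylV x (f n) (f i) (f j) (f k) (f l)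
  A i j k := Fr.cottonV x (f i) (f j) (f k)
  Γ_skew _ _ _ := Fr.gamV_skew _ _ _ _
  c_skew _ _ _ _ := Fr.weylV_skew _ _ _ _ _
  c_pair _ _ _ _ := Fr.weylV_pair _ _ _ _ _
  c_cyclic _ _ _ _ := Fr.weylV_cyclic _ _ _ _ _
  c_trace i j := by
    let T : CV →ₗ[ℂ] CV →ₗ[ℂ] ℂ := LinearMap.mk₂ ℂ (fun v w => Fr.weylV x v (f i) (f j) w)
      (by intros; simp) (by intros; simp) (by intros; simp) (by intros; simp)
    exact (hf.trace T).trans (Fr.weylV_trace x _ _)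
  c_wt i j k l h := hwt x i j k l h
  dc_wt n i j k l h := Fr.dweylV_eq_zero (fun x => hwt x i j k l h) x _
  bianchi i j k p q := by
    have h := Fr.weylV_bianchi x (f i) (f j) (f k) (f p) (f q)
    simp only [hf _ _] at h
    rw [← h]
    -- The sums over Γ in `nablaComp` are the expansion of the connection vector `nabV` in the null
    -- frame, evaluated under a linear functional; it is used once for each of the four slots.
    have e : ∀ (a b : Fin 5) (L : CV →ₗ[ℂ] ℂ), ∑ m, Fr.gamV x (f a) (f b) (f (star m)) * L (f m) =
        L (Fr.nabV x (f a) (f b)) := by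
      intro a b L
      conv_rhs => rw [hf.expand (Fr.nabV x (f a) (f b))]
      simp only [map_sum, map_smul, metV_nabV, smul_eq_mul]
    have e1 := fun a b c d e' : Fin 5 => e a b
      (((Fr.weylV x).flip (f c)).flip (f d) |>.flip (f e'))
    have e2 := fun a b c d e' : Fin 5 => e a b
      (((Fr.weylV x (f c)).flip (f d)).flip (f e'))
    have e3 := fun a b c d e' : Fin 5 => e a b ((Fr.weylV x (f c) (f d)).flip (f e'))
    have e4 := fun a b c d e' : Fin 5 => e a b (Fr.weylV x (f c) (f d) (f e'))
    simp only [LinearMap.flip_apply] at e1 e2 e3 e4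
    simp only [nablaComp, e1, e2, e3, e4]
  A_zero r i j hr hi hj := hA x r i j hr hi hj

variable (Fr)
/-- The components of a tangent vector, as complex numbers. -/
def coR (v : TangentSpace (𝓡 5) x) : CV := fun a => (Fr.co a v : ℂ)

/-- The components of a complex vector field. -/
def comp (X : CField M) (x : M) : CV := Fr.coR (X.re x) + Complex.I • Fr.coR (X.im x)

theorem coR_add (v w : TangentSpace (𝓡 5) x) : Fr.coR (v + w) = Fr.coR v + Fr.coR w := by
  funext a; simp [coR, co, add_div]

theorem coR_sub (v w : TangentSpace (𝓡 5) x) : Fr.coR (v - w) = Fr.coR v - Fr.coR w := by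
  funext a; simp [coR, co, sub_div]

theorem coR_zero : Fr.coR (0 : TangentSpace (𝓡 5) x) = 0 := by
  funext a; simp [coR, co]

theorem coR_neg (v : TangentSpace (𝓡 5) x) : Fr.coR (-v) = -Fr.coR v := by
  funext a; simp [coR, co, neg_div]

theorem weyl_eq (hU : IsOpen U) (hx : x ∈ U) (hX : SmoothOn X U) (hY : SmoothOn Y U)
    (hZ : SmoothOn Z U) (hW : SmoothOn W U) : (g.weyl X Y Z W x : ℂ) =
    Fr.weylV x (Fr.coR (X x)) (Fr.coR (Y x)) (Fr.coR (Z x)) (Fr.coR (W x)) := by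
  have hE := fun a => Fr.smoothOn a U
  rw [weylV, lin4, Fr.weyl_expand1 hU hx hX hY hZ hW, lin_apply]
  simp only [Complex.ofReal_sum, Complex.ofReal_mul, LinearMap.sum_apply,
    LinearMap.smul_apply, smul_eq_mul]
  refine Finset.sum_congr rfl fun a _ => congrArg _ ?_
  rw [Fr.weyl_expand2 hU hx (hE a) hY hZ hW, lin_apply]
  simp only [Complex.ofReal_sum, Complex.ofReal_mul, LinearMap.sum_apply,
    LinearMap.smul_apply, smul_eq_mul]
  refine Finset.sum_congr rfl fun b _ => congrArg _ ?_
  rw [Fr.weyl_expand3 hU hx (hE a) (hE b) hZ hW, lin_apply]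
  simp only [Complex.ofReal_sum, Complex.ofReal_mul, LinearMap.sum_apply,
    LinearMap.smul_apply, smul_eq_mul]
  refine Finset.sum_congr rfl fun c _ => congrArg _ ?_
  rw [Fr.weyl_expand4 hU hx (hE a) (hE b) (hE c) hW, lin_apply]
  push_cast
  rfl

theorem weylC_eq {X Y Z W : CField M} (hX : X.SmoothOn Set.univ) (hY : Y.SmoothOn Set.univ)
    (hZ : Z.SmoothOn Set.univ) (hW : W.SmoothOn Set.univ) (x : M) :
    g.weylC X Y Z W x =
      Fr.weylV x (Fr.comp X x) (Fr.comp Y x) (Fr.comp Z x) (Fr.comp W x) := by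
  have h := fun {A B C D : RField M} (hA : SmoothOn A Set.univ) (hB : SmoothOn B Set.univ)
    (hC : SmoothOn C Set.univ) (hD : SmoothOn D Set.univ) =>
      Fr.weyl_eq isOpen_univ (Set.mem_univ x) hA hB hC hD
  obtain ⟨x1, x2⟩ := hX
  obtain ⟨y1, y2⟩ := hY
  obtain ⟨z1, z2⟩ := hZ
  obtain ⟨w1, w2⟩ := hW
  simp only [LorentzMetric.weylC, cext, comp, map_add, map_smul, LinearMap.add_apply,
    LinearMap.smul_apply, smul_eq_mul, h x1 y1 z1 w1, h x1 y1 z1 w2, h x1 y1 z2 w1, h x1 y1 z2 w2,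
    h x1 y2 z1 w1, h x1 y2 z1 w2, h x1 y2 z2 w1, h x1 y2 z2 w2, h x2 y1 z1 w1, h x2 y1 z1 w2,
    h x2 y1 z2 w1, h x2 y1 z2 w2, h x2 y2 z1 w1, h x2 y2 z1 w2, h x2 y2 z2 w1, h x2 y2 z2 w2]
  ring

section cotton
include Fr
variable (hU : IsOpen U) (hx : x ∈ U) (hX : SmoothOn X U) (hX' : SmoothOn X' U)
  (hY : SmoothOn Y U) (hZ : SmoothOn Z U) (hh : SmoothFnOn h U)
include hU hx hX hY

theorem rho_add_left (hX' : SmoothOn X' U) : g.rho (X + X') Y x = g.rho X Y x + g.rho X' Y x := by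
  rw [Fr.rho_eq hU hx (hX.add hX') hY, Fr.rho_eq hU hx hX hY, Fr.rho_eq hU hx hX' hY]
  simp

theorem rho_smul_left (hh : SmoothFnOn h U) : g.rho (h • X) Y x = h x * g.rho X Y x := by
  rw [Fr.rho_eq hU hx (SmoothOn.smul hh hX) hY, Fr.rho_eq hU hx hX hY]
  simp

theorem rho_congr_left (hX' : SmoothOn X' U) (he : X x = X' x) : g.rho X Y x = g.rho X' Y x := by
  rw [Fr.rho_eq hU hx hX hY, Fr.rho_eq hU hx hX' hY, he]

include hZ

theorem nablaRho_symm : g.nablaRho X Y Z x = g.nablaRho X Z Y x := by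
  have h1 : D X (g.rho Y Z) x = D X (g.rho Z Y) x :=
    D_congr hU hx fun y hy => Fr.rho_symm hU hy hY hZ
  change D X (g.rho Y Z) x - _ - _ = D X (g.rho Z Y) x - _ - _
  rw [h1, Fr.rho_symm hU hx (Fr.smooth_nabla hU hX hY) hZ,
    Fr.rho_symm hU hx hY (Fr.smooth_nabla hU hX hZ)]
  ring

theorem nablaRho_expand1 :
    g.nablaRho X Y Z x = ∑ a, Fr.co a (X x) * g.nablaRho (Fr.E a) Y Z x := by
  refine Fr.tensor_expand (U := U) (fun X => g.nablaRho X Y Z x) ?_ ?_ hX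
  · intro A B hA hB
    have n := fun {A C : RField M} (hA : SmoothOn A U) (hC : SmoothOn C U) =>
      Fr.smooth_nabla hU hA hC
    change D (A + B) (g.rho Y Z) x - _ - _ = (D A (g.rho Y Z) x - _ - _) +
      (D B (g.rho Y Z) x - _ - _)
    rw [D_field_add, Fr.rho_symm hU hx hY (n (hA.add hB) hZ),
      Fr.rho_congr_left hU hx (n (hA.add hB) hY) hZ ((n hA hY).add (n hB hY))
        (Fr.nabla_add_left hU hx hA hB hY),
      Fr.rho_congr_left hU hx (n (hA.add hB) hZ) hY ((n hA hZ).add (n hB hZ))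
        (Fr.nabla_add_left hU hx hA hB hZ),
      Fr.rho_add_left hU hx (n hA hY) hZ (n hB hY), Fr.rho_add_left hU hx (n hA hZ) hY (n hB hZ),
      Fr.rho_symm hU hx hY (n hA hZ), Fr.rho_symm hU hx hY (n hB hZ)]
    ring
  · intro h A hh hA
    have n := fun {A C : RField M} (hA : SmoothOn A U) (hC : SmoothOn C U) =>
      Fr.smooth_nabla hU hA hC
    have hA' := SmoothOn.smul hh hA
    change D (h • A) (g.rho Y Z) x - _ - _ = h x * (D A (g.rho Y Z) x - _ - _)
    rw [D_field_smul, Fr.rho_symm hU hx hY (n hA' hZ),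
      Fr.rho_congr_left hU hx (n hA' hY) hZ (SmoothOn.smul hh (n hA hY))
        (Fr.nabla_smul_left hU hx hA hY hh),
      Fr.rho_congr_left hU hx (n hA' hZ) hY (SmoothOn.smul hh (n hA hZ))
        (Fr.nabla_smul_left hU hx hA hZ hh),
      Fr.rho_smul_left hU hx (n hA hY) hZ hh, Fr.rho_smul_left hU hx (n hA hZ) hY hh,
      Fr.rho_symm hU hx hY (n hA hZ)]
    ring

/-- The derivative of the coefficient produced by differentiating the Rho component is cancelled by
the one from the product rule for `nabla`. -/
theorem nablaRho_expand2 :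
    g.nablaRho X Y Z x = ∑ a, Fr.co a (Y x) * g.nablaRho X (Fr.E a) Z x := by
  have n := fun {A C : RField M} (hA : SmoothOn A U) (hC : SmoothOn C U) =>
      Fr.smooth_nabla hU hA hC
  refine Fr.tensor_expand (U := U) (fun Y => g.nablaRho X Y Z x) ?_ ?_ hY
  · intro A B hA hB
    change D X (g.rho (A + B) Z) x - _ - _ = (D X (g.rho A Z) x - _ - _) +
      (D X (g.rho B Z) x - _ - _)
    have h1 : D X (g.rho (A + B) Z) x = D X (g.rho A Z + g.rho B Z) x :=
      D_congr hU hx fun y hy => Fr.rho_add_left hU hy hA hZ hB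
    rw [h1, D_add hU (Fr.smooth_rho hU hA hZ) (Fr.smooth_rho hU hB hZ) hx,
      Fr.rho_congr_left hU hx (n hX (hA.add hB)) hZ ((n hX hA).add (n hX hB))
        (Fr.nabla_add_right hU hx hA hB hX),
      Fr.rho_add_left hU hx (n hX hA) hZ (n hX hB), Fr.rho_add_left hU hx hA (n hX hZ) hB]
    ring
  · intro h A hh hA
    change D X (g.rho (h • A) Z) x - _ - _ = h x * (D X (g.rho A Z) x - _ - _)
    have h1 : D X (g.rho (h • A) Z) x = D X (h * g.rho A Z) x :=
      D_congr hU hx fun y hy => Fr.rho_smul_left hU hy hA hZ hh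
    have hD := Fr.smooth_D hU hX hh
    rw [h1, D_mul hU hh (Fr.smooth_rho hU hA hZ) hx,
      Fr.rho_congr_left hU hx (n hX (SmoothOn.smul hh hA)) hZ
        ((SmoothOn.smul hh (n hX hA)).add (SmoothOn.smul hD hA))
        (Fr.nabla_smul_right hU hx hA hX hh),
      Fr.rho_add_left hU hx (SmoothOn.smul hh (n hX hA)) hZ (SmoothOn.smul hD hA),
      Fr.rho_smul_left hU hx (n hX hA) hZ hh, Fr.rho_smul_left hU hx hA hZ hD,
      Fr.rho_smul_left hU hx hA (n hX hZ) hh]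
    ring

theorem nablaRho_expand3 :
    g.nablaRho X Y Z x = ∑ a, Fr.co a (Z x) * g.nablaRho X Y (Fr.E a) x := by
  rw [Fr.nablaRho_symm hU hx hX hY hZ, Fr.nablaRho_expand2 hU hx hX hZ hY]
  exact Finset.sum_congr rfl fun a _ => by
    rw [Fr.nablaRho_symm hU hx hX hY (Fr.smoothOn a U)]

end cotton

theorem cotton_eq (hU : IsOpen U) (hx : x ∈ U) (hX : SmoothOn X U) (hY : SmoothOn Y U)
    (hZ : SmoothOn Z U) : (g.cotton Z X Y x : ℂ) =
    Fr.cottonV x (Fr.coR (Z x)) (Fr.coR (X x)) (Fr.coR (Y x)) := by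
  have hE := fun a => Fr.smoothOn a U
  have e1 : g.cotton Z X Y x = ∑ c, Fr.co c (Z x) * g.cotton (Fr.E c) X Y x := by
    simp only [LorentzMetric.cotton]
    rw [Fr.nablaRho_expand3 hU hx hX hY hZ, Fr.nablaRho_expand3 hU hx hY hX hZ]
    simp only [mul_sub, Finset.sum_sub_distrib]
  have e2 : ∀ c, g.cotton (Fr.E c) X Y x = ∑ a, Fr.co a (X x) * g.cotton (Fr.E c) (Fr.E a) Y x := by
    intro c
    simp only [LorentzMetric.cotton]
    rw [Fr.nablaRho_expand1 hU hx hX hY (hE c), Fr.nablaRho_expand2 hU hx hY hX (hE c)]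
    simp only [mul_sub, Finset.sum_sub_distrib]
  have e3 : ∀ c a, g.cotton (Fr.E c) (Fr.E a) Y x =
      ∑ b, Fr.co b (Y x) * g.cotton (Fr.E c) (Fr.E a) (Fr.E b) x := by
    intro c a
    simp only [LorentzMetric.cotton]
    rw [Fr.nablaRho_expand2 hU hx (hE a) hY (hE c), Fr.nablaRho_expand1 hU hx hY (hE a) (hE c)]
    simp only [mul_sub, Finset.sum_sub_distrib]
  rw [cottonV, lin3, e1, lin_apply]
  simp only [Complex.ofReal_sum, Complex.ofReal_mul, LinearMap.sum_apply,
    LinearMap.smul_apply, smul_eq_mul]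
  refine Finset.sum_congr rfl fun a _ => congrArg _ ?_
  rw [e2, lin_apply]
  simp only [Complex.ofReal_sum, Complex.ofReal_mul, LinearMap.sum_apply,
    LinearMap.smul_apply, smul_eq_mul]
  refine Finset.sum_congr rfl fun b _ => congrArg _ ?_
  rw [e3, lin_apply]
  push_cast
  rfl

theorem cottonC_eq {X Y Z : CField M} (hX : X.SmoothOn Set.univ) (hY : Y.SmoothOn Set.univ)
    (hZ : Z.SmoothOn Set.univ) (x : M) :
    g.cottonC Z X Y x = Fr.cottonV x (Fr.comp Z x) (Fr.comp X x) (Fr.comp Y x) := by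
  have h := fun {A B C : RField M} (hC : SmoothOn C Set.univ) (hA : SmoothOn A Set.univ)
    (hB : SmoothOn B Set.univ) => Fr.cotton_eq isOpen_univ (Set.mem_univ x) hA hB hC
  obtain ⟨x1, x2⟩ := hX
  obtain ⟨y1, y2⟩ := hY
  obtain ⟨z1, z2⟩ := hZ
  simp only [LorentzMetric.cottonC, cext, comp, map_add, map_smul, LinearMap.add_apply,
    LinearMap.smul_apply, smul_eq_mul, h z1 x1 y1, h z1 x1 y2, h z1 x2 y1, h z1 x2 y2,
    h z2 x1 y1, h z2 x1 y2, h z2 x2 y1, h z2 x2 y2]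
  ring

end OrthoFrame
end Optical

/-! ### Lie brackets of complex fields in frame components. -/

namespace Optical

variable {M : Type*} [TopologicalSpace M] [ChartedSpace E5 M] [IsManifold (𝓡 5) ∞ M]
variable {U : Set M} {X Y Z : RField M} {x : M} {g : LorentzMetric M}

theorem eq_sum_bas (n : CV) : n = ∑ a, n a • bas a := by
  funext b
  simp [Finset.sum_apply, Pi.single_apply]

namespace OrthoFrame
variable (Fr : OrthoFrame g)

theorem metV_eq_sum (v n : CV) : Fr.metV v n = ∑ a, n a * Fr.metV v (bas a) := by
  conv_lhs => rw [eq_sum_bas n]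
  simp only [map_sum, map_smul, smul_eq_mul]

theorem metV_coR (v : TangentSpace (𝓡 5) x) (a : Fin 5) :
    Fr.metV (Fr.coR v) (bas a) = g.val x v (Fr.E a x) := by
  have : (Fr.η a : ℂ) ≠ 0 := by exact_mod_cast Fr.η_ne a
  rw [metV_symm, metV_bas_left, coR, co]
  push_cast
  field_simp

theorem gamV_coR (hU : IsOpen U) (hx : x ∈ U) (hX : SmoothOn X U) (v : TangentSpace (𝓡 5) x)
    (a : Fin 5) : Fr.gamV x (Fr.coR (X x)) (bas a) (Fr.coR v) =
      g.val x v (g.nabla X (Fr.E a) x) := by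
  have h1 : ∀ c, g.val x (g.nabla X (Fr.E a) x) (Fr.E c x) =
      ∑ b, Fr.co b (X x) * Fr.gam x b a c := by
    intro c
    refine Fr.tensor_expand (U := U) (fun X => g.val x (g.nabla X (Fr.E a) x) (Fr.E c x)) ?_ ?_ hX
    · intro A B hA hB
      rw [Fr.nabla_add_left hU hx hA hB (Fr.smoothOn a U)]
      simp
    · intro f A hf hA
      rw [Fr.nabla_smul_left hU hx hA (Fr.smoothOn a U) hf]
      simp
  have h2 : g.val x v (g.nabla X (Fr.E a) x) =
      ∑ b, Fr.co b (X x) * ∑ c, Fr.co c v * Fr.gam x b a c := by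
    rw [g.symm]
    conv_lhs => rw [← Fr.sum_co v]
    simp only [map_sum, map_smul, smul_eq_mul, h1, Finset.mul_sum]
    rw [Finset.sum_comm]
    exact Finset.sum_congr rfl fun b _ => Finset.sum_congr rfl fun c _ => by ring
  rw [h2, gamV, lin3, lin_apply]
  simp only [Complex.ofReal_sum, Complex.ofReal_mul, LinearMap.sum_apply,
    LinearMap.smul_apply, smul_eq_mul, lin_bas]
  simp only [lin_apply, smul_eq_mul]
  rfl

/-- Vanishing torsion writes the bracket as a difference of covariant derivatives, and metric
compatibility moves each derivative onto the frame vector. -/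
theorem brk_inner (hU : IsOpen U) (hx : x ∈ U) (hX : SmoothOn X U) (hY : SmoothOn Y U)
    (a : Fin 5) : Fr.metV (Fr.coR (brk X Y x)) (bas a) =
      D X (g.inner Y (Fr.E a)) x - D Y (g.inner X (Fr.E a)) x
      - Fr.gamV x (Fr.coR (X x)) (bas a) (Fr.coR (Y x))
      + Fr.gamV x (Fr.coR (Y x)) (bas a) (Fr.coR (X x)) := by
  have hE := Fr.smoothOn a U
  rw [metV_coR, Fr.gamV_coR hU hx hX, Fr.gamV_coR hU hx hY, Fr.D_inner hU hx hX hY hE,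
    Fr.D_inner hU hx hY hX hE, ← Fr.torsion hU hx hX hY]
  simp only [map_sub, sub_apply]
  push_cast
  ring

theorem metV_comp (X : CField M) (y : M) (a : Fin 5) : Fr.metV (Fr.comp X y) (bas a) =
    g.inner X.re (Fr.E a) y + Complex.I * g.inner X.im (Fr.E a) y := by
  simp only [comp, map_add, map_smul, LinearMap.add_apply, LinearMap.smul_apply, smul_eq_mul,
    metV_coR, LorentzMetric.inner]

/-- The real and imaginary parts of `Y` give ten real functions, indexed by `Fin 5 ⊕ Fin 5`, that
satisfy one complex relation with constant coefficients. -/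
theorem D_metV (hU : IsOpen U) (hx : x ∈ U) {Y : CField M} (hY : Y.SmoothOn U) {n : CV}
    (h : ∀ y ∈ U, Fr.metV (Fr.comp Y y) n = 0) (Z : RField M) :
    ∑ a, n a * (D Z (g.inner Y.re (Fr.E a)) x + Complex.I * D Z (g.inner Y.im (Fr.E a)) x) = 0 := by
  have := D_complex_relation (ι := Fin 5 ⊕ Fin 5) (Sum.elim n fun a => n a * Complex.I)
    (Sum.elim (fun a => g.inner Y.re (Fr.E a)) fun a => g.inner Y.im (Fr.E a)) Z hU
    (fun i => by
      rcases i with a | a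
      · exact g.smooth_inner hY.1 (Fr.smoothOn a U)
      · exact g.smooth_inner hY.2 (Fr.smoothOn a U))
    (fun y hy => by
      rw [← h y hy, metV_eq_sum]
      simp only [metV_comp, Fintype.sum_sum_type, Sum.elim_inl, Sum.elim_inr, mul_add,
        Finset.sum_add_distrib, mul_assoc]) hx
  rw [← this]
  simp only [Fintype.sum_sum_type, Sum.elim_inl, Sum.elim_inr, mul_add,
    Finset.sum_add_distrib, mul_assoc]

/-- The components of the Lie bracket of two fields orthogonal to a constant vector. -/
theorem metV_bracket (hU : IsOpen U) (hx : x ∈ U) {X Y : CField M} (hX : X.SmoothOn U)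
    (hY : Y.SmoothOn U) {n : CV} (hXn : ∀ y ∈ U, Fr.metV (Fr.comp X y) n = 0)
    (hYn : ∀ y ∈ U, Fr.metV (Fr.comp Y y) n = 0) :
    Fr.metV (Fr.comp (X.bracket Y) x) n =
      Fr.gamV x (Fr.comp Y x) n (Fr.comp X x) - Fr.gamV x (Fr.comp X x) n (Fr.comp Y x) := by
  have e1 := Fr.D_metV hU hx hY hYn X.re
  have e2 := Fr.D_metV hU hx hY hYn X.im
  have e3 := Fr.D_metV hU hx hX hXn Y.re
  have e4 := Fr.D_metV hU hx hX hXn Y.im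
  have hg : ∀ v w, Fr.gamV x v n w = ∑ a, n a * Fr.gamV x v (bas a) w := by
    intro v w
    conv_lhs => rw [eq_sum_bas n]
    simp only [map_sum, map_smul, smul_eq_mul, LinearMap.sum_apply, LinearMap.smul_apply]
  have hb : ∀ a, Fr.metV (Fr.comp (X.bracket Y) x) (bas a) =
      ((D X.re (g.inner Y.re (Fr.E a)) x + Complex.I * D X.re (g.inner Y.im (Fr.E a)) x)
      + Complex.I * (D X.im (g.inner Y.re (Fr.E a)) x + Complex.I * D X.im (g.inner Y.im (Fr.E a)) x)
      - (D Y.re (g.inner X.re (Fr.E a)) x + Complex.I * D Y.re (g.inner X.im (Fr.E a)) x)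
      - Complex.I * (D Y.im (g.inner X.re (Fr.E a)) x
        + Complex.I * D Y.im (g.inner X.im (Fr.E a)) x))
      + (Fr.gamV x (Fr.comp Y x) (bas a) (Fr.comp X x)
        - Fr.gamV x (Fr.comp X x) (bas a) (Fr.comp Y x)) := by
    intro a
    have b1 := Fr.brk_inner hU hx hX.1 hY.1 a
    have b2 := Fr.brk_inner hU hx hX.2 hY.2 a
    have b3 := Fr.brk_inner hU hx hX.1 hY.2 a
    have b4 := Fr.brk_inner hU hx hX.2 hY.1 a
    simp only [comp, CField.bracket, Pi.sub_apply, Pi.add_apply, coR_sub, coR_add, map_add,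
      map_sub, map_smul, LinearMap.add_apply, LinearMap.sub_apply, LinearMap.smul_apply,
      smul_eq_mul, b1, b2, b3, b4]
    -- The terms pairing imaginary part with imaginary part carry -1 on one side and `I * I` on the
    -- other.
    linear_combination (D X.im (g.inner Y.im (Fr.E a)) x - D Y.im (g.inner X.im (Fr.E a)) x
      - Fr.gamV x (Fr.coR (X.im x)) (bas a) (Fr.coR (Y.im x))
      + Fr.gamV x (Fr.coR (Y.im x)) (bas a) (Fr.coR (X.im x)) : ℂ) *
      (-Complex.I_mul_I)
  rw [metV_eq_sum, hg, hg]
  simp only [hb, mul_add, mul_sub, Finset.sum_add_distrib, Finset.sum_sub_distrib] at e1 e2 e3 e4 ⊢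
  -- Pulling `I` out of the sums exposes the combinations that `e1`, ..., `e4` make zero; only the
  -- connection terms survive.
  simp only [mul_left_comm _ Complex.I, ← Finset.mul_sum] at e1 e2 e3 e4 ⊢
  linear_combination e1 + Complex.I * e2 - e3 - Complex.I * e4

end OrthoFrame
end Optical

/-! ### The distribution of a null frame: almost optical structure and integrability criteria. -/

namespace Optical

variable {M : Type*} [TopologicalSpace M] [ChartedSpace E5 M] [IsManifold (𝓡 5) ∞ M]
variable {U : Set M} {x : M} {g : LorentzMetric M}

/-- Complex conjugation of components. -/
def conjV (v : CV) : CV := fun a => starRingEnd ℂ (v a)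

theorem conjV_conjV (v : CV) : conjV (conjV v) = v := by
  funext a; simp [conjV]

namespace OrthoFrame
variable (Fr : OrthoFrame g)

/-- The components of a complex tangent vector. -/
def coC (x : M) : ℂ ⊗[ℝ] TangentSpace (𝓡 5) x ≃ₗ[ℂ] CV := ((Fr.basis x).baseChange ℂ).equivFun

theorem basis_repr (v : TangentSpace (𝓡 5) x) (a : Fin 5) : (Fr.basis x).repr v a = Fr.co a v := by
  have h : (Fr.basis x).equivFun v = fun a => Fr.co a v := by
    rw [← LinearEquiv.eq_symm_apply, Module.Basis.equivFun_symm_apply]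
    simp only [basis_apply, sum_co]
  exact congrFun h a

theorem coC_tmul (z : ℂ) (v : TangentSpace (𝓡 5) x) : Fr.coC x (z ⊗ₜ v) = z • Fr.coR v := by
  funext a
  simp only [coC, Module.Basis.equivFun_apply, Module.Basis.baseChange_repr_tmul, basis_repr]
  simp [coR, mul_comm]

theorem coC_val (X : CField M) (x : M) : Fr.coC x (X.val x) = Fr.comp X x := by
  rw [CField.val, map_add, coC_tmul, coC_tmul, comp, one_smul]

theorem metV_coR_coR (v w : TangentSpace (𝓡 5) x) :
    Fr.metV (Fr.coR v) (Fr.coR w) = g.val x v w := by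
  rw [metV_eq_sum]
  simp only [metV_coR]
  conv_rhs => rw [← Fr.sum_co w]
  simp [coR]

theorem formC_eq (v w : ℂ ⊗[ℝ] TangentSpace (𝓡 5) x) :
    g.formC x v w = Fr.metV (Fr.coC x v) (Fr.coC x w) := by
  induction v using TensorProduct.induction_on with
  | zero => simp
  | add v v' h h' => simp only [map_add, LinearMap.add_apply, h, h']
  | tmul a v =>
    induction w using TensorProduct.induction_on with
    | zero => simp
    | add w w' h h' => simp only [map_add, h, h']
    | tmul b w =>
      rw [LorentzMetric.formC, LinearMap.BilinForm.baseChange_tmul, coC_tmul, coC_tmul, map_smul,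
        map_smul, LinearMap.smul_apply, metV_coR_coR]
      simp [LorentzMetric.form]
      ring

theorem coC_conjT (v : ℂ ⊗[ℝ] TangentSpace (𝓡 5) x) :
    Fr.coC x (conjT x v) = conjV (Fr.coC x v) := by
  induction v using TensorProduct.induction_on with
  | zero => funext a; simp [conjV]
  | add v v' h h' =>
    rw [map_add, map_add, h, h', map_add]
    funext a; simp [conjV]
  | tmul a v =>
    rw [conjT, LinearMap.rTensor_tmul, coC_tmul, coC_tmul]
    funext b; simp [conjV, coR]

theorem metV_conjV (v w : CV) : Fr.metV (conjV v) (conjV w) = starRingEnd ℂ (Fr.metV v w) := by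
  rw [metV_eq_sum, Fr.metV_eq_sum v w, map_sum]
  refine Finset.sum_congr rfl fun a _ => ?_
  rw [metV_symm, metV_bas_left, Fr.metV_symm v, metV_bas_left]
  simp [conjV]

variable {Fr} {f : Fin 5 → CV}

/-- Membership in the span of the first two vectors of a null frame. -/
theorem IsNull.mem_span (hf : Fr.IsNull f) (v : CV) : v ∈ Submodule.span ℂ {f 0, f 1} ↔
    Fr.metV v (f 0) = 0 ∧ Fr.metV v (f 1) = 0 ∧ Fr.metV v (f 4) = 0 := by
  constructor
  · intro h
    obtain ⟨a, b, rfl⟩ := Submodule.mem_span_pair.1 h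
    simp only [map_add, map_smul, LinearMap.add_apply, LinearMap.smul_apply, hf _ _]
    simp [nullMetric, star]
  · rintro ⟨h0, h1, h4⟩
    rw [hf.expand v]
    simp only [Fin.sum_univ_five, star, Matrix.cons_val, h0, h1, h4, zero_smul, add_zero]
    exact Submodule.mem_span_pair.2 ⟨_, _, rfl⟩

variable {N : CDist M} {k : RField M} {n : CField M}

section
variable (hf : Fr.IsNull f) (hk : ∀ x, Fr.comp (CField.ofReal k) x = f 0)
  (hn : ∀ x, Fr.comp n x = f 1)
  (hN : ∀ x, N x = Submodule.span ℂ {(CField.ofReal k).val x, n.val x})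
include hf hk hn hN

theorem IsNull.mem_N (v : ℂ ⊗[ℝ] TangentSpace (𝓡 5) x) : v ∈ N x ↔
    Fr.metV (Fr.coC x v) (f 0) = 0 ∧ Fr.metV (Fr.coC x v) (f 1) = 0 ∧
      Fr.metV (Fr.coC x v) (f 4) = 0 := by
  rw [← hf.mem_span, hN, ← hk x, ← hn x, ← coC_val, ← coC_val, ← Set.image_pair]
  exact (Submodule.apply_mem_span_image_iff_mem_span (f := (Fr.coC x).toLinearMap)
    (Fr.coC x).injective).symm

theorem IsNull.mem_perp (v : ℂ ⊗[ℝ] TangentSpace (𝓡 5) x) : v ∈ g.perp N x ↔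
    Fr.metV (Fr.coC x v) (f 0) = 0 ∧ Fr.metV (Fr.coC x v) (f 1) = 0 := by
  have h : v ∈ g.perp N x ↔ ∀ w ∈ N x, g.formC x w v = 0 := Iff.rfl
  rw [h, Fr.metV_symm _ (f 0), Fr.metV_symm _ (f 1), ← hk x, ← hn x, ← coC_val, ← coC_val,
    ← formC_eq, ← formC_eq, hN]
  constructor
  · intro h
    exact ⟨h _ (Submodule.subset_span (by simp)), h _ (Submodule.subset_span (by simp))⟩
  · rintro ⟨h0, h1⟩ w hw
    obtain ⟨a, b, rfl⟩ := Submodule.mem_span_pair.1 hw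
    simp [h0, h1]

/-- The span of the first two vectors of a null frame is an almost optical structure. -/
theorem IsNull.isAlmostOpticalStructure (hks : SmoothOn k Set.univ) (hns : n.SmoothOn Set.univ)
    (hc0 : conjV (f 0) = f 0) (hc1 : conjV (f 3) = f 1) (hc4 : conjV (f 4) = f 4) :
    IsAlmostOpticalStructure g N fun x => Submodule.span ℝ {k x} := by
  have hli : LinearIndependent ℂ f := hf.linearIndependent
  refine ⟨⟨fun x => ⟨Set.univ, isOpen_univ, Set.mem_univ x, ![CField.ofReal k, n], ?_, ?_⟩, ?_⟩,
    fun x => ⟨Set.univ, isOpen_univ, Set.mem_univ x, fun _ => k, fun _ => hks, ?_⟩, ?_⟩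
  · intro i
    fin_cases i
    · exact ⟨hks, smoothOn_zero⟩
    · exact hns
  · intro y _
    constructor
    · refine LinearIndependent.of_comp (Fr.coC y).toLinearMap ?_
      convert hli.comp ![0, 1] (by decide) using 1
      funext i
      fin_cases i
      · simpa [coC_val] using hk y
      · simpa [coC_val] using hn y
    · rw [hN]
      congr 1
      ext v
      simp [Fin.exists_fin_two, eq_comm]
  · intro x v hv
    have h := (hf.mem_N hk hn hN v).1 hv
    exact (hf.mem_perp hk hn hN v).2 ⟨h.1, h.2.1⟩
  · intro y _
    constructor
    · refine linearIndependent_unique_iff.2 fun h => hli.ne_zero 0 ?_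
      rw [← hk y]
      simp [comp, CField.ofReal, h, coR_zero]
    · simp
  · intro x v
    -- The metric is real and conjugation exchanges `f 1` and `f 3`, so the conjugate of `v` lies in
    -- `N` exactly when `v` is orthogonal to `f 0`, `f 3` and `f 4`.
    have e : ∀ i j, conjV (f i) = f j → (Fr.metV (Fr.coC x (conjT x v)) (f i) = 0 ↔
        Fr.metV (Fr.coC x v) (f j) = 0) := by
      intro i j h
      rw [coC_conjT, ← conjV_conjV (f i), metV_conjV, h]
      simp
    have hc1' : conjV (f 1) = f 3 := by rw [← hc1, conjV_conjV]
    rw [hf.mem_N hk hn hN, hf.mem_N hk hn hN, e 0 0 hc0, e 1 3 hc1', e 4 4 hc4]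
    have hK : v ∈ (Submodule.span ℝ {k x}).baseChange ℂ ↔ ∃ a : ℂ, a • f 0 = Fr.coC x v := by
      rw [Submodule.baseChange_span, Set.image_singleton, Submodule.mem_span_singleton]
      refine exists_congr fun a => ?_
      rw [← (Fr.coC x).injective.eq_iff, map_smul, ← hk x, ← coC_val]
      simp [CField.val, CField.ofReal]
    rw [hK]
    constructor
    · rintro ⟨⟨h0, h1, h4⟩, -, h3, -⟩
      -- Orthogonality to `f 0`, `f 1`, `f 3`, `f 4` leaves only the coefficient of `f 0`, which is
      -- the product with its dual `f 2`.
      refine ⟨Fr.metV (Fr.coC x v) (f 2), ?_⟩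
      conv_rhs => rw [hf.expand (Fr.coC x v)]
      simp [Fin.sum_univ_five, star, h0, h1, h4, h3]
    · rintro ⟨a, ha⟩
      rw [← ha]
      simp only [map_smul, LinearMap.smul_apply, hf _ _]
      simp [nullMetric, star]

variable (hΓ : ∀ (x : M) (i j k : Fin 5), (i = 0 ∨ i = 1 ∨ i = 4) → (j = 0 ∨ j = 1 ∨ j = 4) →
  (k = 0 ∨ k = 1) → (i ≠ 4 ∨ j ≠ 4) → Fr.gamV x (f i) (f j) (f k) = 0)
include hΓ

/-- `N` is the annihilator of `f 0`, `f 1`, `f 4`, and `metV_bracket` expresses the products of a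
bracket with these constant vectors through Γ alone. -/
theorem IsNull.isIntegrable : IsIntegrable N := by
  intro U hU X Y hX hY x hx
  have m := fun {X : CField M} (hX : IsSectionOn N X U) (y : M) (hy : y ∈ U) => by
    have := (hf.mem_N hk hn hN _).1 (hX.2 y hy)
    rwa [coC_val] at this
  have ex : ∀ {X : CField M}, IsSectionOn N X U → ∃ a b : ℂ, Fr.comp X x = a • f 0 + b • f 1 := by
    intro X hX
    obtain ⟨a, b, h⟩ := Submodule.mem_span_pair.1 ((hf.mem_span _).2 (m hX x hx))
    exact ⟨a, b, h.symm⟩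
  obtain ⟨a, b, hXx⟩ := ex hX
  obtain ⟨c, d, hYx⟩ := ex hY
  rw [hf.mem_N hk hn hN, coC_val]
  have hz : ∀ j, (j = 0 ∨ j = 1 ∨ j = 4) →
      Fr.gamV x (Fr.comp Y x) (f j) (Fr.comp X x) - Fr.gamV x (Fr.comp X x) (f j) (Fr.comp Y x)
        = 0 := by
    intro j hj
    have g0 := fun i k (hi : i = 0 ∨ i = 1) (hk : k = 0 ∨ k = 1) =>
      hΓ x i j k (by tauto) hj hk (Or.inl (by rcases hi with rfl | rfl <;> decide))
    rw [hXx, hYx]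
    simp [g0]
  exact ⟨(Fr.metV_bracket hU hx hX.1 hY.1 (fun y hy => (m hX y hy).1)
      fun y hy => (m hY y hy).1).trans (hz 0 (by simp)),
    (Fr.metV_bracket hU hx hX.1 hY.1 (fun y hy => (m hX y hy).2.1)
      fun y hy => (m hY y hy).2.1).trans (hz 1 (by simp)),
    (Fr.metV_bracket hU hx hX.1 hY.1 (fun y hy => (m hX y hy).2.2)
      fun y hy => (m hY y hy).2.2).trans (hz 4 (by simp))⟩

/-- Products with `f 0` and `f 1` suffice here. The components Γ with i = j = 4, about which `hΓ`
says nothing, enter symmetrically in the two fields and cancel in the antisymmetric bracket. -/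
theorem IsNull.isIntegrable_perp : IsIntegrable (g.perp N) := by
  intro U hU X Y hX hY x hx
  have m := fun {X : CField M} (hX : IsSectionOn (g.perp N) X U) (y : M) (hy : y ∈ U) => by
    have := (hf.mem_perp hk hn hN _).1 (hX.2 y hy)
    rwa [coC_val] at this
  have ex : ∀ {X : CField M}, IsSectionOn (g.perp N) X U →
      ∃ a b c : ℂ, Fr.comp X x = a • f 0 + b • f 1 + c • f 4 := by
    intro X hX
    obtain ⟨h0, h1⟩ := m hX x hx
    have := hf.expand (Fr.comp X x)
    simp only [Fin.sum_univ_five, star, Matrix.cons_val, h0, h1, zero_smul, add_zero] at this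
    exact ⟨_, _, _, this⟩
  obtain ⟨a, b, c, hXx⟩ := ex hX
  obtain ⟨a', b', c', hYx⟩ := ex hY
  rw [hf.mem_perp hk hn hN, coC_val]
  have hz : ∀ j, (j = 0 ∨ j = 1) →
      Fr.gamV x (Fr.comp Y x) (f j) (Fr.comp X x) - Fr.gamV x (Fr.comp X x) (f j) (Fr.comp Y x)
        = 0 := by
    intro j hj
    have g0 := fun i k (hi : i = 0 ∨ i = 1 ∨ i = 4) (hk : k = 0 ∨ k = 1 ∨ k = 4)
      (hik : i ≠ 4 ∨ k ≠ 4) => hΓ x i k j hi hk hj hik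
    rw [Fr.gamV_skew x _ (f j), Fr.gamV_skew x _ (f j), hXx, hYx]
    simp only [map_add, map_smul, LinearMap.add_apply, LinearMap.smul_apply, smul_eq_mul,
      g0 0 0 (by simp) (by simp) (by simp), g0 0 1 (by simp) (by simp) (by simp),
      g0 0 4 (by simp) (by simp) (by simp), g0 1 0 (by simp) (by simp) (by simp),
      g0 1 1 (by simp) (by simp) (by simp), g0 1 4 (by simp) (by simp) (by simp),
      g0 4 0 (by simp) (by simp) (by simp), g0 4 1 (by simp) (by simp) (by simp)]
    ring
  exact ⟨(Fr.metV_bracket hU hx hX.1 hY.1 (fun y hy => (m hX y hy).1)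
      fun y hy => (m hY y hy).1).trans (hz 0 (by simp)),
    (Fr.metV_bracket hU hx hX.1 hY.1 (fun y hy => (m hX y hy).2)
      fun y hy => (m hY y hy).2).trans (hz 1 (by simp))⟩

end

end OrthoFrame
end Optical

/-! ### The grading argument, and passage from the dense set to the whole manifold. -/

namespace Optical

variable {M : Type*} [TopologicalSpace M] [ChartedSpace E5 M] [IsManifold (𝓡 5) ∞ M]
variable {U : Set M} {x : M} {g : LorentzMetric M}

/-- Components of positive degree vanish for a tensor with the symmetries of the Weyl tensor which
is algebraically special. -/
theorem eq_zero_of_degree {c : Fin 5 → Fin 5 → Fin 5 → Fin 5 → ℂ} (d : Fin 5 → ℤ)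
    (hd : ∀ i, d i ≤ 1)
    (hs : ∀ i j k l, c i j k l = -c j i k l) (hp : ∀ i j k l, c i j k l = c k l i j)
    (hc : ∀ i j k l, c i j k l + c j k i l + c k i j l = 0)
    (h : ∀ i j k l, 0 ≤ d i → 0 ≤ d j → d k = 1 → c i j k l = 0) {i j k l : Fin 5}
    (hdeg : 1 ≤ d i + d j + d k + d l) : c i j k l = 0 := by
  have hs' : ∀ i j k l, c i j k l = -c i j l k := fun i j k l => by rw [hp, hs, hp]
  -- If the total degree is positive, one of the two pairs has positive degree; pair symmetry lets
  -- it be the first. Both of its indices then have nonnegative degree, since no degree exceeds 1.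
  have key : ∀ {i j k l}, 1 ≤ d i + d j → 1 ≤ d i + d j + d k + d l → c i j k l = 0 := by
    intro i j k l h1 h2
    have hi := hd i
    have hj := hd j
    have hi0 : 0 ≤ d i := by omega
    have hj0 : 0 ≤ d j := by omega
    by_cases hk : d k = 1
    · exact h _ _ _ _ hi0 hj0 hk
    by_cases hl : d l = 1
    · rw [hs', h _ _ _ _ hi0 hj0 hl, neg_zero]
    have hk' := hd k
    have hl' := hd l
    -- Covers the case where one of the last two degrees is negative, which forces degree 1 on `i`
    -- and `j` and degree 0 on the other one: the cyclic identity moves an index of degree 1 into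
    -- the third slot.
    have cyc : ∀ k l, 0 ≤ d k → d i = 1 → d j = 1 → c i j k l = 0 := by
      intro k l hk hi hj
      have := hc i j k l
      rwa [h j k i l hj0 hk hi, h k i j l hk hi0 hj, add_zero, add_zero] at this
    by_cases hk0 : d k = 0
    · by_cases hl0 : d l = 0
      · rw [hp]
        by_cases hi1 : d i = 1
        · exact h _ _ _ _ hk0.ge hl0.ge hi1
        · rw [hs', h _ _ _ _ hk0.ge hl0.ge (by omega), neg_zero]
      · exact cyc _ _ hk0.ge (by omega) (by omega)
    · rw [hs', cyc l k (by omega) (by omega) (by omega), neg_zero]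
  by_cases h1 : 1 ≤ d i + d j
  · exact key h1 hdeg
  · rw [hp]
    exact key (by omega) (by omega)

namespace OrthoFrame
variable {Fr : OrthoFrame g} {f : Fin 5 → CV} {N : CDist M} {k : RField M} {n : CField M}

theorem weylV_conjV (x : M) (v w y z : CV) :
    Fr.weylV x (conjV v) (conjV w) (conjV y) (conjV z) = starRingEnd ℂ (Fr.weylV x v w y z) := by
  simp only [weylV, lin4_apply, conjV, map_sum, map_mul, Complex.conj_ofReal]

/-- Genericity holds only on a dense set; continuity carries the vanishing of Γ to the remaining
points. -/
theorem continuous_gamV (v w y : CV) : Continuous fun x => Fr.gamV x v w y := by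
  have h : ∀ a b c, Continuous fun x => Fr.gam x a b c := fun a b c =>
    continuousOn_univ.1 (g.smooth_inner (Fr.smooth_nabla isOpen_univ (Fr.smooth a) (Fr.smooth b))
      (Fr.smooth c)).continuousOn
  simp only [gamV, lin3, lin_apply, LinearMap.sum_apply, LinearMap.smul_apply, smul_eq_mul]
  exact continuous_finsetSum _ fun a _ => continuous_const.mul <|
    continuous_finsetSum _ fun b _ => continuous_const.mul <|
    continuous_finsetSum _ fun c _ => continuous_const.mul <|
    Complex.continuous_ofReal.comp (h a b c)

section
variable (hf : Fr.IsNull f) (hk : ∀ x, Fr.comp (CField.ofReal k) x = f 0)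
  (hn : ∀ x, Fr.comp n x = f 1)
  (hN : ∀ x, N x = Submodule.span ℂ {(CField.ofReal k).val x, n.val x})
  {Z : Fin 5 → CField M} (hZs : ∀ i, (Z i).SmoothOn Set.univ) (hZ : ∀ i x, Fr.comp (Z i) x = f i)
include hf hk hn hN hZs hZ

theorem IsNull.isSection {i : Fin 5} (hi : i = 0 ∨ i = 1) : IsSection N (Z i) := by
  refine ⟨hZs i, fun x _ => (hf.mem_N hk hn hN _).2 ?_⟩
  rw [coC_val, hZ, hf, hf, hf]
  rcases hi with rfl | rfl <;> simp [nullMetric, star]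

theorem IsNull.isSection_perp {i : Fin 5} (hi : i = 0 ∨ i = 1 ∨ i = 4) :
    IsSection (g.perp N) (Z i) := by
  refine ⟨hZs i, fun x _ => (hf.mem_perp hk hn hN _).2 ?_⟩
  rw [coC_val, hZ, hf, hf]
  rcases hi with rfl | rfl | rfl <;> simp [nullMetric, star]

theorem IsNull.weylV_eq_zero (hW : WeylSpecial g N) (x : M) {i j r : Fin 5} (s : Fin 5)
    (hi : i = 0 ∨ i = 1 ∨ i = 4) (hj : j = 0 ∨ j = 1 ∨ j = 4) (hr : r = 0 ∨ r = 1) :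
    Fr.weylV x (f i) (f j) (f r) (f s) = 0 := by
  rw [← hZ i x, ← hZ j x, ← hZ r x, ← hZ s x, ← Fr.weylC_eq (hZs i) (hZs j) (hZs r) (hZs s)]
  exact hW _ _ _ _ (hf.isSection_perp hk hn hN hZs hZ hi) (hf.isSection_perp hk hn hN hZs hZ hj)
    (hf.isSection hk hn hN hZs hZ hr) (hZs s) x

theorem IsNull.cottonV_eq_zero (hA : CottonDegenerate g N) (x : M) (r i j : Fin 5)
    (hr : r = 0 ∨ r = 1) (hi : i = 0 ∨ i = 1 ∨ i = 4) (hj : j = 0 ∨ j = 1 ∨ j = 4) :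
    Fr.cottonV x (f r) (f i) (f j) = 0 := by
  rw [← hZ i x, ← hZ j x, ← hZ r x, ← Fr.cottonC_eq (hZs i) (hZs j) (hZs r)]
  exact hA _ _ _ (hf.isSection_perp hk hn hN hZs hZ hi) (hf.isSection_perp hk hn hN hZs hZ hj)
    (hf.isSection hk hn hN hZs hZ hr) x

/-- A null frame in which the Weyl tensor is generically of type D, and for which the Cotton-York
tensor degenerates, gives an optical structure. -/
theorem IsNull.isOpticalStructure (hks : SmoothOn k Set.univ) (hns : n.SmoothOn Set.univ)
    (hc0 : conjV (f 0) = f 0) (hc1 : conjV (f 3) = f 1) (hc4 : conjV (f 4) = f 4)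
    (hwt : ∀ (x : M) (i j k l : Fin 5), wt i + wt j + wt k + wt l ≠ 0 →
      Fr.weylV x (f i) (f j) (f k) (f l) = 0)
    (hA : CottonDegenerate g N)
    (hgen : Dense {x : M | Fr.weylV x (f 0) (f 1) (f 2) (f 3) ≠ 0 ∧
      Fr.weylV x (f 0) (f 4) (f 2) (f 4) ≠ 0 ∧
      Fr.weylV x (f 0) (f 1) (f 2) (f 3) ≠ Fr.weylV x (f 0) (f 4) (f 2) (f 4) ∧
      Fr.weylV x (f 0) (f 1) (f 2) (f 3) ≠ -Fr.weylV x (f 0) (f 4) (f 2) (f 4)}) :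
    IsOpticalStructure g N fun x => Submodule.span ℝ {k x} := by
  have hA' := hf.cottonV_eq_zero hk hn hN hZs hZ hA
  have hΓ : ∀ (x : M) (i j k : Fin 5), (i = 0 ∨ i = 1 ∨ i = 4) → (j = 0 ∨ j = 1 ∨ j = 4) →
      (k = 0 ∨ k = 1) → (i ≠ 4 ∨ j ≠ 4) → Fr.gamV x (f i) (f j) (f k) = 0 := by
    intro x i j k hi hj hk hij
    have := Continuous.ext_on hgen (continuous_gamV (Fr := Fr) (f i) (f j) (f k))
      (continuous_const (y := (0 : ℂ))) fun y hy =>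
        (typeD hf hwt hA' y).gamma_eq_zero hy.1 hy.2.1 hy.2.2.1 hy.2.2.2 i j k hi hj hk hij
    exact congrFun this x
  exact ⟨hf.isAlmostOpticalStructure hk hn hN hks hns hc0 hc1 hc4,
    hf.isIntegrable hk hn hN hΓ, hf.isIntegrable_perp hk hn hN hΓ⟩

end

end OrthoFrame
end Optical

/-! ### The given null frame, type D, and the two optical structures. -/

namespace Optical

variable {M : Type*} [TopologicalSpace M] [ChartedSpace E5 M] [IsManifold (𝓡 5) ∞ M]
variable {x : M} {g : LorentzMetric M}

theorem formC_val (X Y : CField M) (x : M) : g.formC x (X.val x) (Y.val x) =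
    ((g.val x (X.re x) (Y.re x) - g.val x (X.im x) (Y.im x) : ℝ) : ℂ) +
      ((g.val x (X.re x) (Y.im x) + g.val x (X.im x) (Y.re x) : ℝ) : ℂ) * Complex.I := by
  simp only [LorentzMetric.formC, CField.val, map_add, LinearMap.add_apply,
    LinearMap.BilinForm.baseChange_tmul, LorentzMetric.form, LinearMap.mk₂_apply,
    Complex.real_smul]
  push_cast
  linear_combination (g.val x (X.im x) (Y.im x) : ℂ) * Complex.I_mul_I

/-- The exchange of `k` and `l` in a null frame. -/
def flip : Fin 5 → Fin 5 := ![2, 1, 0, 3, 4]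

/-- Complex conjugation in a null frame. -/
def cj : Fin 5 → Fin 5 := ![0, 3, 2, 1, 4]

/-- A tensor with the symmetries of the Weyl tensor, real and algebraically special relative to two
optical structures, is of type D. -/
theorem eq_zero_of_wt {c : Fin 5 → Fin 5 → Fin 5 → Fin 5 → ℂ}
    (hs : ∀ i j k l, c i j k l = -c j i k l) (hp : ∀ i j k l, c i j k l = c k l i j)
    (hc : ∀ i j k l, c i j k l + c j k i l + c k i j l = 0)
    (hcj : ∀ i j k l, c (cj i) (cj j) (cj k) (cj l) = 0 → c i j k l = 0)
    (h1 : ∀ i j k l, i = 0 ∨ i = 1 ∨ i = 4 → j = 0 ∨ j = 1 ∨ j = 4 → k = 0 ∨ k = 1 →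
      c i j k l = 0)
    (h0 : ∀ i j k l, i = 0 ∨ i = 1 ∨ i = 4 → j = 0 ∨ j = 1 ∨ j = 4 → k = 0 ∨ k = 1 →
      c (flip i) (flip j) (flip k) (flip l) = 0)
    {i j k l : Fin 5} (h : wt i + wt j + wt k + wt l ≠ 0) : c i j k l = 0 := by
  have flip_flip : ∀ i, flip (flip i) = i := by decide
  have h0' : ∀ i j k l, i = 2 ∨ i = 1 ∨ i = 4 → j = 2 ∨ j = 1 ∨ j = 4 → k = 2 ∨ k = 1 →
      c i j k l = 0 := by
    intro i j k l hi hj hk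
    have := h0 (flip i) (flip j) (flip k) (flip l) (by revert i; decide) (by revert j; decide)
      (by revert k; decide)
    simpa only [flip_flip] using this
  have key := fun (d : Fin 5 → ℤ) hd hv => eq_zero_of_degree (i := i) (j := j) (k := k) (l := l)
    d hd hs hp hc hv
  by_contra hne
  -- The four gradings belong to span{k, m̄}, span{l, m̄} and their conjugates span{k, m}, span{l,
  -- m}. A nonzero component has degree at most 0 in each, so both entries of its weight vanish.
  have a1 := mt (key (fun i => (wt i).1 + (wt i).2) (by decide) fun i j k l hi hj hk =>
    h1 i j k l (by revert i; decide) (by revert j; decide) (by revert k; decide)) hne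
  have a2 := mt (key (fun i => -(wt i).1 + (wt i).2) (by decide) fun i j k l hi hj hk =>
    h0' i j k l (by revert i; decide) (by revert j; decide) (by revert k; decide)) hne
  have a3 := mt (key (fun i => (wt i).1 - (wt i).2) (by decide) fun i j k l hi hj hk =>
    hcj _ _ _ _ (h1 _ _ _ _ (by revert i; decide) (by revert j; decide)
      (by revert k; decide))) hne
  have a4 := mt (key (fun i => -(wt i).1 - (wt i).2) (by decide) fun i j k l hi hj hk =>
    hcj _ _ _ _ (h0' _ _ _ _ (by revert i; decide) (by revert j; decide)
      (by revert k; decide))) hne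
  refine h (Prod.ext ?_ ?_) <;> simp only [Prod.fst_add, Prod.snd_add, Prod.fst_zero,
    Prod.snd_zero] <;> omega

namespace NullFrame
variable (F : NullFrame g)

theorem real_products (x : M) {v : RField M}
    (h : g.formC x ((CField.ofReal v).val x) (F.m.val x) = 0) :
    g.val x (v x) (F.m.re x) = 0 ∧ g.val x (v x) (F.m.im x) = 0 := by
  rw [formC_val] at h
  have h1 := congrArg Complex.re h
  have h2 := congrArg Complex.im h
  simp [CField.ofReal] at h1 h2
  exact ⟨h1, h2⟩

theorem m_products (x : M) : g.val x (F.m.re x) (F.m.re x) = 1 / 2 ∧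
    g.val x (F.m.im x) (F.m.im x) = 1 / 2 ∧ g.val x (F.m.re x) (F.m.im x) = 0 := by
  have h := F.mm x
  have h' := F.m_conj x
  rw [formC_val] at h h'
  have h1 := congrArg Complex.re h
  have h2 := congrArg Complex.im h
  have h3 := congrArg Complex.re h'
  simp [CField.conj] at h1 h2 h3
  rw [g.symm x (F.m.im x) (F.m.re x)] at h2
  exact ⟨by linarith, by linarith, by linarith⟩

/-- The orthogonal frame of a null frame. -/
def orthoFrame : OrthoFrame g where
  E a x := ![F.k x - F.l x, F.k x + F.l x, F.u x, F.m.re x, F.m.im x] a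
  -- The squares of k ∓ l are ∓2 g(k, l). Since g(m, m) = 0 and g(m, m̄) = 1, the real and imaginary
  -- parts of `m` are orthogonal with square 1/2.
  η := ![-2, 2, 1, 1 / 2, 1 / 2]
  η_ne a := by fin_cases a <;> norm_num
  smooth a := by
    fin_cases a
    · exact F.smooth_k.sub F.smooth_l
    · exact F.smooth_k.add F.smooth_l
    · exact F.smooth_u
    · exact F.smooth_m.1
    · exact F.smooth_m.2
  orth a b x := by
    have kk : g.val x (F.k x) (F.k x) = 0 := F.kk x
    have ll : g.val x (F.l x) (F.l x) = 0 := F.ll x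
    have uu : g.val x (F.u x) (F.u x) = 1 := F.uu x
    have kl : g.val x (F.k x) (F.l x) = 1 := F.kl x
    have ku : g.val x (F.k x) (F.u x) = 0 := F.ku x
    have lu : g.val x (F.l x) (F.u x) = 0 := F.lu x
    obtain ⟨k1, k2⟩ := F.real_products x (F.km x)
    obtain ⟨l1, l2⟩ := F.real_products x (F.lm x)
    obtain ⟨u1, u2⟩ := F.real_products x (F.um x)
    obtain ⟨m1, m2, m3⟩ := F.m_products x
    have lk := (g.symm x (F.l x) (F.k x)).trans kl
    have uk := (g.symm x (F.u x) (F.k x)).trans ku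
    have ul := (g.symm x (F.u x) (F.l x)).trans lu
    have k1' := (g.symm x (F.m.re x) (F.k x)).trans k1
    have k2' := (g.symm x (F.m.im x) (F.k x)).trans k2
    have l1' := (g.symm x (F.m.re x) (F.l x)).trans l1
    have l2' := (g.symm x (F.m.im x) (F.l x)).trans l2
    have u1' := (g.symm x (F.m.re x) (F.u x)).trans u1
    have u2' := (g.symm x (F.m.im x) (F.u x)).trans u2
    have m3' := (g.symm x (F.m.im x) (F.m.re x)).trans m3
    fin_cases a <;> fin_cases b <;> simp [LorentzMetric.inner, *] <;> norm_num

/-- The components of the vectors `k, m̄, l, m, u`. -/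
def vec : Fin 5 → CV :=
  ![![1 / 2, 1 / 2, 0, 0, 0], ![0, 0, 0, 1, -Complex.I], ![-1 / 2, 1 / 2, 0, 0, 0],
    ![0, 0, 0, 1, Complex.I], ![0, 0, 1, 0, 0]]

/-- The vector fields `k, m̄, l, m, u`. -/
def field : Fin 5 → CField M :=
  ![CField.ofReal F.k, F.m.conj, CField.ofReal F.l, F.m, CField.ofReal F.u]

theorem smooth_field (i : Fin 5) : (F.field i).SmoothOn Set.univ := by
  fin_cases i
  · exact ⟨F.smooth_k, smoothOn_zero⟩
  · exact ⟨F.smooth_m.1, F.smooth_m.2.neg⟩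
  · exact ⟨F.smooth_l, smoothOn_zero⟩
  · exact F.smooth_m
  · exact ⟨F.smooth_u, smoothOn_zero⟩

theorem coR_eq {v : TangentSpace (𝓡 5) x} (c : Fin 5 → ℝ)
    (h : v = ∑ a, c a • F.orthoFrame.E a x) : F.orthoFrame.coR v = fun a => (c a : ℂ) := by
  funext b
  have h0 := F.orthoFrame.η_ne b
  have : F.orthoFrame.co b v = c b := by
    rw [h, OrthoFrame.co]
    simp [OrthoFrame.orth', h0]
  rw [OrthoFrame.coR, this]

theorem comp_field (i : Fin 5) (x : M) : F.orthoFrame.comp (F.field i) x = vec i := by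
  have hk : F.orthoFrame.coR (F.k x) = _ := F.coR_eq ![1 / 2, 1 / 2, 0, 0, 0] (by
    simp [Fin.sum_univ_five, orthoFrame]; module)
  have hl : F.orthoFrame.coR (F.l x) = _ := F.coR_eq ![-1 / 2, 1 / 2, 0, 0, 0] (by
    simp [Fin.sum_univ_five, orthoFrame]; module)
  have hu : F.orthoFrame.coR (F.u x) = _ := F.coR_eq ![0, 0, 1, 0, 0] (by
    simp [Fin.sum_univ_five, orthoFrame])
  have h1 : F.orthoFrame.coR (F.m.re x) = _ := F.coR_eq ![0, 0, 0, 1, 0] (by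
    simp [Fin.sum_univ_five, orthoFrame])
  have h2 : F.orthoFrame.coR (F.m.im x) = _ := F.coR_eq ![0, 0, 0, 0, 1] (by
    simp [Fin.sum_univ_five, orthoFrame])
  fin_cases i <;> funext a <;> fin_cases a <;>
    simp [OrthoFrame.comp, field, vec, CField.ofReal, CField.conj, OrthoFrame.coR_zero,
      OrthoFrame.coR_neg, hk, hl, hu, h1, h2]

theorem isNull_vec : F.orthoFrame.IsNull vec := by
  intro i j
  rw [OrthoFrame.metV_eq_sum]
  simp only [OrthoFrame.metV_symm _ (vec i), OrthoFrame.metV_bas_left]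
  fin_cases i <;> fin_cases j <;>
    simp [Fin.sum_univ_five, vec, orthoFrame, nullMetric, star] <;> norm_num [mul_left_comm Complex.I]

theorem conjV_vec (i : Fin 5) : conjV (vec i) = vec (cj i) := by
  fin_cases i <;> funext a <;> fin_cases a <;> simp [conjV, vec, cj, map_ofNat]

theorem isNull_vec_flip : F.orthoFrame.IsNull (vec ∘ flip) := by
  intro i j
  have : (flip j = star (flip i)) = (j = star i) := by revert i j; decide
  simp only [Function.comp_apply, F.isNull_vec _ _, nullMetric, this]

theorem coR_of (v : RField M) (x : M) :
    F.orthoFrame.coR (v x) = F.orthoFrame.comp (CField.ofReal v) x := by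
  simp [OrthoFrame.comp, CField.ofReal, OrthoFrame.coR_zero]

theorem psi2_eq (x : M) : F.psi2 x = F.orthoFrame.weylV x (vec 0) (vec 1) (vec 2) (vec 3) := by
  have h := F.orthoFrame.weylC_eq (F.smooth_field 0) (F.smooth_field 1) (F.smooth_field 2)
    (F.smooth_field 3) x
  rwa [comp_field, comp_field, comp_field, comp_field] at h

theorem psi20_eq (x : M) :
    F.psi20 x = F.orthoFrame.weylV x (vec 0) (vec 4) (vec 2) (vec 4) := by
  have h := F.orthoFrame.weyl_eq isOpen_univ (Set.mem_univ x) F.smooth_k F.smooth_u F.smooth_l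
    F.smooth_u
  rw [coR_of, coR_of, coR_of] at h
  exact h.trans (by rw [← F.comp_field 0 x, ← F.comp_field 2 x, ← F.comp_field 4 x]; rfl)

/-- The Weyl tensor of a null frame is of type D if it is algebraically special relative to both
null structures. -/
theorem weylV_eq_zero (hW0 : WeylSpecial g F.N0) (hW1 : WeylSpecial g F.N1) (x : M)
    (i j k l : Fin 5) (h : wt i + wt j + wt k + wt l ≠ 0) :
    F.orthoFrame.weylV x (vec i) (vec j) (vec k) (vec l) = 0 := by
  refine eq_zero_of_wt (c := fun i j k l => F.orthoFrame.weylV x (vec i) (vec j) (vec k) (vec l))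
    (fun i j k l => F.orthoFrame.weylV_skew x _ _ _ _)
    (fun i j k l => F.orthoFrame.weylV_pair x _ _ _ _)
    (fun i j k l => F.orthoFrame.weylV_cyclic x _ _ _ _) (fun i j k l h => ?_)
    (fun i j k l hi hj hk => F.isNull_vec.weylV_eq_zero (F.comp_field 0)
      (F.comp_field 1) (fun _ => rfl) F.smooth_field F.comp_field hW1 x l hi hj hk)
    (fun i j k l hi hj hk => F.isNull_vec_flip.weylV_eq_zero (F.comp_field 2)
      (F.comp_field 1) (fun _ => rfl) (fun i => F.smooth_field (flip i))
      (fun i => F.comp_field (flip i)) hW0 x l hi hj hk) h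
  rwa [← conjV_vec, ← conjV_vec, ← conjV_vec, ← conjV_vec, OrthoFrame.weylV_conjV,
    map_eq_zero] at h

theorem isOpticalStructure_one (hW0 : WeylSpecial g F.N0) (hW1 : WeylSpecial g F.N1)
    (hA1 : CottonDegenerate g F.N1) (hgen : F.GenericPsi) : IsOpticalStructure g F.N1 F.K := by
  refine F.isNull_vec.isOpticalStructure (F.comp_field 0) (F.comp_field 1) (fun _ => rfl)
    F.smooth_field F.comp_field F.smooth_k (F.smooth_field 1) (conjV_vec 0) (conjV_vec 3)
    (conjV_vec 4) (F.weylV_eq_zero hW0 hW1) hA1 (hgen.mono fun x hx => ?_)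
  simpa only [Set.mem_ofPred_eq, ← psi2_eq, ← psi20_eq, Complex.ofReal_ne_zero] using hx

/-- The frame (l, m̄, k, m, u) is again null, with `N0` spanned by its first two vectors. By pair
symmetry and reality its Ψ₂ is the conjugate of the original one and its Ψ₂⁰ is unchanged, so
genericity persists. -/
theorem isOpticalStructure_zero (hW0 : WeylSpecial g F.N0) (hW1 : WeylSpecial g F.N1)
    (hA0 : CottonDegenerate g F.N0) (hgen : F.GenericPsi) : IsOpticalStructure g F.N0 F.L := by
  refine F.isNull_vec_flip.isOpticalStructure (F.comp_field 2) (F.comp_field 1) (fun _ => rfl)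
    (fun i => F.smooth_field (flip i)) (fun i => F.comp_field (flip i)) F.smooth_l
    (F.smooth_field 1) (conjV_vec 2) (conjV_vec 3) (conjV_vec 4) (fun x i j k l h => ?_) hA0
    (hgen.mono fun x hx => ?_)
  · have hw : ∀ i, wt (flip i) = (-(wt i).1, (wt i).2) := by decide
    refine F.weylV_eq_zero hW0 hW1 x _ _ _ _ fun h' => h ?_
    simp only [hw, Prod.ext_iff, Prod.fst_add, Prod.snd_add, Prod.fst_zero, Prod.snd_zero] at h' ⊢
    omega
  · have c0 : conjV (vec 0) = vec 0 := conjV_vec 0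
    have c1 : conjV (vec 1) = vec 3 := conjV_vec 1
    have c2 : conjV (vec 2) = vec 2 := conjV_vec 2
    have c3 : conjV (vec 3) = vec 1 := conjV_vec 3
    have f0 : (vec ∘ flip) 0 = vec 2 := rfl
    have f1 : (vec ∘ flip) 1 = vec 1 := rfl
    have f2 : (vec ∘ flip) 2 = vec 0 := rfl
    have f3 : (vec ∘ flip) 3 = vec 3 := rfl
    have f4 : (vec ∘ flip) 4 = vec 4 := rfl
    have e1 : F.orthoFrame.weylV x ((vec ∘ flip) 0) ((vec ∘ flip) 1) ((vec ∘ flip) 2)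
        ((vec ∘ flip) 3) = starRingEnd ℂ (F.psi2 x) := by
      rw [psi2_eq, ← OrthoFrame.weylV_conjV, c0, c1, c2, c3, f0, f1, f2, f3,
        OrthoFrame.weylV_pair]
    have e2 : F.orthoFrame.weylV x ((vec ∘ flip) 0) ((vec ∘ flip) 4) ((vec ∘ flip) 2)
        ((vec ∘ flip) 4) = F.psi20 x := by
      rw [psi20_eq, f0, f2, f4, OrthoFrame.weylV_pair]
    -- Writing the real Ψ₂⁰ as its own conjugate makes the conditions conjugates of the given ones,
    -- so injectivity of conjugation transfers them.
    have hr : (F.psi20 x : ℂ) = starRingEnd ℂ (F.psi20 x : ℂ) := (Complex.conj_ofReal _).symm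
    obtain ⟨h1, h2, h3, h4⟩ := hx
    rw [Set.mem_ofPred_eq, e1, e2, hr, ← map_neg]
    have inj := (starRingEnd ℂ).injective
    exact ⟨(map_ne_zero _).2 h1, (map_ne_zero _).2 (by exact_mod_cast h2), inj.ne h3, inj.ne h4⟩

end NullFrame
end Optical

end

theorem mainTheorem3 {M : Type*} [TopologicalSpace M] [ChartedSpace Optical.E5 M]
    [IsManifold (𝓡 5) ∞ M] (g : Optical.LorentzMetric M) (F : Optical.NullFrame g)
    (hW0 : Optical.WeylSpecial g F.N0) (hW1 : Optical.WeylSpecial g F.N1)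
    (hA0 : Optical.CottonDegenerate g F.N0) (hA1 : Optical.CottonDegenerate g F.N1)
    (hgen : F.GenericPsi) :
    Optical.IsOpticalStructure g F.N0 F.L ∧ Optical.IsOpticalStructure g F.N1 F.K := by
  exact ⟨F.isOpticalStructure_zero hW0 hW1 hA0 hgen, F.isOpticalStructure_one hW0 hW1 hA1 hgen⟩
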